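/- Let $d,s$ be non-negative integers, $\mathbb T^n=\mathbb R^n/\mathbb Z^n$, and let $A,B\in \mathrm{GL}(d,\mathbb Z)$ be commuting matrices; write $A,B$ also for the induced automorphisms of $\mathbb T^d$. Assume that $A^lB^k$ is ergodic on $\mathbb T^d$ (with respect to Haar measure) for every $(l,k)\in\mathbb Z^2\setminus\{(0,0)\}$. For a smooth function $f$ on $\mathbb T^d\times\mathbb T^s$ with values in $\mathbb R^m$ and $r\in\mathbb N=\{0,1,2,\dots\}$ let $\|f\|_{C^r}=\max_{|j|\le r}\sup|\partial^j f|$, where $j$ runs over multi-indices in all $d+s$ variables and $|\cdot|$ is the maximum norm on $\mathbb R^m$. (1) Twisted case. There is an integer $\sigma_1>0$, depending only on $d$ and on the eigenvalues of $A$ and $B$, and there are constants $C_r$ ($r\in\mathbb N$), depending only on $r,d,s,A,B$, such that the following holds. Let $R,S\in C^\infty(\mathbb T^d\times\mathbb T^s,\mathbb R^d)$ satisfy $$\mathcal L_1(R,S):=\big(R(Bx,y)-B\,R(x,y)\big)-\big(S(Ax,y)-A\,S(x,y)\big)=0 .$$ Then there is a unique $\Omega\in C^\infty(\mathbb T^d\times\mathbb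 T^s,\mathbb R^d)$ with $$\Omega(Ax,y)-A\,\Omega(x,y)=R(x,y),\qquad \Omega(Bx,y)-B\,\Omega(x,y)=S(x,y),$$ and $\|\Omega\|_{C^r}\le C_r\|R\|_{C^{r+\sigma_1}}$ for all $r\in\mathbb N$. (2) Untwisted case. There are constants $C_r$ ($r\in\mathbb N$), depending only on $r,d,s,A,B$, such that the following holds. Let $R,S\in C^\infty(\mathbb T^d\times\mathbb T^s,\mathbb R^s)$ satisfy $$\mathcal L_2(R,S):=\big(R(Bx,y)-R(x,y)\big)-\big(S(Ax,y)-S(x,y)\big)=0$$ and $\int_{\mathbb T^d}R(x,y)\,dx=\int_{\mathbb T^d}S(x,y)\,dx=0$ for all $y\in\mathbb T^s$. Then there is a unique $\Omega\in C^\infty(\mathbb T^d\times\mathbb T^s,\mathbb R^s)$ with $\int_{\mathbb T^d}\Omega(x,y)\,dx=0$ for all $y\in\mathbb T^s$ and $$\Omega(Ax,y)-\Omega(x,y)=R(x,y),\qquad \Omega(Bx,y)-\Omega(x,y)=S(x,y),$$ and $\|\Omega\|_{C^r}\le C_r\|R\|_{C^{r+d+2}}$ for all $r\in\mathbb N$.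 -/

import Mathlib

open MeasureTheory
open scoped ContDiff NNReal ENNReal

/-- The torus `𝕋ⁿ = (ℝ/ℤ)ⁿ`. Its measure `volume` is the Haar probability measure. -/
abbrev Torus (n : ℕ) : Type := Fin n → UnitAddCircle

/-- The covering map `ℝⁿ → 𝕋ⁿ`. -/
def torusProj {n : ℕ} (x : Fin n → ℝ) : Torus n := fun i => (x i : UnitAddCircle)

/-- The automorphism `x ↦ M x` of `𝕋ᵈ` induced by an integer matrix `M` with determinant `±1`. -/
def torusAut {d : ℕ} (M : Matrix.GeneralLinearGroup (Fin d) ℤ) (x : Torus d) : Torus d :=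
  fun i => ∑ j, (M : Matrix (Fin d) (Fin d) ℤ) i j • x j

/-- The linear action `v ↦ M v` on `ℝᵈ` of an integer matrix `M` with determinant `±1`. -/
def linAct {d : ℕ} (M : Matrix.GeneralLinearGroup (Fin d) ℤ) (v : Fin d → ℝ) : Fin d → ℝ :=
  ((M : Matrix (Fin d) (Fin d) ℤ).map (Int.cast : ℤ → ℝ)).mulVec v

/-- The set of complex eigenvalues of an integer matrix with determinant `±1`. -/
def eigenvalueSet {d : ℕ} (M : Matrix.GeneralLinearGroup (Fin d) ℤ) : Set ℂ :=
  spectrum ℂ ((M : Matrix (Fin d) (Fin d) ℤ).map (Int.cast : ℤ → ℂ))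

/-- The higher rank condition: `Aˡ Bᵏ` is ergodic on `𝕋ᵈ` for every `(l, k) ≠ (0, 0)` in `ℤ²`. -/
def HigherRank {d : ℕ} (A B : Matrix.GeneralLinearGroup (Fin d) ℤ) : Prop :=
  ∀ l k : ℤ, (l, k) ≠ (0, 0) → Ergodic (torusAut (A ^ l * B ^ k)) (volume : Measure (Torus d))

section Functions

variable {d s m : ℕ}

/-- The periodic function on `ℝᵈ × ℝˢ` defined by a function on `𝕋ᵈ × 𝕋ˢ`. -/
def torusLift (f : Torus d × Torus s → Fin m → ℝ) :
    (Fin d → ℝ) × (Fin s → ℝ) → Fin m → ℝ :=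
  fun p => f (torusProj p.1, torusProj p.2)

/-- `f ∈ C^∞(𝕋ᵈ × 𝕋ˢ, ℝᵐ)`. -/
def TorusSmooth (f : Torus d × Torus s → Fin m → ℝ) : Prop :=
  ContDiff ℝ ∞ (torusLift f)

/-- The coordinate directions of `ℝᵈ × ℝˢ`, first those of the base, then those of the fiber. -/
def coordDir : Fin d ⊕ Fin s → (Fin d → ℝ) × (Fin s → ℝ) :=
  Sum.elim (fun i => (Pi.single i 1, 0)) (fun j => (0, Pi.single j 1))

/-- The partial derivative `∂_{v₀} ⋯ ∂_{v_{k-1}} f` in the coordinates listed by `v`. -/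
noncomputable def torusPartial {k : ℕ} (v : Fin k → Fin d ⊕ Fin s)
    (f : Torus d × Torus s → Fin m → ℝ) (p : (Fin d → ℝ) × (Fin s → ℝ)) : Fin m → ℝ :=
  iteratedFDeriv ℝ k (torusLift f) p (fun i => coordDir (v i))

/-- The `C^r` norm: the largest supremum of a partial derivative of order at most `r`. It takes
values in `[0, ∞]` and is finite on smooth functions. -/
noncomputable def crNorm (r : ℕ) (f : Torus d × Torus s → Fin m → ℝ) : ℝ≥0∞ :=
  ⨆ (k : ℕ) (_ : k ≤ r) (v : Fin k → Fin d ⊕ Fin s) (p : (Fin d → ℝ) × (Fin s → ℝ)),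
    ‖torusPartial v f p‖ₑ

/-- The twisted coboundary operator `(Δ^M f)(x, y) = f(Mx, y) - M f(x, y)`. -/
def twistedDelta (M : Matrix.GeneralLinearGroup (Fin d) ℤ)
    (f : Torus d × Torus s → Fin d → ℝ) : Torus d × Torus s → Fin d → ℝ :=
  fun p => f (torusAut M p.1, p.2) - linAct M (f p)

/-- The untwisted coboundary operator `f ↦ f(Mx, y) - f(x, y)`. -/
def untwistedDelta (M : Matrix.GeneralLinearGroup (Fin d) ℤ)
    (f : Torus d × Torus s → Fin m → ℝ) : Torus d × Torus s → Fin m → ℝ :=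
  fun p => f (torusAut M p.1, p.2) - f p

/-- `L₁(R, S) = (R(Bx, y) - B R(x, y)) - (S(Ax, y) - A S(x, y))`. -/
def opL1 (A B : Matrix.GeneralLinearGroup (Fin d) ℤ)
    (R S : Torus d × Torus s → Fin d → ℝ) : Torus d × Torus s → Fin d → ℝ :=
  twistedDelta B R - twistedDelta A S

/-- `L₂(R, S) = (R(Bx, y) - R(x, y)) - (S(Ax, y) - S(x, y))`. -/
def opL2 (A B : Matrix.GeneralLinearGroup (Fin d) ℤ)
    (R S : Torus d × Torus s → Fin m → ℝ) : Torus d × Torus s → Fin m → ℝ :=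
  untwistedDelta B R - untwistedDelta A S

/-- The averages over the base vanish: `∫_{𝕋ᵈ} f(x, y) dx = 0` for every `y`. -/
def ZeroBaseAverage (f : Torus d × Torus s → Fin m → ℝ) : Prop :=
  ∀ y : Torus s, ∫ x : Torus d, f (x, y) = 0

/-- `Ω` is a smooth solution of `Ω(Ax, y) - A Ω(x, y) = R`, `Ω(Bx, y) - B Ω(x, y) = S`. -/
def IsTwistedSolution (A B : Matrix.GeneralLinearGroup (Fin d) ℤ)
    (R S Ω : Torus d × Torus s → Fin d → ℝ) : Prop :=
  TorusSmooth Ω ∧ twistedDelta A Ω = R ∧ twistedDelta B Ω = S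

/-- `Ω` is a smooth solution of `Ω(Ax, y) - Ω(x, y) = R`, `Ω(Bx, y) - Ω(x, y) = S` with vanishing
averages over the base. -/
def IsUntwistedSolution (A B : Matrix.GeneralLinearGroup (Fin d) ℤ)
    (R S Ω : Torus d × Torus s → Fin m → ℝ) : Prop :=
  TorusSmooth Ω ∧ ZeroBaseAverage Ω ∧ untwistedDelta A Ω = R ∧ untwistedDelta B Ω = S

end Functions

/-! Expand in Fourier series in the base variable, the fibre variable being a parameter. With `n A`
for the row action `dualAct`, the equation over `A` reads `Ω̂(n) - T Ω̂(n A) = R̂(n A)`, where `T`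
is `A` (twisted) or `1` (untwisted); `T'` plays the same role for `B`. For `n ≠ 0` the forward half
of the orbit gives the solution `Σ_{l ≥ 0} T^l R̂(n A^(l+1))`. It also equals minus the sum over the
backward half as soon as the sum over the whole orbit vanishes.

The obstruction vanishes because the action has rank two. The relation between `R` and `S` gives
`O(n) = T' O(n B)` for the full orbit sums, hence `O(n) = T'^k O(n B^k)` for all `k`. By ergodicity
no nontrivial `A^l B^k` fixes a nonzero integer vector. The orbit of `n` is therefore seen by the
embeddings of a number field containing multiplicatively independent units `a`, `b`, and the
finiteness of algebraic integers with bounded conjugates forces `‖n A^l B^k‖` to grow exponentially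
in `|l| + |k|` (`exists_log_pos`, `DualFree.exists_exp_le_norm`). Rapid decay of the coefficients
then gives `O = 0` (`tsum_orbit_eq_zero`).

The estimates need growth along `A` that is uniform in `n`, at a rate `τ` depending only on `d` and
the eigenvalues. It comes from counting: subset sums of a long piece of an orbit are distinct
integer vectors, so they do not fit into a small box (`DualFree.two_pow_le`). Norms along an orbit
segment are controlled by the two ends up to a subexponential factor, so `‖n‖ + ‖n A^l‖` is at least
`c e^(τ l)` (`exists_exp_le_norm_add_norm`). For the same reason the norm cannot drop much below
`‖n‖` both in the future and in the past (`exists_norm_rpow_le_or`). Summing over the better half of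
the orbit loses `q` powers of `‖n‖`, and summing over all frequencies costs `d + 1` more, so the
total loss is `q + d + 1`. In the untwisted case `q = 1` suffices.

The zeroth coefficient is found by inverting `1 - A` in the twisted case and is zero in the
untwisted case. For uniqueness, a solution of the homogeneous equation makes all terms of a
convergent orbit series equal, so it vanishes. -/

/-! ### Powers of an endomorphism of a finite-dimensional complex space -/

theorem LinearMap.exists_norm_apply_le {V : Type*} [NormedAddCommGroup V] [NormedSpace ℂ V]
    [FiniteDimensional ℂ V] (T : Module.End ℂ V) : ∃ K : ℝ, 0 ≤ K ∧ ∀ v, ‖T v‖ ≤ K * ‖v‖ :=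
  ⟨‖LinearMap.toContinuousLinearMap T‖, norm_nonneg _, fun v =>
    (LinearMap.toContinuousLinearMap T).le_opNorm v⟩

theorem Module.End.exists_list_prod_eq_zero {V : Type*} [AddCommGroup V] [Module ℂ V]
    [FiniteDimensional ℂ V] (T : Module.End ℂ V) :
    ∃ Λ : List ℂ, (∀ z ∈ Λ, z ∈ spectrum ℂ T) ∧
      (Λ.map (fun z => T - algebraMap ℂ (Module.End ℂ V) z)).prod = 0 := by
  refine ⟨(LinearMap.charpoly T).roots.toList, ?_, ?_⟩
  · intro z hz
    rw [Multiset.mem_toList, Polynomial.mem_roots (LinearMap.charpoly_monic T).ne_zero] at hz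
    rw [← Module.End.hasEigenvalue_iff_mem_spectrum]
    exact (Module.End.hasEigenvalue_iff_isRoot_charpoly T z).2 hz
  · have h1 := LinearMap.aeval_self_charpoly T
    rw [(IsAlgClosed.splits (LinearMap.charpoly T)).eq_prod_roots_of_monic
      (LinearMap.charpoly_monic T)] at h1
    have h2 : ((LinearMap.charpoly T).roots.map (fun a => Polynomial.X - Polynomial.C a)) =
        (((LinearMap.charpoly T).roots.toList.map (fun a => Polynomial.X - Polynomial.C a) :
          List (Polynomial ℂ)) : Multiset (Polynomial ℂ)) := by
      conv_lhs => rw [← Multiset.coe_toList (LinearMap.charpoly T).roots]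
      rw [Multiset.map_coe]
    rw [h2, Multiset.prod_coe, map_list_prod, List.map_map] at h1
    rw [← h1]
    congr 1
    apply List.map_congr_left
    intro z _
    simp

section Recurrence

variable {V : Type*} [NormedAddCommGroup V] [NormedSpace ℂ V]

theorem list_prod_sub_apply_of_cons (T : Module.End ℂ V) (z : ℂ) (Λ : List ℂ) (v : V)
    (hv : ((z :: Λ).map (fun z => T - algebraMap ℂ (Module.End ℂ V) z)).prod v = 0) :
    (Λ.map (fun z => T - algebraMap ℂ (Module.End ℂ V) z)).prod
      ((T - algebraMap ℂ (Module.End ℂ V) z) v) = 0 := by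
  have hc : Commute (T - algebraMap ℂ (Module.End ℂ V) z)
      (Λ.map (fun z => T - algebraMap ℂ (Module.End ℂ V) z)).prod := by
    apply Commute.list_prod_right
    intro x hx
    obtain ⟨y, -, rfl⟩ := List.mem_map.1 hx
    have h1 := Algebra.commutes z T
    have h2 := Algebra.commutes y T
    have h3 := Algebra.commutes y (algebraMap ℂ (Module.End ℂ V) z)
    simp only [Commute, SemiconjBy, sub_mul, mul_sub, h1, h2, h3]
    abel
  rw [List.map_cons, List.prod_cons, hc.eq] at hv
  exact hv

theorem pow_succ_apply_eq (T : Module.End ℂ V) (z : ℂ) (v : V) (j : ℕ) :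
    (T ^ (j + 1)) v = z • (T ^ j) v + (T ^ j) ((T - algebraMap ℂ (Module.End ℂ V) z) v) := by
  rw [pow_succ]
  simp [Module.algebraMap_end_apply]

/-- The recurrence `T^(j+1) v = z T^j v + T^j (T - z) v` is read in the direction in which `z` does
not expand: forwards from `v` if `‖z‖ ≤ 1`, backwards from `T^l v` if `‖z‖ ≥ 1`. At most `l` errors
of size `D` accumulate. -/
theorem norm_pow_apply_le_sum (T : Module.End ℂ V) (z : ℂ) (v : V) (D : ℝ) (l : ℕ)
    (hD : ∀ j ≤ l, ‖(T ^ j) ((T - algebraMap ℂ (Module.End ℂ V) z) v)‖ ≤ D) {j : ℕ} (hj : j ≤ l) :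
    ‖(T ^ j) v‖ ≤ ‖v‖ + ‖(T ^ l) v‖ + l * D := by
  have hD0 : 0 ≤ D := (norm_nonneg _).trans (hD 0 (Nat.zero_le _))
  rcases le_total ‖z‖ 1 with hz | hz
  · have key : ∀ i : ℕ, i ≤ l → ‖(T ^ i) v‖ ≤ ‖v‖ + i * D := by
      intro i
      induction i with
      | zero => simp
      | succ i ih =>
        intro hi
        rw [pow_succ_apply_eq T z]
        refine (norm_add_le _ _).trans ?_
        rw [norm_smul]
        have h1 := ih (by omega)
        have h2 := hD i (by omega)
        have h3 : ‖z‖ * ‖(T ^ i) v‖ ≤ 1 * ‖(T ^ i) v‖ :=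
          mul_le_mul_of_nonneg_right hz (norm_nonneg _)
        push_cast
        linarith
    have h1 := key j hj
    have h2 : (j : ℝ) * D ≤ l * D := mul_le_mul_of_nonneg_right (by exact_mod_cast hj) hD0
    linarith [norm_nonneg ((T ^ l) v)]
  · have key : ∀ i : ℕ, i ≤ l → ‖(T ^ (l - i)) v‖ ≤ ‖(T ^ l) v‖ + i * D := by
      intro i
      induction i with
      | zero => simp
      | succ i ih =>
        intro hi
        have h1 := ih (by omega)
        have h2 := hD (l - (i + 1)) (by omega)
        have h4 := pow_succ_apply_eq T z v (l - (i + 1))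
        rw [show l - (i + 1) + 1 = l - i by omega] at h4
        have h5 : z • (T ^ (l - (i + 1))) v = (T ^ (l - i)) v -
            (T ^ (l - (i + 1))) ((T - algebraMap ℂ (Module.End ℂ V) z) v) := by
          rw [h4]; abel
        have h6 := congrArg norm h5
        rw [norm_smul] at h6
        have h7 := norm_sub_le ((T ^ (l - i)) v)
          ((T ^ (l - (i + 1))) ((T - algebraMap ℂ (Module.End ℂ V) z) v))
        have h8 : 1 * ‖(T ^ (l - (i + 1))) v‖ ≤ ‖z‖ * ‖(T ^ (l - (i + 1))) v‖ :=
          mul_le_mul_of_nonneg_right hz (norm_nonneg _)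
        push_cast
        linarith
    have h1 := key (l - j) (by omega)
    rw [show l - (l - j) = j by omega] at h1
    have h2 : ((l - j : ℕ) : ℝ) * D ≤ l * D :=
      mul_le_mul_of_nonneg_right (by exact_mod_cast Nat.sub_le _ _) hD0
    linarith [norm_nonneg v]

variable [FiniteDimensional ℂ V]

/-- Induction that peels off one linear factor `T - z` at a time. Using `ρ + 1` in place of `ρ`
absorbs the polynomial factors coming from Jordan blocks. -/
theorem exists_norm_pow_apply_le_of_list (T : Module.End ℂ V) (ρ : ℝ) (hρ : 0 ≤ ρ) (Λ : List ℂ)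
    (hΛ : ∀ z ∈ Λ, ‖z‖ ≤ ρ) :
    ∃ C : ℝ, 0 ≤ C ∧ ∀ v, (Λ.map (fun z => T - algebraMap ℂ (Module.End ℂ V) z)).prod v = 0 →
      ∀ l : ℕ, ‖(T ^ l) v‖ ≤ C * (ρ + 1) ^ l * ‖v‖ := by
  induction Λ with
  | nil => exact ⟨0, le_rfl, fun v hv l => by simp at hv; simp [hv]⟩
  | cons z Λ ih =>
    obtain ⟨C, hC, h⟩ := ih (fun y hy => hΛ y (List.mem_cons_of_mem _ hy))
    obtain ⟨K, hK, hT⟩ :=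
      LinearMap.exists_norm_apply_le (T - algebraMap ℂ (Module.End ℂ V) z)
    refine ⟨C * K + 1, by positivity, fun v hv l => ?_⟩
    have hw := h _ (list_prod_sub_apply_of_cons T z Λ v hv)
    induction l with
    | zero => simp; nlinarith [norm_nonneg v, mul_nonneg hC hK]
    | succ j ihj =>
      rw [pow_succ_apply_eq T z]
      refine (norm_add_le _ _).trans ?_
      rw [norm_smul]
      have h1 : ‖z‖ * ‖(T ^ j) v‖ ≤ ρ * ((C * K + 1) * (ρ + 1) ^ j * ‖v‖) :=
        mul_le_mul (hΛ z List.mem_cons_self) ihj (norm_nonneg _) hρ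
      have h2 := (hw j).trans (mul_le_mul_of_nonneg_left (hT v) (by positivity))
      have h3 : 0 ≤ (ρ + 1) ^ j * ‖v‖ := by positivity
      rw [pow_succ]
      nlinarith

/-- Powers of an endomorphism grow at most like powers of `ρ + 1`, if its eigenvalues have modulus
at most `ρ`. -/
theorem Module.End.exists_norm_pow_apply_le (T : Module.End ℂ V) (ρ : ℝ) (hρ : 0 ≤ ρ)
    (hT : ∀ z ∈ spectrum ℂ T, ‖z‖ ≤ ρ) :
    ∃ C : ℝ, 0 ≤ C ∧ ∀ v (l : ℕ), ‖(T ^ l) v‖ ≤ C * (ρ + 1) ^ l * ‖v‖ := by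
  obtain ⟨Λ, h1, h2⟩ := T.exists_list_prod_eq_zero
  obtain ⟨C, hC, h⟩ := exists_norm_pow_apply_le_of_list T ρ hρ Λ (fun z hz => hT z (h1 z hz))
  exact ⟨C, hC, fun v => h v (by simp [h2])⟩

theorem exists_norm_pow_apply_le_add_of_list (T : Module.End ℂ V) (Λ : List ℂ) :
    ∀ ρ : ℝ, 1 < ρ → ∃ C : ℝ, 0 ≤ C ∧
      ∀ v, (Λ.map (fun z => T - algebraMap ℂ (Module.End ℂ V) z)).prod v = 0 →
        ∀ l j : ℕ, j ≤ l → ‖(T ^ j) v‖ ≤ C * ρ ^ l * (‖v‖ + ‖(T ^ l) v‖) := by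
  induction Λ with
  | nil => exact fun ρ _ => ⟨0, le_rfl, fun v hv l j _ => by simp at hv; simp [hv]⟩
  | cons z Λ ih =>
    intro ρ hρ
    -- The rate is split as `ρ = s * s`: one factor `s ^ l` is spent on the inductive hypothesis,
    -- the other absorbs the factor `l` of `norm_pow_apply_le_sum` by Bernoulli's inequality.
    have hs1 : 1 < √ρ := by
      rw [Real.lt_sqrt (by norm_num)]; simpa using hρ
    have hs2 : √ρ * √ρ = ρ := Real.mul_self_sqrt (by linarith)
    set s := √ρ with hs
    obtain ⟨C, hC, h⟩ := ih s hs1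
    obtain ⟨K, hK, hT⟩ :=
      LinearMap.exists_norm_apply_le (T - algebraMap ℂ (Module.End ℂ V) z)
    refine ⟨1 + (s - 1)⁻¹ * (C * K), ?_, fun v hv l j hj => ?_⟩
    · have : 0 < s - 1 := by linarith
      positivity
    have hw := h _ (list_prod_sub_apply_of_cons T z Λ v hv) l
    have hcomm : (T ^ l) ((T - algebraMap ℂ (Module.End ℂ V) z) v) =
        (T - algebraMap ℂ (Module.End ℂ V) z) ((T ^ l) v) := by
      have := pow_succ_apply_eq T z v l
      rw [pow_succ'] at this
      simp only [Module.End.mul_apply] at this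
      simp [this, Module.algebraMap_end_apply]
    have hb : ∀ i ≤ l, ‖(T ^ i) ((T - algebraMap ℂ (Module.End ℂ V) z) v)‖ ≤
        C * s ^ l * (K * (‖v‖ + ‖(T ^ l) v‖)) := by
      intro i hi
      refine (hw i hi).trans ?_
      rw [hcomm, mul_add K]
      gcongr
      · exact hT v
      · exact hT _
    have h1 := norm_pow_apply_le_sum T z v _ l hb hj
    have hl : (l : ℝ) ≤ (s - 1)⁻¹ * s ^ l := by
      have := one_add_mul_le_pow (a := s - 1) (by linarith) l
      rw [add_sub_cancel] at this
      rw [inv_mul_eq_div, le_div_iff₀ (by linarith)]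
      linarith
    have hX : 0 ≤ ‖v‖ + ‖(T ^ l) v‖ := by positivity
    have h2 : (l : ℝ) * (C * s ^ l * (K * (‖v‖ + ‖(T ^ l) v‖))) ≤
        (s - 1)⁻¹ * s ^ l * (C * s ^ l * (K * (‖v‖ + ‖(T ^ l) v‖))) :=
      mul_le_mul_of_nonneg_right hl (by positivity)
    have h3 : ρ ^ l = s ^ l * s ^ l := by rw [← mul_pow, hs2]
    have h4 : 1 ≤ ρ ^ l := one_le_pow₀ hρ.le
    have h5 : (s - 1)⁻¹ * s ^ l * (C * s ^ l * (K * (‖v‖ + ‖(T ^ l) v‖))) =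
        (s - 1)⁻¹ * (C * K) * ρ ^ l * (‖v‖ + ‖(T ^ l) v‖) := by rw [h3]; ring
    nlinarith [mul_le_mul_of_nonneg_right h4 hX]

/-- The norms along a finite piece of an orbit are controlled by the norms at its two ends, up to a
subexponential factor. -/
theorem Module.End.exists_norm_pow_apply_le_add (T : Module.End ℂ V) (ρ : ℝ) (hρ : 1 < ρ) :
    ∃ C : ℝ, 0 ≤ C ∧ ∀ v (l j : ℕ), j ≤ l →
      ‖(T ^ j) v‖ ≤ C * ρ ^ l * (‖v‖ + ‖(T ^ l) v‖) := by
  obtain ⟨Λ, -, h2⟩ := T.exists_list_prod_eq_zero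
  obtain ⟨C, hC, h⟩ := exists_norm_pow_apply_le_add_of_list T Λ ρ hρ
  exact ⟨C, hC, fun v => h v (by simp [h2])⟩

end Recurrence

/-! ### Orbits of integer vectors seen in number fields -/

/-- A cyclic module over a finite commutative `ℚ`-algebra has number field valued quotients. -/
theorem exists_numberField_of_cyclic {𝒜 V : Type} [CommRing 𝒜] [Algebra ℚ 𝒜] [Module.Finite ℚ 𝒜]
    [AddCommGroup V] [Module ℚ V] (ev : 𝒜 →ₗ[ℚ] V) (h1 : ev 1 ≠ 0)
    (hmul : ∀ c a, ev a = 0 → ev (c * a) = 0) :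
    ∃ (K : Type) (_ : Field K) (_ : NumberField K) (π : 𝒜 →+* K),
      ∀ σ : K →+* ℂ, ∃ g : V →ₗ[ℚ] ℂ, ∀ a, g (ev a) = σ (π a) := by
  -- By `hmul` the kernel of `ev` is an ideal, proper because `ev 1 ≠ 0`. The field is the quotient
  -- by a maximal ideal above it.
  let I : Ideal 𝒜 :=
    { carrier := {a | ev a = 0}
      add_mem' := fun {a b} ha hb => by
        change ev (a + b) = 0
        rw [map_add, show ev a = 0 from ha, show ev b = 0 from hb, add_zero]
      zero_mem' := map_zero ev
      smul_mem' := fun c a ha => hmul c a ha }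
  have hI : I ≠ ⊤ := fun h => h1 ((Ideal.eq_top_iff_one I).1 h)
  obtain ⟨𝔪, h𝔪, hle⟩ := Ideal.exists_le_maximal I hI
  have hfin : Module.Finite ℚ (𝒜 ⧸ 𝔪) :=
    Module.Finite.of_surjective ((Ideal.Quotient.mkₐ ℚ 𝔪).toLinearMap)
      (Ideal.Quotient.mkₐ_surjective ℚ 𝔪)
  let _ : Field (𝒜 ⧸ 𝔪) := Ideal.Quotient.field 𝔪
  have : CharZero (𝒜 ⧸ 𝔪) := algebraRat.charZero _
  have hfd : @Module.Finite ℚ (𝒜 ⧸ 𝔪) _ _ (DivisionRing.toRatAlgebra.toModule) := by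
    have h3 : (DivisionRing.toRatAlgebra : Algebra ℚ (𝒜 ⧸ 𝔪)) = Ideal.Quotient.algebra ℚ :=
      Subsingleton.elim _ _
    rw [h3]
    exact hfin
  refine ⟨𝒜 ⧸ 𝔪, inferInstance, @NumberField.mk _ _ inferInstance hfd, Ideal.Quotient.mk 𝔪, fun σ => ?_⟩
  -- Since `χ` kills the kernel of `ev`, it descends to the range of `ev` and then extends linearly
  -- to all of `V`.
  let χ : 𝒜 →ₗ[ℚ] ℂ := ((σ.comp (Ideal.Quotient.mk 𝔪)).toRatAlgHom).toLinearMap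
  have hker : LinearMap.ker ev ≤ LinearMap.ker χ := by
    intro a ha
    have ha' : a ∈ I := ha
    have : Ideal.Quotient.mk 𝔪 a = 0 := Ideal.Quotient.eq_zero_iff_mem.2 (hle ha')
    change σ (Ideal.Quotient.mk 𝔪 a) = 0
    rw [this, map_zero]
  let f := ((LinearMap.ker ev).liftQ χ hker).comp ev.quotKerEquivRange.symm.toLinearMap
  obtain ⟨g, hg⟩ := f.exists_extend
  refine ⟨g, fun a => ?_⟩
  have h3 := LinearMap.congr_fun hg ⟨ev a, LinearMap.mem_range_self ev a⟩
  have h4 : ev.quotKerEquivRange.symm ⟨ev a, LinearMap.mem_range_self ev a⟩ =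
      (LinearMap.ker ev).mkQ a := ev.quotKerEquivRange_symm_apply_image a _
  simp only [LinearMap.comp_apply, Submodule.subtype_apply, f, LinearEquiv.coe_coe, h4] at h3
  rw [h3]
  rfl

section Spectrum

variable {d : ℕ}

/-- The action of the matrices `Aˡ Bᵏ` on nonzero integer row vectors is free. -/
def DualFree (A B : Matrix.GeneralLinearGroup (Fin d) ℤ) : Prop :=
  ∀ l k : ℤ, (l, k) ≠ (0, 0) → ∀ n : Fin d → ℤ, n ≠ 0 →
    Matrix.vecMul n (A ^ l * B ^ k : Matrix.GeneralLinearGroup (Fin d) ℤ).val ≠ n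

/-- The rational matrix of an element of `GL(d, ℤ)`. -/
noncomputable def ratMat :
    Matrix.GeneralLinearGroup (Fin d) ℤ →* (Matrix (Fin d) (Fin d) ℚ)ˣ :=
  Units.map ((Int.castRingHom ℚ).mapMatrix (m := Fin d)).toMonoidHom

theorem ratMat_val (M : Matrix.GeneralLinearGroup (Fin d) ℤ) :
    (ratMat M).val = M.val.map (Int.castRingHom ℚ) := rfl

theorem DualFree.isUnit_ratMat_sub_one {A B : Matrix.GeneralLinearGroup (Fin d) ℤ}
    (h : DualFree A B) {l k : ℤ} (hlk : (l, k) ≠ (0, 0)) :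
    IsUnit ((ratMat (A ^ l * B ^ k)).val - 1) := by
  rw [Matrix.isUnit_iff_isUnit_det, isUnit_iff_ne_zero]
  have h1 : (ratMat (A ^ l * B ^ k)).val - 1 =
      ((A ^ l * B ^ k).val - 1).map (Int.castRingHom ℚ) := by
    rw [Matrix.map_sub _ (map_sub _), Matrix.map_one _ (map_zero _) (map_one _)]
    rfl
  rw [h1, ← RingHom.mapMatrix_apply, ← RingHom.map_det]
  intro h0
  have h2 : ((A ^ l * B ^ k).val - 1).det = 0 := by simpa using h0
  obtain ⟨v, hv, hv0⟩ := Matrix.exists_vecMul_eq_zero_iff.2 h2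
  rw [Matrix.vecMul_sub, Matrix.vecMul_one, sub_eq_zero] at hv0
  exact h l k hlk v hv hv0

theorem vecMul_ratMat (n : Fin d → ℤ) (M : Matrix.GeneralLinearGroup (Fin d) ℤ) :
    Matrix.vecMul (fun i => (n i : ℚ)) (ratMat M).val =
      fun i => ((Matrix.vecMul n M.val i : ℤ) : ℚ) := by
  ext i
  simp [Matrix.vecMul, dotProduct, ratMat_val]

open scoped IsMulCommutative in
/-- The orbit of a nonzero integer vector under commuting matrices is seen by the embeddings of a
number field. -/
theorem exists_numberField_of_orbit {A B : Matrix.GeneralLinearGroup (Fin d) ℤ}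
    (hAB : Commute A B) (hfree : DualFree A B) {n : Fin d → ℤ} (hn : n ≠ 0) :
    ∃ (K : Type) (_ : Field K) (_ : NumberField K) (a b : Kˣ),
      (∀ l k : ℤ, IsIntegral ℤ ((a ^ l * b ^ k : Kˣ) : K)) ∧
      (∀ l k : ℤ, a ^ l * b ^ k = 1 → (l, k) = (0, 0)) ∧
      ∀ σ : K →+* ℂ, σ a ∈ eigenvalueSet A ∧ ∃ w : Fin d → ℂ, ∀ l k : ℤ,
        ∑ i, ((Matrix.vecMul n (A ^ l * B ^ k : Matrix.GeneralLinearGroup (Fin d) ℤ).val i : ℤ) : ℂ)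
          * w i = σ a ^ l * σ b ^ k := by
  -- The inverses are among the generators so that `A` and `B` become units of the commutative
  -- algebra `𝒜`.
  let S : Set (Matrix (Fin d) (Fin d) ℚ) :=
    (fun M => (ratMat M).val) '' {A, A⁻¹, B, B⁻¹}
  have hS : ∀ x ∈ S, ∀ y ∈ S, x * y = y * x := by
    have hc : ∀ M ∈ ({A, A⁻¹, B, B⁻¹} : Set (Matrix.GeneralLinearGroup (Fin d) ℤ)),
        ∀ N ∈ ({A, A⁻¹, B, B⁻¹} : Set (Matrix.GeneralLinearGroup (Fin d) ℤ)), Commute M N := by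
      have h1 := hAB.inv_left
      have h2 := hAB.inv_right
      have h3 := hAB.inv_left.inv_right
      have hA := (Commute.refl A).inv_left
      have hB := (Commute.refl B).inv_left
      intro M hM N hN
      rcases hM with rfl | rfl | rfl | rfl <;> rcases hN with rfl | rfl | rfl | rfl <;>
        first | exact Commute.refl _ | assumption | (apply Commute.symm; assumption)
    rintro _ ⟨M, hM, rfl⟩ _ ⟨N, hN, rfl⟩
    have := congrArg Units.val (congrArg ratMat (hc M hM N hN).eq)
    simpa using this
  obtain ⟨𝒜, hcomm, hS𝒜⟩ : ∃ 𝒜 : Subalgebra ℚ (Matrix (Fin d) (Fin d) ℚ),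
      IsMulCommutative 𝒜 ∧ S ⊆ 𝒜 :=
    ⟨Algebra.adjoin ℚ S, Algebra.isMulCommutative_adjoin ℚ hS, Algebra.subset_adjoin⟩
  have hmem : ∀ M ∈ ({A, A⁻¹, B, B⁻¹} : Set (Matrix.GeneralLinearGroup (Fin d) ℤ)),
      (ratMat M).val ∈ 𝒜 := fun M hM => hS𝒜 ⟨M, hM, rfl⟩
  have hunit : ∀ M : Matrix.GeneralLinearGroup (Fin d) ℤ, (ratMat M).val ∈ 𝒜 →
      (ratMat M⁻¹).val ∈ 𝒜 → ∃ u : 𝒜ˣ, Units.map (𝒜.val : 𝒜 →* _) u = ratMat M := by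
    intro M h1 h2
    refine ⟨⟨⟨_, h1⟩, ⟨_, h2⟩, ?_, ?_⟩, ?_⟩
    · ext1
      change (ratMat M).val * (ratMat M⁻¹).val = 1
      rw [map_inv]; exact Units.mul_inv _
    · ext1
      change (ratMat M⁻¹).val * (ratMat M).val = 1
      rw [map_inv]; exact Units.inv_mul _
    · ext1; rfl
  obtain ⟨u, hu⟩ := hunit A (hmem _ (by simp)) (hmem _ (by simp))
  obtain ⟨v, hv⟩ := hunit B (hmem _ (by simp)) (hmem _ (by simp))
  have huv : ∀ l k : ℤ, (((u ^ l * v ^ k : 𝒜ˣ) : 𝒜) : Matrix (Fin d) (Fin d) ℚ) =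
      (ratMat (A ^ l * B ^ k)).val := by
    intro l k
    have : Units.map (𝒜.val : 𝒜 →* _) (u ^ l * v ^ k) = ratMat (A ^ l * B ^ k) := by
      rw [map_mul, map_zpow, map_zpow, hu, hv, map_mul, map_zpow, map_zpow]
    exact congrArg Units.val this
  let nq : Fin d → ℚ := fun i => (n i : ℚ)
  let ev : 𝒜 →ₗ[ℚ] (Fin d → ℚ) :=
    (Matrix.vecMulBilin ℚ ℚ nq).comp 𝒜.val.toLinearMap
  have hev : ∀ a : 𝒜, ev a = Matrix.vecMul nq a.val := fun a => rfl
  have hcom : ∀ c a : 𝒜, c * a = a * c := fun c a => mul_comm c a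
  obtain ⟨K, _, _, π, hπ⟩ := exists_numberField_of_cyclic ev
    (by
      rw [hev]
      intro h
      apply hn
      have h' : nq = 0 := by simpa using h
      funext i
      have := congrFun h' i
      simpa [nq] using this)
    (by
      intro c a ha
      rw [hcom, hev]
      rw [hev] at ha
      change Matrix.vecMul nq (a.val * c.val) = 0
      rw [← Matrix.vecMul_vecMul, ha, Matrix.zero_vecMul])
  -- Cayley–Hamilton inside `𝒜`. It yields both the integrality of the images in `K` and the fact
  -- that `σ a` is an eigenvalue of `A`.
  have hroot : ∀ M : Matrix.GeneralLinearGroup (Fin d) ℤ, ∀ x : 𝒜, x.val = (ratMat M).val →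
      Polynomial.aeval x M.val.charpoly = 0 := by
    intro M x hx
    have h1 : Polynomial.aeval x.val M.val.charpoly = 0 := by
      rw [hx, ratMat_val]
      have h2 := congrArg (RingHom.mapMatrix (Int.castRingHom ℚ)) (Matrix.aeval_self_charpoly M.val)
      rw [map_zero] at h2
      rw [← h2]
      exact (Polynomial.aeval_algHom_apply
        ((Int.castRingHom ℚ).mapMatrix.toIntAlgHom :
          Matrix (Fin d) (Fin d) ℤ →ₐ[ℤ] Matrix (Fin d) (Fin d) ℚ) M.val M.val.charpoly)
    apply Subtype.ext
    have h3 := Polynomial.aeval_algHom_apply (𝒜.val.toRingHom.toIntAlgHom) x M.val.charpoly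
    exact h3.symm.trans h1
  refine ⟨K, inferInstance, inferInstance, Units.map π u, Units.map π v, ?_, ?_, ?_⟩
  · intro l k
    have h1 := hroot (A ^ l * B ^ k) _ (huv l k)
    have h2 : IsIntegral ℤ ((u ^ l * v ^ k : 𝒜ˣ) : 𝒜) :=
      ⟨_, Matrix.charpoly_monic (A ^ l * B ^ k).val, h1⟩
    have h3 := h2.map (π.toIntAlgHom)
    have h4 : Units.map (π : 𝒜 →* K) (u ^ l * v ^ k) =
        Units.map (π : 𝒜 →* K) u ^ l * Units.map (π : 𝒜 →* K) v ^ k := by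
      rw [map_mul, map_zpow, map_zpow]
    rw [← h4]
    exact h3
  · intro l k hlk
    by_contra hne
    have h4 : Units.map (π : 𝒜 →* K) (u ^ l * v ^ k) = 1 := by
      rw [map_mul, map_zpow, map_zpow, hlk]
    have h5 : π (((u ^ l * v ^ k : 𝒜ˣ) : 𝒜) - 1) = 0 := by
      rw [map_sub, map_one, sub_eq_zero]
      exact congrArg Units.val h4
    -- The map `π` need not be injective, so `A^l B^k ≠ 1` would not be enough. But `A^l B^k - 1` is
    -- an invertible matrix, hence cancellable in `𝒜`, hence a unit of the Artinian ring `𝒜`, and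
    -- units have nonzero image.
    have : IsArtinianRing 𝒜 := IsArtinianRing.of_finite ℚ 𝒜
    have h6 := hfree.isUnit_ratMat_sub_one hne
    have h7 : IsUnit (((u ^ l * v ^ k : 𝒜ˣ) : 𝒜) - 1) := by
      apply IsArtinianRing.isUnit_of_mem_nonZeroDivisors
      rw [mem_nonZeroDivisors_iff_right]
      intro x hx
      apply Subtype.ext
      have h8 : x.val * ((ratMat (A ^ l * B ^ k)).val - 1) = 0 := by
        rw [← huv l k]
        exact congrArg Subtype.val hx
      exact (h6.mul_left_eq_zero).1 h8
    exact (h7.map π).ne_zero h5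
  · intro σ
    constructor
    · rw [eigenvalueSet, Matrix.mem_spectrum_iff_isRoot_charpoly]
      have h1 := hroot A u (congrArg Units.val hu)
      have h2 := congrArg (σ.comp π) h1
      rw [map_zero] at h2
      have h3 := Polynomial.aeval_algHom_apply ((σ.comp π).toIntAlgHom) (u : 𝒜) A.val.charpoly
      have h4 : Polynomial.aeval (σ (π u)) A.val.charpoly = 0 := h3.trans h2
      have h5 : (A.val.map (Int.cast : ℤ → ℂ)).charpoly =
          A.val.charpoly.map (Int.castRingHom ℂ) := Matrix.charpoly_map A.val (Int.castRingHom ℂ)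
      change Polynomial.IsRoot ((A.val.map (Int.cast : ℤ → ℂ)).charpoly) (σ (π u))
      rw [h5, Polynomial.IsRoot, Polynomial.eval_map]
      exact h4
    · obtain ⟨g, hg⟩ := hπ σ
      refine ⟨fun i => g (Pi.single i 1), fun l k => ?_⟩
      have h1 := hg ((u ^ l * v ^ k : 𝒜ˣ) : 𝒜)
      rw [hev, huv, vecMul_ratMat] at h1
      have h2 : σ (π ((u ^ l * v ^ k : 𝒜ˣ) : 𝒜)) = σ (π u) ^ l * σ (π v) ^ k := by
        have h4 : Units.map ((σ.comp π : 𝒜 →+* ℂ) : 𝒜 →* ℂ) (u ^ l * v ^ k) =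
          Units.map ((σ.comp π : 𝒜 →+* ℂ) : 𝒜 →* ℂ) u ^ l *
            Units.map ((σ.comp π : 𝒜 →+* ℂ) : 𝒜 →* ℂ) v ^ k := by
          rw [map_mul, map_zpow, map_zpow]
        have h5 := congrArg Units.val h4
        rw [Units.val_mul, Units.val_zpow_eq_zpow_val, Units.val_zpow_eq_zpow_val] at h5
        exact h5
      refine Eq.trans ?_ (h1.trans h2)
      have h3 : ∀ x : Fin d → ℚ, g x = ∑ i, (x i : ℂ) * g (Pi.single i 1) := by
        intro x
        conv_lhs => rw [pi_eq_sum_univ' x]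
        rw [map_sum]
        refine Finset.sum_congr rfl fun i _ => ?_
        rw [map_smul, Rat.smul_def]
      rw [h3]
      simp

end Spectrum

/-! ### The action on characters -/

section DualAction

variable {d : ℕ}

/-- The action of an integer matrix on the characters of the torus. -/
def dualAct (M : Matrix.GeneralLinearGroup (Fin d) ℤ) (n : Fin d → ℤ) : Fin d → ℤ :=
  Matrix.vecMul n M.val

theorem dualAct_mul (M N : Matrix.GeneralLinearGroup (Fin d) ℤ) (n : Fin d → ℤ) :
    dualAct (M * N) n = dualAct N (dualAct M n) := by
  simp [dualAct, Matrix.vecMul_vecMul]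

@[simp] theorem dualAct_one (n : Fin d → ℤ) : dualAct 1 n = n := by
  simp [dualAct]

@[simp] theorem dualAct_zero (M : Matrix.GeneralLinearGroup (Fin d) ℤ) : dualAct M 0 = 0 := by
  simp [dualAct]

theorem dualAct_inv_dualAct (M : Matrix.GeneralLinearGroup (Fin d) ℤ) (n : Fin d → ℤ) :
    dualAct M⁻¹ (dualAct M n) = n := by
  rw [← dualAct_mul, mul_inv_cancel, dualAct_one]

theorem dualAct_dualAct_inv (M : Matrix.GeneralLinearGroup (Fin d) ℤ) (n : Fin d → ℤ) :
    dualAct M (dualAct M⁻¹ n) = n := by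
  rw [← dualAct_mul, inv_mul_cancel, dualAct_one]

/-- The action of an integer matrix on the characters of the torus, as a permutation. -/
def dualEquiv (M : Matrix.GeneralLinearGroup (Fin d) ℤ) : (Fin d → ℤ) ≃ (Fin d → ℤ) where
  toFun := dualAct M
  invFun := dualAct M⁻¹
  left_inv := dualAct_inv_dualAct M
  right_inv := dualAct_dualAct_inv M

theorem dualAct_ne_zero (M : Matrix.GeneralLinearGroup (Fin d) ℤ) {n : Fin d → ℤ} (hn : n ≠ 0) :
    dualAct M n ≠ 0 := fun h => hn <| by
  rw [← dualAct_inv_dualAct M n, h, dualAct_zero]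

theorem one_le_norm_of_ne_zero {n : Fin d → ℤ} (hn : n ≠ 0) : 1 ≤ ‖n‖ := by
  obtain ⟨i, hi⟩ := Function.ne_iff.1 hn
  have h1 : (1 : ℝ) ≤ ‖n i‖ := by
    rw [Int.norm_eq_abs]
    exact_mod_cast Int.one_le_abs hi
  exact h1.trans (norm_le_pi_norm n i)

theorem norm_dualAct_pos (M : Matrix.GeneralLinearGroup (Fin d) ℤ) {n : Fin d → ℤ} (hn : n ≠ 0) :
    0 < ‖dualAct M n‖ := norm_pos_iff.2 (dualAct_ne_zero M hn)

theorem norm_intCast_vec (n : Fin d → ℤ) : ‖fun i => (n i : ℂ)‖ = ‖n‖ := by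
  simp [Pi.norm_def]

end DualAction

/-! ### Embeddings of multiplicatively independent units -/

section Embeddings

theorem norm_zpow_mul_zpow {x y : ℂ} (hx : x ≠ 0) (hy : y ≠ 0) (l k : ℤ) :
    ‖x ^ l * y ^ k‖ = Real.exp (l * Real.log ‖x‖ + k * Real.log ‖y‖) := by
  rw [norm_mul, norm_zpow, norm_zpow, Real.exp_add, ← Real.rpow_intCast, ← Real.rpow_intCast,
    Real.rpow_def_of_pos (norm_pos_iff.2 hx), Real.rpow_def_of_pos (norm_pos_iff.2 hy),
    mul_comm (l : ℝ), mul_comm (k : ℝ)]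

/-- Kronecker's theorem: a nonzero algebraic integer with all conjugates in the closed unit disc is
a root of unity. -/
theorem exists_norm_one_lt {K : Type} [Field K] [NumberField K] (a : Kˣ)
    (ha : IsIntegral ℤ (a : K)) (h : ∀ m : ℕ, 0 < m → a ^ m ≠ 1) : ∃ σ : K →+* ℂ, 1 < ‖σ a‖ := by
  by_contra! hc
  obtain ⟨m, hm, h1⟩ := NumberField.Embeddings.pow_eq_one_of_norm_le_one K ℂ a.ne_zero ha hc
  exact h m hm (Units.ext (by simpa using h1))

/-- No nonzero real direction is contracted by all embeddings. -/
theorem exists_log_pos {K : Type} [Field K] [NumberField K] (a b : Kˣ)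
    (hint : ∀ l k : ℤ, IsIntegral ℤ ((a ^ l * b ^ k : Kˣ) : K))
    (hinj : ∀ l k : ℤ, a ^ l * b ^ k = 1 → (l, k) = (0, 0)) (v : ℝ × ℝ) (hv : v ≠ 0) :
    ∃ σ : K →+* ℂ, 0 < v.1 * Real.log ‖σ a‖ + v.2 * Real.log ‖σ b‖ := by
  by_contra! hc
  -- Lattice points at bounded distance from the ray through `v`. If no embedding expands in the
  -- direction `v`, the conjugates of the algebraic integers `g j` are bounded independently of `j`.
  let P : ℕ → ℤ × ℤ := fun j => (⌊j * v.1⌋, ⌊j * v.2⌋)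
  let g : ℕ → K := fun j => ((a ^ (P j).1 * b ^ (P j).2 : Kˣ) : K)
  have hgP : ∀ i j, g i = g j → P i = P j := by
    intro i j hij
    have h1 : a ^ (P i).1 * b ^ (P i).2 = a ^ (P j).1 * b ^ (P j).2 := Units.ext hij
    have h2 := hinj ((P i).1 - (P j).1) ((P i).2 - (P j).2) (by
      rw [zpow_sub, zpow_sub]
      calc _ = (a ^ (P i).1 * b ^ (P i).2) * (a ^ (P j).1 * b ^ (P j).2)⁻¹ := by
            rw [mul_inv]; exact mul_mul_mul_comm _ _ _ _
        _ = 1 := by rw [h1, mul_inv_cancel])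
    rw [Prod.mk.injEq, sub_eq_zero, sub_eq_zero] at h2
    exact Prod.ext h2.1 h2.2
  have hpos : ∀ (σ : K →+* ℂ) (u : Kˣ), 0 < ‖σ u‖ := fun σ u =>
    norm_pos_iff.2 ((map_ne_zero σ).2 u.ne_zero)
  have hbound : ∀ j, ∀ σ : K →+* ℂ, ‖σ (g j)‖ ≤
      Real.exp (∑ σ : K →+* ℂ, (|Real.log ‖σ a‖| + |Real.log ‖σ b‖|)) := by
    intro j σ
    have h1 : ‖σ (g j)‖ = Real.exp ((P j).1 * Real.log ‖σ a‖ + (P j).2 * Real.log ‖σ b‖) := by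
      rw [← norm_zpow_mul_zpow (norm_pos_iff.1 (hpos σ a)) (norm_pos_iff.1 (hpos σ b))]
      simp [g]
    rw [h1, Real.exp_le_exp]
    have h2 : |Real.log ‖σ a‖| + |Real.log ‖σ b‖| ≤
        ∑ σ : K →+* ℂ, (|Real.log ‖σ a‖| + |Real.log ‖σ b‖|) :=
      Finset.single_le_sum (f := fun σ : K →+* ℂ => |Real.log ‖σ a‖| + |Real.log ‖σ b‖|)
        (fun _ _ => by positivity) (Finset.mem_univ σ)
    refine le_trans ?_ h2
    have h3 : ∀ x y : ℝ, ((⌊x⌋ : ℤ) : ℝ) * y ≤ x * y + |y| := by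
      intro x y
      have h4 := Int.floor_add_fract x
      have h5 := Int.fract_nonneg x
      have h6 := (Int.fract_lt_one x).le
      have h7 : -(Int.fract x * y) ≤ |y| := by
        calc -(Int.fract x * y) ≤ |Int.fract x * y| := neg_le_abs _
          _ = Int.fract x * |y| := by rw [abs_mul, abs_of_nonneg h5]
          _ ≤ 1 * |y| := mul_le_mul_of_nonneg_right h6 (abs_nonneg _)
          _ = |y| := one_mul _
      calc ((⌊x⌋ : ℤ) : ℝ) * y = x * y - Int.fract x * y := by rw [← sub_mul]; congr 1; linarith
        _ ≤ _ := by linarith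
    have h8 := h3 (j * v.1) (Real.log ‖σ a‖)
    have h9 := h3 (j * v.2) (Real.log ‖σ b‖)
    have h10 : (j : ℝ) * (v.1 * Real.log ‖σ a‖ + v.2 * Real.log ‖σ b‖) ≤ 0 :=
      mul_nonpos_of_nonneg_of_nonpos (Nat.cast_nonneg j) (hc σ)
    change ((⌊j * v.1⌋ : ℤ) : ℝ) * _ + ((⌊j * v.2⌋ : ℤ) : ℝ) * _ ≤ _
    linarith
  -- There are only finitely many such integers, so some value is taken for infinitely many `j`; by
  -- independence of `a` and `b` the point `P j` is constant on that infinite set.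
  have hfin : (Set.range g).Finite :=
    (NumberField.Embeddings.finite_of_norm_le K ℂ _).subset (by
      rintro _ ⟨j, rfl⟩
      exact ⟨hint _ _, hbound j⟩)
  have : Finite (Set.range g) := hfin
  obtain ⟨y, hy⟩ := Finite.exists_infinite_fiber (Set.rangeFactorization g)
  have hinf : Set.Infinite {j | Set.rangeFactorization g j = y} := Set.infinite_coe_iff.1 hy
  obtain ⟨i, hi⟩ := hinf.nonempty
  -- Equal floors force `|i - j| |x| < 1`, which fails for `j` far from `i` unless `x = 0`.
  have key : ∀ x : ℝ, (∀ j ∈ {j | Set.rangeFactorization g j = y}, ⌊i * x⌋ = ⌊j * x⌋) → x = 0 := by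
    intro x hx
    by_contra hx0
    obtain ⟨j, hj, hlt⟩ := hinf.exists_gt (i + ⌈1 / |x|⌉₊)
    have h1 := Int.abs_sub_lt_one_of_floor_eq_floor (hx j hj)
    rw [← sub_mul, abs_mul] at h1
    have h2 : 1 / |x| ≤ |(i : ℝ) - j| := by
      have h3 : ((i + ⌈1 / |x|⌉₊ : ℕ) : ℝ) < j := by exact_mod_cast hlt
      push_cast at h3
      have h4 := Nat.le_ceil (1 / |x|)
      rw [abs_sub_comm]
      exact le_trans (by linarith) (le_abs_self _)
    rw [div_le_iff₀ (abs_pos.2 hx0)] at h2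
    linarith
  have hP : ∀ j ∈ {j | Set.rangeFactorization g j = y}, P i = P j := fun j hj =>
    hgP i j (congrArg Subtype.val (hi.trans hj.symm))
  apply hv
  apply Prod.ext
  · exact key v.1 fun j hj => congrArg Prod.fst (hP j hj)
  · exact key v.2 fun j hj => congrArg Prod.snd (hP j hj)

/-- By homogeneity only the unit sphere matters. There the maximum over the finitely many embeddings
is continuous and, by `exists_log_pos`, positive, so compactness gives `τ`. -/
theorem exists_log_ge {K : Type} [Field K] [NumberField K] (a b : Kˣ)
    (hint : ∀ l k : ℤ, IsIntegral ℤ ((a ^ l * b ^ k : Kˣ) : K))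
    (hinj : ∀ l k : ℤ, a ^ l * b ^ k = 1 → (l, k) = (0, 0)) :
    ∃ τ : ℝ, 0 < τ ∧ ∀ v : ℝ × ℝ,
      ∃ σ : K →+* ℂ, τ * ‖v‖ ≤ v.1 * Real.log ‖σ a‖ + v.2 * Real.log ‖σ b‖ := by
  let F : (K →+* ℂ) → ℝ × ℝ → ℝ := fun σ v => v.1 * Real.log ‖σ a‖ + v.2 * Real.log ‖σ b‖
  let f : ℝ × ℝ → ℝ := fun v => Finset.univ.sup' Finset.univ_nonempty (fun σ => F σ v)
  have hf : Continuous f := by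
    apply Continuous.finset_sup'_apply
    intro σ _
    fun_prop
  obtain ⟨v₀, hv₀, hmin⟩ := (isCompact_sphere (0 : ℝ × ℝ) 1).exists_isMinOn
    ⟨(1, 1), by simp [Prod.norm_def]⟩ hf.continuousOn
  have hv₀' : v₀ ≠ 0 := by
    rintro rfl
    simp at hv₀
  obtain ⟨σ₀, hσ₀⟩ := exists_log_pos a b hint hinj v₀ hv₀'
  have hpos : 0 < f v₀ := hσ₀.trans_le (Finset.le_sup' (fun σ => F σ v₀) (Finset.mem_univ σ₀))
  refine ⟨f v₀, hpos, fun v => ?_⟩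
  by_cases hv : v = 0
  · subst hv
    exact ⟨σ₀, by simp⟩
  have hn : 0 < ‖v‖ := norm_pos_iff.2 hv
  have h1 : f v₀ ≤ f (‖v‖⁻¹ • v) := hmin (by simp [norm_smul, hn.ne'])
  obtain ⟨σ, -, hσ⟩ := Finset.exists_mem_eq_sup' Finset.univ_nonempty (fun σ => F σ (‖v‖⁻¹ • v))
  refine ⟨σ, ?_⟩
  have h2 : f (‖v‖⁻¹ • v) = ‖v‖⁻¹ * F σ v := by
    rw [show f (‖v‖⁻¹ • v) = F σ (‖v‖⁻¹ • v) from hσ]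
    simp only [F, Prod.smul_fst, Prod.smul_snd, smul_eq_mul]
    ring
  rw [h2, inv_mul_eq_div, le_div_iff₀ hn] at h1
  exact h1

end Embeddings

/-! ### Exponential growth of orbits and the counting argument -/

section Growth

variable {d : ℕ}

theorem norm_sum_intCast_mul_le (n : Fin d → ℤ) (w : Fin d → ℂ) :
    ‖∑ i, (n i : ℂ) * w i‖ ≤ ‖n‖ * ∑ i, ‖w i‖ := by
  refine (norm_sum_le _ _).trans ?_
  rw [Finset.mul_sum]
  refine Finset.sum_le_sum fun i _ => ?_
  rw [norm_mul]
  refine mul_le_mul_of_nonneg_right ?_ (norm_nonneg _)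
  rw [← norm_intCast_vec]
  exact norm_le_pi_norm (fun i => (n i : ℂ)) i

/-- Orbits of nonzero integer vectors under a free action of `ℤ²` grow exponentially in all
directions. -/
theorem DualFree.exists_exp_le_norm {A B : Matrix.GeneralLinearGroup (Fin d) ℤ}
    (hAB : Commute A B) (hfree : DualFree A B) {n : Fin d → ℤ} (hn : n ≠ 0) :
    ∃ c τ : ℝ, 0 < c ∧ 0 < τ ∧
      ∀ l k : ℤ, c * Real.exp (τ * (|(l : ℝ)| + |(k : ℝ)|)) ≤ ‖dualAct (A ^ l * B ^ k) n‖ := by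
  obtain ⟨K, _, _, a, b, hint, hinj, hσ⟩ := exists_numberField_of_orbit hAB hfree hn
  choose hspec w hw using hσ
  obtain ⟨τ, hτ, h⟩ := exists_log_ge a b hint hinj
  let W : ℝ := 1 + ∑ σ, ∑ i, ‖w σ i‖
  have hW : 0 < W := by positivity
  -- `W` bounds the functionals `w σ` for all embeddings at once; `τ` is halved because the maximum
  -- norm of `(l, k)` is at least half of `|l| + |k|`.
  refine ⟨W⁻¹, τ / 2, by positivity, by positivity, fun l k => ?_⟩
  obtain ⟨σ, h1⟩ := h (l, k)
  have hpos : ∀ u : Kˣ, 0 < ‖σ u‖ := fun u => norm_pos_iff.2 ((map_ne_zero σ).2 u.ne_zero)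
  have h2 : ‖σ a ^ l * σ b ^ k‖ = Real.exp (l * Real.log ‖σ a‖ + k * Real.log ‖σ b‖) :=
     norm_zpow_mul_zpow (norm_pos_iff.1 (hpos a)) (norm_pos_iff.1 (hpos b)) l k
  have h3 : τ / 2 * (|(l : ℝ)| + |(k : ℝ)|) ≤ l * Real.log ‖σ a‖ + k * Real.log ‖σ b‖ := by
    refine le_trans ?_ h1
    have h4 : |(l : ℝ)| ≤ ‖((l : ℝ), (k : ℝ))‖ := norm_fst_le ((l : ℝ), (k : ℝ))
    have h5 : |(k : ℝ)| ≤ ‖((l : ℝ), (k : ℝ))‖ := norm_snd_le ((l : ℝ), (k : ℝ))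
    nlinarith
  have h6 := norm_sum_intCast_mul_le (dualAct (A ^ l * B ^ k) n) (w σ)
  have h7 : ∑ i, ‖w σ i‖ ≤ W := by
    have := Finset.single_le_sum (f := fun σ => ∑ i, ‖w σ i‖) (fun _ _ => by positivity)
      (Finset.mem_univ σ)
    simp only [W]
    linarith
  rw [show (∑ i, (dualAct (A ^ l * B ^ k) n i : ℂ) * w σ i) = σ a ^ l * σ b ^ k from hw σ l k,
    h2] at h6
  rw [inv_mul_le_iff₀ hW]
  calc _ ≤ Real.exp (l * Real.log ‖σ a‖ + k * Real.log ‖σ b‖) := Real.exp_le_exp.2 h3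
    _ ≤ _ := h6
    _ ≤ ‖dualAct (A ^ l * B ^ k) n‖ * W := mul_le_mul_of_nonneg_left h7 (norm_nonneg _)
    _ = _ := mul_comm _ _

theorem sum_mul_pow_ne_zero (μ : ℂ) (hμ : 2 ≤ ‖μ‖) (c : ℕ → ℂ) (m : ℕ) (hc : ∀ j, ‖c j‖ ≤ 1)
    (hm : ‖c m‖ = 1) : ∑ j ∈ Finset.range (m + 1), c j * μ ^ j ≠ 0 := by
  intro h0
  rw [Finset.sum_range_succ, add_eq_zero_iff_eq_neg] at h0
  have h1 : ‖∑ j ∈ Finset.range m, c j * μ ^ j‖ ≤ ∑ j ∈ Finset.range m, ‖μ‖ ^ j := by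
    refine (norm_sum_le _ _).trans (Finset.sum_le_sum fun j _ => ?_)
    rw [norm_mul, norm_pow]
    exact mul_le_of_le_one_left (by positivity) (hc j)
  rw [h0, norm_neg, norm_mul, hm, one_mul, norm_pow] at h1
  have h2 := geom_sum_mul ‖μ‖ m
  have h3 : 0 ≤ ∑ j ∈ Finset.range m, ‖μ‖ ^ j := by positivity
  nlinarith

/-- In the difference of two such sums the coefficients lie in `{-1, 0, 1}`, and for `‖μ‖ ≥ 2` the
top power outweighs the sum of all lower ones. -/
theorem sum_pow_injective (μ : ℂ) (hμ : 2 ≤ ‖μ‖) :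
    Function.Injective (fun S : Finset ℕ => ∑ j ∈ S, μ ^ j) := by
  intro S S' hSS'
  by_contra hne
  have hsd : (symmDiff S S').Nonempty := by
    rw [Finset.nonempty_iff_ne_empty]
    intro h
    exact hne (symmDiff_eq_bot.1 h)
  let m := (symmDiff S S').max' hsd
  have hm : m ∈ symmDiff S S' := Finset.max'_mem _ hsd
  let c : ℕ → ℂ := fun j => (if j ∈ S then 1 else 0) - (if j ∈ S' then 1 else 0)
  have hc : ∀ j, m < j → c j = 0 := by
    intro j hj
    have : j ∉ symmDiff S S' := fun h => absurd (Finset.le_max' (symmDiff S S') j h) (not_le.2 hj)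
    rw [Finset.mem_symmDiff] at this
    simp only [c]
    by_cases h1 : j ∈ S <;> by_cases h2 : j ∈ S' <;> simp_all
  refine sum_mul_pow_ne_zero μ hμ c m (fun j => ?_) ?_ ?_
  · simp only [c]
    split_ifs <;> simp
  · rw [Finset.mem_symmDiff] at hm
    simp only [c]
    rcases hm with hm | hm <;> simp [hm]
  · let R := Finset.range (m + 1) ∪ (S ∪ S')
    have h1 : ∑ j ∈ Finset.range (m + 1), c j * μ ^ j = ∑ j ∈ R, c j * μ ^ j := by
      apply Finset.sum_subset Finset.subset_union_left
      intro j _ hj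
      rw [hc j (by rw [Finset.mem_range] at hj; omega), zero_mul]
    have h2 : ∀ Q : Finset ℕ, Q ⊆ R → ∑ j ∈ R, (if j ∈ Q then 1 else 0) * μ ^ j =
        ∑ j ∈ Q, μ ^ j := by
      intro Q hQ
      simp_rw [ite_mul, one_mul, zero_mul]
      rw [← Finset.sum_filter, Finset.filter_mem_eq_inter, Finset.inter_eq_right.2 hQ]
    rw [h1]
    simp only [c, sub_mul]
    rw [Finset.sum_sub_distrib,
      h2 S (Finset.subset_union_left.trans Finset.subset_union_right),
      h2 S' (Finset.subset_union_right.trans Finset.subset_union_right)]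
    exact sub_eq_zero.2 hSS'

/-- A long piece of an orbit does not fit into a small box. -/
theorem DualFree.two_pow_le {A B : Matrix.GeneralLinearGroup (Fin d) ℤ}
    (hAB : Commute A B) (hfree : DualFree A B) {t : ℕ}
    (hA : ∀ z ∈ eigenvalueSet A, 1 < ‖z‖ → 2 ≤ ‖z‖ ^ t) {n : Fin d → ℤ} (hn : n ≠ 0)
    {L M : ℕ} (hM : ∀ j ≤ L, ‖dualAct (A ^ (t * j)) n‖ ≤ M) :
    2 ^ (L + 1) ≤ (2 * ((L + 1) * M) + 1) ^ d := by
  obtain ⟨K, _, _, a, b, hint, hinj, hσ⟩ := exists_numberField_of_orbit hAB hfree hn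
  obtain ⟨σ, hσ1⟩ := exists_norm_one_lt a (by simpa using hint 1 0) (fun m hm h => by
    have := hinj m 0 (by simpa using h)
    simp at this
    omega)
  obtain ⟨hspec, w, hw⟩ := hσ σ
  have hμ : 2 ≤ ‖σ a ^ t‖ := by rw [norm_pow]; exact hA _ hspec hσ1
  -- Subset sums of the orbit. The functional `w` sends them to subset sums of powers of `μ =
  -- σ(a)^t`, with `‖μ‖ ≥ 2`, so all `2 ^ (L + 1)` of them are distinct integer vectors of norm at
  -- most `(L + 1) M`.
  let φ : Finset ℕ → (Fin d → ℤ) := fun S => ∑ j ∈ S, dualAct (A ^ (t * j)) n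
  have hφ : Function.Injective φ := by
    have h1 : ∀ S, ∑ i, ((φ S i : ℤ) : ℂ) * w i = ∑ j ∈ S, (σ a ^ t) ^ j := by
      intro S
      simp only [φ, Finset.sum_apply, Int.cast_sum, Finset.sum_mul]
      rw [Finset.sum_comm]
      refine Finset.sum_congr rfl fun j _ => ?_
      have := hw ((t * j : ℕ) : ℤ) 0
      simp only [zpow_natCast, zpow_zero, mul_one] at this
      rw [← pow_mul]
      exact this
    intro S S' h
    apply sum_pow_injective _ hμ
    simp only [← h1, h]
  have hsub : (Finset.range (L + 1)).powerset.image φ ⊆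
      Finset.Icc (fun _ => -(((L + 1) * M : ℕ) : ℤ)) (fun _ => (((L + 1) * M : ℕ) : ℤ)) := by
    intro x hx
    obtain ⟨S, hS, rfl⟩ := Finset.mem_image.1 hx
    rw [Finset.mem_powerset] at hS
    have h1 : ∀ i, |φ S i| ≤ (((L + 1) * M : ℕ) : ℤ) := by
      intro i
      simp only [φ, Finset.sum_apply]
      refine (Finset.abs_sum_le_sum_abs _ _).trans ?_
      have h2 : ∀ j ∈ S, |dualAct (A ^ (t * j)) n i| ≤ (M : ℤ) := by
        intro j hj
        have h3 := hM j (by have := Finset.mem_range.1 (hS hj); omega)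
        have h4 := (norm_le_pi_norm (dualAct (A ^ (t * j)) n) i).trans h3
        rw [Int.norm_eq_abs] at h4
        exact_mod_cast h4
      refine (Finset.sum_le_card_nsmul _ _ _ h2).trans ?_
      have h5 : S.card ≤ L + 1 := by simpa using Finset.card_le_card hS
      rw [nsmul_eq_mul]
      push_cast
      exact mul_le_mul_of_nonneg_right (by exact_mod_cast h5) (by positivity)
    rw [Finset.mem_Icc]
    exact ⟨fun i => (abs_le.1 (h1 i)).1, fun i => (abs_le.1 (h1 i)).2⟩
  have hcard := Finset.card_le_card hsub
  rw [Finset.card_image_of_injective _ hφ, Finset.card_powerset, Finset.card_range,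
    Pi.card_Icc] at hcard
  refine hcard.trans (le_of_eq ?_)
  simp only [Int.card_Icc, Finset.prod_const, Finset.card_univ, Fintype.card_fin]
  congr 1
  omega

end Growth

/-! ### Uniform growth along the orbits of one matrix -/

section OrbitGrowth

variable {d : ℕ}

theorem toLin'_transpose_pow_intCast (A : Matrix.GeneralLinearGroup (Fin d) ℤ) (n : Fin d → ℤ)
    (j : ℕ) : ((Matrix.toLin' (A.val.map (Int.cast : ℤ → ℂ)).transpose) ^ j) (fun i => (n i : ℂ)) =
      fun i => (dualAct (A ^ j) n i : ℂ) := by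
  induction j with
  | zero => simp
  | succ j ih =>
    rw [pow_succ', Module.End.mul_apply, ih, pow_succ, dualAct_mul]
    ext i
    simp [dualAct, Matrix.mulVec_transpose, Matrix.vecMul, dotProduct]

theorem exists_norm_dualAct_pow_le_add (A : Matrix.GeneralLinearGroup (Fin d) ℤ) (ρ : ℝ)
    (hρ : 1 < ρ) : ∃ C : ℝ, 0 < C ∧ ∀ (n : Fin d → ℤ) (l j : ℕ), j ≤ l →
      ‖dualAct (A ^ j) n‖ ≤ C * ρ ^ l * (‖n‖ + ‖dualAct (A ^ l) n‖) := by
  obtain ⟨C, hC, h⟩ := Module.End.exists_norm_pow_apply_le_add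
    (Matrix.toLin' (A.val.map (Int.cast : ℤ → ℂ)).transpose) ρ hρ
  refine ⟨C + 1, by positivity, fun n l j hj => ?_⟩
  have h1 := h (fun i => (n i : ℂ)) l j hj
  rw [toLin'_transpose_pow_intCast, toLin'_transpose_pow_intCast, norm_intCast_vec,
    norm_intCast_vec, norm_intCast_vec] at h1
  refine h1.trans ?_
  gcongr
  linarith

theorem exists_pow_le_mul_pow (d : ℕ) (r : ℝ) (hr : 1 < r) :
    ∃ C : ℝ, 1 ≤ C ∧ ∀ L : ℕ, (3 * (L : ℝ)) ^ d ≤ C * r ^ L := by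
  have h := (tendsto_pow_const_div_const_pow_of_one_lt d hr).bddAbove_range
  obtain ⟨B, hB⟩ := h
  refine ⟨max 1 (3 ^ d * B), le_max_left _ _, fun L => ?_⟩
  have h1 : (L : ℝ) ^ d / r ^ L ≤ B := hB ⟨L, rfl⟩
  rw [div_le_iff₀ (by positivity)] at h1
  have h2 : (3 ^ d * B) * r ^ L ≤ max 1 (3 ^ d * B) * r ^ L :=
    mul_le_mul_of_nonneg_right (le_max_right _ _) (by positivity)
  rw [mul_pow]
  refine le_trans ?_ h2
  rw [mul_assoc]
  exact mul_le_mul_of_nonneg_left h1 (by positivity)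

/-- The counting bound reads `2^L ≤ (3 L M)^d` with `L` about `l / t` and `M` about `X`. Half of the
exponent on the left absorbs `(3 L)^d`; the `d`-th root of the rest gives `τ = log √2 / (t d)`,
which involves the matrix only through `t`. -/
theorem exists_exp_le_of_norm_le (hd : 0 < d) (t : ℕ) (ht : 0 < t) :
    ∃ τ C : ℝ, 0 < τ ∧ 0 < C ∧ ∀ A B : Matrix.GeneralLinearGroup (Fin d) ℤ, Commute A B →
      DualFree A B → (∀ z ∈ eigenvalueSet A, 1 < ‖z‖ → 2 ≤ ‖z‖ ^ t) →
      ∀ n : Fin d → ℤ, n ≠ 0 → ∀ (l : ℕ) (X : ℝ), 1 ≤ X →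
        (∀ j ≤ l, ‖dualAct (A ^ j) n‖ ≤ X) → Real.exp (τ * l) ≤ C * X := by
  have hs1 : 1 < √(2 : ℝ) := by
    rw [Real.lt_sqrt (by norm_num)]; norm_num
  have hs2 : √(2 : ℝ) * √2 = 2 := Real.mul_self_sqrt (by norm_num)
  obtain ⟨C, hC, hpow⟩ := exists_pow_le_mul_pow d (√2) hs1
  have hlog : 0 < Real.log (√2) := Real.log_pos hs1
  have hdR : (0 : ℝ) < d := by exact_mod_cast hd
  have htR : (0 : ℝ) < t := by exact_mod_cast ht
  refine ⟨Real.log (√2) / (t * d), C * 2, by positivity, by positivity,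
    fun A B hAB hfree hA n hn l X hX hb => ?_⟩
  have hM : ∀ j ≤ l / t, ‖dualAct (A ^ (t * j)) n‖ ≤ ⌈X⌉₊ := fun j hj =>
    (hb (t * j) ((Nat.mul_le_mul_left t hj).trans (Nat.mul_div_le l t))).trans (Nat.le_ceil X)
  have h1 := hfree.two_pow_le hAB hA hn hM
  set M := ⌈X⌉₊ with hMdef
  have hM1 : 1 ≤ M := Nat.one_le_iff_ne_zero.2 (Nat.ceil_pos.2 (by linarith)).ne'
  have hM2 : (M : ℝ) ≤ 2 * X := by
    have := Nat.ceil_lt_add_one (show 0 ≤ X by linarith)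
    linarith
  set L := l / t + 1 with hL
  have h2 : (2 : ℝ) ^ L ≤ (3 * (L : ℝ)) ^ d * (M : ℝ) ^ d := by
    have h3 : (2 * (L * M) + 1) ^ d ≤ (3 * L * M) ^ d := by
      apply Nat.pow_le_pow_left
      have : 1 ≤ L * M := Nat.one_le_iff_ne_zero.2 (by positivity)
      nlinarith
    rw [← mul_pow]
    exact_mod_cast h1.trans h3
  have h4 : (√2 : ℝ) ^ L ≤ C * (M : ℝ) ^ d := by
    have h5 : (2 : ℝ) ^ L = (√2) ^ L * (√2) ^ L := by rw [← mul_pow, hs2]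
    have h6 : (0 : ℝ) < (√2) ^ L := by positivity
    have h7 := h2.trans (mul_le_mul_of_nonneg_right (hpow L) (by positivity))
    rw [h5] at h7
    have h8 : (√2 : ℝ) ^ L * (√2) ^ L ≤ (C * (M : ℝ) ^ d) * (√2) ^ L := by linarith
    exact le_of_mul_le_mul_right h8 h6
  have h9 : Real.exp (Real.log (√2) / (t * d) * l) ^ d ≤ (√2 : ℝ) ^ L := by
    rw [← Real.exp_nat_mul]
    have h10 : (√2 : ℝ) ^ L = Real.exp (L * Real.log (√2)) := by
      rw [Real.exp_nat_mul, Real.exp_log (by positivity)]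
    rw [h10, Real.exp_le_exp]
    have h11 : (l : ℝ) ≤ t * L := by
      have := Nat.lt_mul_div_succ l ht
      exact_mod_cast this.le
    have h12 : (d : ℝ) * (Real.log (√2) / (t * d) * l) = (l / t) * Real.log (√2) := by
      field_simp
    rw [h12]
    refine mul_le_mul_of_nonneg_right ?_ hlog.le
    rw [div_le_iff₀ htR]
    linarith
  have h13 : C * (M : ℝ) ^ d ≤ (C * M) ^ d := by
    rw [mul_pow]
    exact mul_le_mul_of_nonneg_right (le_self_pow₀ hC hd.ne') (by positivity)
  have h14 : Real.exp (Real.log (√2) / (t * d) * l) ≤ C * M :=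
    le_of_pow_le_pow_left₀ hd.ne' (by positivity) (h9.trans (h4.trans h13))
  nlinarith

/-- Orbits of integer vectors grow exponentially after a time logarithmic in their length; the rate
depends only on the dimension and on the eigenvalues of the matrix. -/
theorem exists_exp_le_norm_add_norm (hd : 0 < d) (t : ℕ) (ht : 0 < t) :
    ∃ τ : ℝ, 0 < τ ∧ ∀ A B : Matrix.GeneralLinearGroup (Fin d) ℤ, Commute A B → DualFree A B →
      (∀ z ∈ eigenvalueSet A, 1 < ‖z‖ → 2 ≤ ‖z‖ ^ t) →
      ∃ c : ℝ, 0 < c ∧ ∀ n : Fin d → ℤ, n ≠ 0 → ∀ l : ℕ,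
        c * Real.exp (τ * l) ≤ ‖n‖ + ‖dualAct (A ^ l) n‖ := by
  obtain ⟨τ, C, hτ, hC, h⟩ := exists_exp_le_of_norm_le hd t ht
  refine ⟨τ / 2, by positivity, fun A B hAB hfree hA => ?_⟩
  -- With rate `τ / 2` the end-point bound puts the whole segment into a box of size a constant
  -- times `e^(τ l / 2) S`; the counting bound `e^(τ l)` still wins by a factor `e^(τ l / 2)`.
  obtain ⟨D, hD, hconv⟩ := exists_norm_dualAct_pow_le_add A (Real.exp (τ / 2))
    (Real.one_lt_exp_iff.2 (by positivity))
  refine ⟨(C * (D + 1))⁻¹, by positivity, fun n hn l => ?_⟩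
  have hn1 := one_le_norm_of_ne_zero hn
  have hE : 1 ≤ Real.exp (τ / 2) ^ l := one_le_pow₀ (Real.one_le_exp (by positivity))
  set S := ‖n‖ + ‖dualAct (A ^ l) n‖ with hS
  have hS1 : 1 ≤ S := by have := norm_nonneg (dualAct (A ^ l) n); linarith
  have h1 := h A B hAB hfree hA n hn l ((D + 1) * Real.exp (τ / 2) ^ l * S)
    (one_le_mul_of_one_le_of_one_le (one_le_mul_of_one_le_of_one_le (by linarith) hE) hS1)
    (fun j hj => (hconv n l j hj).trans (by gcongr; linarith))
  rw [inv_mul_le_iff₀ (by positivity)]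
  have h2 : Real.exp (τ * l) = Real.exp (τ / 2 * l) * Real.exp (τ / 2 * l) := by
    rw [← Real.exp_add]; ring_nf
  have h3 : Real.exp (τ / 2) ^ l = Real.exp (τ / 2 * l) := by
    rw [← Real.exp_nat_mul, mul_comm]
  rw [h2, h3] at h1
  have h4 : Real.exp (τ / 2 * l) * Real.exp (τ / 2 * l) ≤
      (C * (D + 1) * S) * Real.exp (τ / 2 * l) := by linarith
  exact le_of_mul_le_mul_right h4 (Real.exp_pos _)

theorem dualAct_pow_dualAct_inv_pow (A : Matrix.GeneralLinearGroup (Fin d) ℤ) (a b : ℕ)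
    (n : Fin d → ℤ) : dualAct (A ^ (a + b)) (dualAct (A⁻¹ ^ a) n) = dualAct (A ^ b) n := by
  rw [← dualAct_mul, pow_add, ← mul_assoc, inv_pow, inv_mul_cancel, one_mul]

/-- The hypothesis is applied to the vector `n A^(-l)`, which `A^l` carries back to `n`. -/
theorem norm_inv_dualAct_growth {A : Matrix.GeneralLinearGroup (Fin d) ℤ} {τ c : ℝ}
    (h : ∀ n : Fin d → ℤ, n ≠ 0 → ∀ l : ℕ,
      c * Real.exp (τ * l) ≤ ‖n‖ + ‖dualAct (A ^ l) n‖) (n : Fin d → ℤ) (hn : n ≠ 0) (l : ℕ) :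
    c * Real.exp (τ * l) ≤ ‖n‖ + ‖dualAct (A⁻¹ ^ l) n‖ := by
  have h1 := h _ (dualAct_ne_zero (A⁻¹ ^ l) hn) l
  have h2 := dualAct_pow_dualAct_inv_pow A l 0 n
  rw [add_zero, pow_zero, dualAct_one] at h2
  rw [h2] at h1
  linarith

/-- Along one of the two halves of its orbit, an integer vector does not shrink much. -/
theorem exists_norm_rpow_le_or {A : Matrix.GeneralLinearGroup (Fin d) ℤ} {τ c : ℝ} (hτ : 0 < τ)
    (hc : 0 < c) (h : ∀ n : Fin d → ℤ, n ≠ 0 → ∀ l : ℕ,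
      c * Real.exp (τ * l) ≤ ‖n‖ + ‖dualAct (A ^ l) n‖) (ε : ℝ) (hε : 0 < ε) :
    ∃ κ : ℝ, 0 < κ ∧ ∀ n : Fin d → ℤ, n ≠ 0 →
      (∀ l : ℕ, κ * ‖n‖ ^ (1 - ε) ≤ ‖dualAct (A ^ l) n‖) ∨
      (∀ l : ℕ, κ * ‖n‖ ^ (1 - ε) ≤ ‖dualAct (A⁻¹ ^ l) n‖) := by
  obtain ⟨D, hD, hconv⟩ := exists_norm_dualAct_pow_le_add A (Real.exp (ε * τ / 2))
    (Real.one_lt_exp_iff.2 (by positivity))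
  let Q : ℝ := (2 / c) ^ ε
  have hQ : 0 < Q := by positivity
  refine ⟨min 1 (1 / (4 * D * Q)), by positivity, fun n hn => ?_⟩
  set κ := min 1 (1 / (4 * D * Q)) with hκ
  -- Suppose the norm is small at a future time `b` and at a past time `-a`. The growth bound makes
  -- `a` and `b` logarithmic in `‖n‖`, so interpolating between these two ends bounds `‖n‖` by `D *
  -- (Q ‖n‖^ε) * (2 κ ‖n‖^(1-ε))`. The choice of `κ` makes this at most `‖n‖ / 2`.
  by_contra! hcon
  obtain ⟨⟨b, hb⟩, a, ha⟩ := hcon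
  have hn1 := one_le_norm_of_ne_zero hn
  have hn0 : 0 < ‖n‖ := by linarith
  have hsmall : κ * ‖n‖ ^ (1 - ε) ≤ ‖n‖ := by
    calc κ * ‖n‖ ^ (1 - ε) ≤ 1 * ‖n‖ ^ (1 : ℝ) := by
          refine mul_le_mul (min_le_left _ _)
            (Real.rpow_le_rpow_of_exponent_le hn1 (by linarith)) (by positivity) zero_le_one
      _ = ‖n‖ := by simp
  have hexp : ∀ i : ℕ, c * Real.exp (τ * i) ≤ 2 * ‖n‖ →
      Real.exp (ε * τ / 2 * i) * Real.exp (ε * τ / 2 * i) ≤ Q * ‖n‖ ^ ε := by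
    intro i hi
    have h1 : Real.exp (τ * i) ≤ 2 / c * ‖n‖ := by
      rw [div_mul_eq_mul_div, le_div_iff₀ hc]; linarith
    have h2 := Real.rpow_le_rpow (Real.exp_pos _).le h1 hε.le
    rw [Real.mul_rpow (by positivity) hn0.le, ← Real.exp_mul] at h2
    rw [← Real.exp_add]
    refine le_trans (le_of_eq ?_) h2
    ring_nf
  have hb' := hexp b (by have := h n hn b; linarith)
  have ha' := hexp a (by have := norm_inv_dualAct_growth h n hn a; linarith)
  have h3 := hconv (dualAct (A⁻¹ ^ a) n) (a + b) a (Nat.le_add_right _ _)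
  have h4 := dualAct_pow_dualAct_inv_pow A a 0 n
  rw [add_zero, pow_zero, dualAct_one] at h4
  rw [h4, dualAct_pow_dualAct_inv_pow] at h3
  have h5 : Real.exp (ε * τ / 2) ^ (a + b) ≤ Q * ‖n‖ ^ ε := by
    have h6 : Real.exp (ε * τ / 2) ^ (a + b) =
        Real.exp (ε * τ / 2 * a) * Real.exp (ε * τ / 2 * b) := by
      rw [← Real.exp_nat_mul, ← Real.exp_add]; push_cast; ring_nf
    rw [h6]
    nlinarith [sq_nonneg (Real.exp (ε * τ / 2 * a) - Real.exp (ε * τ / 2 * b))]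
  have h7 : ‖n‖ ^ ε * ‖n‖ ^ (1 - ε) = ‖n‖ := by
    rw [← Real.rpow_add hn0]; simp
  have h8 : ‖n‖ < D * (Q * ‖n‖ ^ ε) * (2 * (κ * ‖n‖ ^ (1 - ε))) := by
    refine lt_of_le_of_lt h3 ?_
    have h9 : 0 ≤ ‖dualAct (A⁻¹ ^ a) n‖ + ‖dualAct (A ^ b) n‖ := by positivity
    have h10 : ‖dualAct (A⁻¹ ^ a) n‖ + ‖dualAct (A ^ b) n‖ < 2 * (κ * ‖n‖ ^ (1 - ε)) := by
      linarith
    calc D * Real.exp (ε * τ / 2) ^ (a + b) * (‖dualAct (A⁻¹ ^ a) n‖ + ‖dualAct (A ^ b) n‖)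
        ≤ D * (Q * ‖n‖ ^ ε) * (‖dualAct (A⁻¹ ^ a) n‖ + ‖dualAct (A ^ b) n‖) := by gcongr
      _ < _ := mul_lt_mul_of_pos_left h10 (by positivity)
  have h11 : κ * (4 * D * Q) ≤ 1 := by
    have := min_le_right 1 (1 / (4 * D * Q))
    rw [← hκ, le_div_iff₀ (by positivity)] at this
    exact this
  have h12 : D * (Q * ‖n‖ ^ ε) * (2 * (κ * ‖n‖ ^ (1 - ε))) =
      (κ * (4 * D * Q)) / 2 * (‖n‖ ^ ε * ‖n‖ ^ (1 - ε)) := by ring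
  rw [h12, h7] at h8
  nlinarith

/-- Split `y^N = y^(N-p) y^p`. The first factor is at least a constant times `x^((1-ε)(N-p))`. Since
`x, y ≥ 1` gives `x + y ≤ 2 x y`, the second satisfies `x^p y^p ≥ (c/2)^p e^(τ p l)`, which beats
`Λ^l` with `θ^l` to spare. The cost in powers of `x` is `2p + ε(N-p) ≤ 2p + 1/4 ≤ q`. -/
theorem pow_mul_inv_pow_le {τ c κ ε p Λ θ x y : ℝ} {N q : ℕ} (hc : 0 < c) (hκ : 0 < κ)
    (hp : 0 < p) (hθ : 0 < θ) (hΛ : θ⁻¹ * Λ ≤ Real.exp (τ * p)) (hΛ0 : 0 ≤ Λ) (hq : 2 * p + 1 / 4 ≤ q)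
    (hqN : q ≤ N) (hε0 : 0 ≤ ε) (hε : ε * (N + 1) ≤ 1 / 4) (hx : 1 ≤ x) (hy : 1 ≤ y) (l : ℕ)
    (hxy : κ * x ^ (1 - ε) ≤ y) (hexp : c * Real.exp (τ * l) ≤ x + y) :
    Λ ^ l * (y ^ N)⁻¹ ≤ (κ ^ (N - p))⁻¹ * ((c / 2) ^ p)⁻¹ * (θ ^ l * (x ^ (N - q))⁻¹) := by
  have hx0 : 0 < x := by linarith
  have hy0 : 0 < y := by linarith
  have hqN' : (q : ℝ) ≤ N := by exact_mod_cast hqN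
  have hNp : 0 ≤ (N : ℝ) - p := by linarith
  have h1 : κ ^ (N - p) * x ^ ((1 - ε) * (N - p)) ≤ y ^ ((N : ℝ) - p) := by
    rw [Real.rpow_mul hx0.le, ← Real.mul_rpow hκ.le (by positivity)]
    exact Real.rpow_le_rpow (by positivity) hxy hNp
  have h2 : (c / 2) ^ p * ((θ⁻¹ * Λ) ^ l) ≤ x ^ p * y ^ p := by
    have h3 : c / 2 * Real.exp (τ * l) ≤ x * y := by nlinarith
    have h4 := Real.rpow_le_rpow (by positivity) h3 hp.le
    rw [Real.mul_rpow hx0.le hy0.le, Real.mul_rpow (by positivity) (Real.exp_pos _).le] at h4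
    refine le_trans ?_ h4
    refine mul_le_mul_of_nonneg_left ?_ (by positivity)
    calc (θ⁻¹ * Λ) ^ l ≤ Real.exp (τ * p) ^ l := pow_le_pow_left₀ (by positivity) hΛ l
      _ = _ := by rw [← Real.exp_nat_mul, ← Real.exp_mul]; ring_nf
  have h5 : x ^ (((N - q : ℕ) : ℝ) + p) ≤ x ^ ((1 - ε) * ((N : ℝ) - p)) := by
    apply Real.rpow_le_rpow_of_exponent_le hx
    rw [Nat.cast_sub hqN]
    nlinarith [mul_nonneg hε0 hp.le]
  have h6 : x ^ (((N - q : ℕ) : ℝ) + p) = x ^ (N - q) * x ^ p := by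
    rw [Real.rpow_add hx0, Real.rpow_natCast]
  have h7 : y ^ ((N : ℝ) - p) * y ^ p = y ^ N := by
    rw [← Real.rpow_add hy0, sub_add_cancel, Real.rpow_natCast]
  have h8 : κ ^ ((N : ℝ) - p) * (c / 2) ^ p * ((θ⁻¹ * Λ) ^ l * x ^ (N - q)) ≤ y ^ N := by
    have h9 : κ ^ ((N : ℝ) - p) * (x ^ (N - q) * x ^ p) ≤ y ^ ((N : ℝ) - p) :=
      le_trans (mul_le_mul_of_nonneg_left (h6 ▸ h5) (by positivity)) h1
    have h10 : 0 < x ^ p := by positivity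
    have h11 : κ ^ ((N : ℝ) - p) * (x ^ (N - q) * x ^ p) * ((c / 2) ^ p * ((θ⁻¹ * Λ) ^ l)) ≤
        y ^ ((N : ℝ) - p) * (x ^ p * y ^ p) :=
      mul_le_mul h9 h2 (by positivity) (by positivity)
    have h12 : (κ ^ ((N : ℝ) - p) * (c / 2) ^ p * ((θ⁻¹ * Λ) ^ l * x ^ (N - q))) * x ^ p ≤
        y ^ N * x ^ p := by
      calc _ = κ ^ ((N : ℝ) - p) * (x ^ (N - q) * x ^ p) * ((c / 2) ^ p * ((θ⁻¹ * Λ) ^ l)) := by ring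
        _ ≤ _ := h11
        _ = y ^ ((N : ℝ) - p) * y ^ p * x ^ p := by ring
        _ = _ := by rw [h7]
    exact le_of_mul_le_mul_right h12 h10
  have hk : 0 < κ ^ ((N : ℝ) - p) := by positivity
  have hcp : 0 < (c / 2) ^ p := by positivity
  rw [← div_eq_mul_inv, div_le_iff₀ (by positivity)]
  have h13 : Λ ^ l = (κ ^ ((N : ℝ) - p))⁻¹ * ((c / 2) ^ p)⁻¹ * (θ ^ l * (x ^ (N - q))⁻¹) *
      (κ ^ ((N : ℝ) - p) * (c / 2) ^ p * ((θ⁻¹ * Λ) ^ l * x ^ (N - q))) := by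
    rw [mul_pow, inv_pow]
    field_simp
  rw [h13]
  exact mul_le_mul_of_nonneg_left h8 (by positivity)

/-- Weighted sums of a rapidly decaying sequence over one of the half orbits of an integer vector
lose only `q` powers of its length. -/
theorem exists_pow_mul_inv_pow_dualAct_le {A : Matrix.GeneralLinearGroup (Fin d) ℤ} {τ c : ℝ}
    (hτ : 0 < τ) (hc : 0 < c) (h : ∀ n : Fin d → ℤ, n ≠ 0 → ∀ l : ℕ,
      c * Real.exp (τ * l) ≤ ‖n‖ + ‖dualAct (A ^ l) n‖) {p Λ θ : ℝ} {q : ℕ}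
    (hp : 0 < p) (hθ : 0 < θ) (hΛ : θ⁻¹ * Λ ≤ Real.exp (τ * p)) (hΛ0 : 0 ≤ Λ) (hq : 2 * p + 1 / 4 ≤ q)
    (N₀ : ℕ) :
    ∃ C : ℝ, 0 ≤ C ∧ ∀ n : Fin d → ℤ, n ≠ 0 →
      (∀ N l : ℕ, q ≤ N → N ≤ N₀ → Λ ^ l * (‖dualAct (A ^ l) n‖ ^ N)⁻¹ ≤
        C * (θ ^ l * (‖n‖ ^ (N - q))⁻¹)) ∨
      (∀ N l : ℕ, q ≤ N → N ≤ N₀ → Λ ^ l * (‖dualAct (A⁻¹ ^ l) n‖ ^ N)⁻¹ ≤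
        C * (θ ^ l * (‖n‖ ^ (N - q))⁻¹)) := by
  have hε : ∀ N : ℕ, N ≤ N₀ → 1 / (4 * ((N₀ : ℝ) + 1)) * (N + 1) ≤ 1 / 4 := by
    intro N hN
    have : (N : ℝ) ≤ N₀ := by exact_mod_cast hN
    rw [div_mul_eq_mul_div, div_le_div_iff₀ (by positivity) (by norm_num)]
    linarith
  -- The exponent `ε` must shrink with the order `N₀` to keep the loss below `q`. Thus the good half
  -- of an orbit may depend on `N₀`, but for a given `N₀` it serves all `N` and `l`.
  obtain ⟨κ, hκ, hor⟩ := exists_norm_rpow_le_or hτ hc h (1 / (4 * ((N₀ : ℝ) + 1))) (by positivity)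
  let D : ℕ → ℝ := fun N => (κ ^ (N - p))⁻¹ * ((c / 2) ^ p)⁻¹
  have hD : ∀ N, 0 ≤ D N := fun N => by positivity
  have hsum : ∀ N ≤ N₀, D N ≤ ∑ N ∈ Finset.range (N₀ + 1), D N := fun N hN =>
    Finset.single_le_sum (fun i _ => hD i) (Finset.mem_range.2 (by omega))
  refine ⟨∑ N ∈ Finset.range (N₀ + 1), D N, Finset.sum_nonneg fun i _ => hD i, fun n hn => ?_⟩
  have hn1 := one_le_norm_of_ne_zero hn
  rcases hor n hn with h1 | h1
  · exact Or.inl fun N l hqN hN => (pow_mul_inv_pow_le hc hκ hp hθ hΛ hΛ0 hq hqN (by positivity)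
      (hε N hN) hn1 (one_le_norm_of_ne_zero (dualAct_ne_zero _ hn)) l (h1 l) (h n hn l)).trans
      (mul_le_mul_of_nonneg_right (hsum N hN) (by positivity))
  · exact Or.inr fun N l hqN hN => (pow_mul_inv_pow_le hc hκ hp hθ hΛ hΛ0 hq hqN (by positivity)
      (hε N hN) hn1 (one_le_norm_of_ne_zero (dualAct_ne_zero _ hn)) l (h1 l)
      (norm_inv_dualAct_growth h n hn l)).trans
      (mul_le_mul_of_nonneg_right (hsum N hN) (by positivity))

end OrbitGrowth

/-! ### The cohomological equation for Fourier coefficients -/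

section CoefficientEquation

/-- Once the obstruction vanishes, this replaces the forward half of an orbit sum by the backward
half, which starts at index `-1`. -/
theorem hasSum_neg_of_tsum_eq_zero {W : Type*} [NormedAddCommGroup W]
    [CompleteSpace W] {f : ℤ → W} (hf : Summable f) (h0 : ∑' z, f z = 0) :
    HasSum (fun l : ℕ => -f (-((l : ℤ) + 1))) (∑' l : ℕ, f l) := by
  have h1 : Summable (fun l : ℕ => f l) := hf.comp_injective Nat.cast_injective
  have h2 : Summable (fun l : ℕ => f (-((l : ℤ) + 1))) :=
    hf.comp_injective (i := fun l : ℕ => -((l : ℤ) + 1)) (fun a b hab => by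
      simp only at hab; omega)
  have h3 := HasSum.of_nat_of_neg_add_one h1.hasSum h2.hasSum
  rw [eq_neg_of_add_eq_zero_left (h3.tsum_eq.symm.trans h0)]
  exact h2.hasSum.neg

variable {d : ℕ} {W : Type*} [NormedAddCommGroup W]

/-- Decay faster than every power. -/
def RapidDecay (r : (Fin d → ℤ) → W) : Prop :=
  ∀ N : ℕ, ∃ C : ℝ, 0 ≤ C ∧ ∀ n, n ≠ 0 → ‖r n‖ ≤ C * (‖n‖ ^ N)⁻¹

theorem RapidDecay.exists_orbit_bound {A B : Matrix.GeneralLinearGroup (Fin d) ℤ}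
    (hAB : Commute A B) (hfree : DualFree A B) {r : (Fin d → ℤ) → W} (hr : RapidDecay r) {Λ : ℝ}
    (hΛ : 0 < Λ) {n : Fin d → ℤ} (hn : n ≠ 0) :
    ∃ C : ℝ, 0 ≤ C ∧ ∀ l k : ℤ, Λ ^ (l.natAbs + k.natAbs) * ‖r (dualAct (A ^ l * B ^ k) n)‖ ≤
      C * (1 / 2) ^ (l.natAbs + k.natAbs) := by
  obtain ⟨c, τ, hc, hτ, h⟩ := hfree.exists_exp_le_norm hAB hn
  -- Decay of order `N` with `e^(τ N) > 2 Λ` beats the operator growth and leaves a factor `1/2` per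
  -- step.
  obtain ⟨N, hN⟩ := pow_unbounded_of_one_lt (2 * Λ) (Real.one_lt_exp_iff.2 hτ)
  obtain ⟨C, hC, hrN⟩ := hr N
  refine ⟨C * (c ^ N)⁻¹, by positivity, fun l k => ?_⟩
  have hM : |(l : ℝ)| + |(k : ℝ)| = ((l.natAbs + k.natAbs : ℕ) : ℝ) := by
    push_cast
    rw [Nat.cast_natAbs, Nat.cast_natAbs]
    push_cast
    rfl
  have h1 := h l k
  rw [hM] at h1
  set M := l.natAbs + k.natAbs
  set m := dualAct (A ^ l * B ^ k) n
  have hm : m ≠ 0 := dualAct_ne_zero _ hn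
  have h2 : c ^ N * (2 * Λ) ^ M ≤ ‖m‖ ^ N := by
    refine le_trans ?_ (pow_le_pow_left₀ (mul_nonneg hc.le (Real.exp_pos _).le) h1 N)
    rw [mul_pow c]
    refine mul_le_mul_of_nonneg_left ?_ (pow_nonneg hc.le N)
    calc (2 * Λ) ^ M ≤ (Real.exp τ ^ N) ^ M := pow_le_pow_left₀ (by positivity) hN.le M
      _ = Real.exp (τ * M) ^ N := by
        rw [← Real.exp_nat_mul, ← Real.exp_nat_mul, ← Real.exp_nat_mul]; ring_nf
  have h3 : (‖m‖ ^ N)⁻¹ ≤ (c ^ N * (2 * Λ) ^ M)⁻¹ := inv_anti₀ (by positivity) h2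
  calc Λ ^ M * ‖r m‖ ≤ Λ ^ M * (C * (c ^ N * (2 * Λ) ^ M)⁻¹) := by
        refine mul_le_mul_of_nonneg_left ((hrN m hm).trans ?_) (by positivity)
        exact mul_le_mul_of_nonneg_left h3 hC
    _ = C * (c ^ N)⁻¹ * (1 / 2) ^ M := by
        rw [mul_pow, one_div, inv_pow]; field_simp

variable [NormedSpace ℂ W]

/-- The powers of `T`, positive and negative, grow at most like the powers of `Λ`. -/
def PowBound (T : (W →L[ℂ] W)ˣ) (Λ D : ℝ) : Prop :=
  ∀ z : ℤ, ‖((T ^ z : (W →L[ℂ] W)ˣ) : W →L[ℂ] W)‖ ≤ D * Λ ^ z.natAbs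

theorem PowBound.nonneg {T : (W →L[ℂ] W)ˣ} {Λ D : ℝ} (h : PowBound T Λ D) : 0 ≤ D := by
  have := (norm_nonneg _).trans (h 0)
  simpa using this

theorem PowBound.norm_apply_le {T : (W →L[ℂ] W)ˣ} {Λ D : ℝ} (h : PowBound T Λ D) (z : ℤ) (w : W) :
    ‖((T ^ z : (W →L[ℂ] W)ˣ) : W →L[ℂ] W) w‖ ≤ D * Λ ^ z.natAbs * ‖w‖ :=
  ((T ^ z : (W →L[ℂ] W)ˣ) : W →L[ℂ] W).le_of_opNorm_le (h z) w

theorem summable_half_pow_natAbs : Summable (fun z : ℤ => (1 / 2 : ℝ) ^ z.natAbs) := by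
  apply Summable.of_nat_of_neg <;> simpa using summable_geometric_two

variable {A B : Matrix.GeneralLinearGroup (Fin d) ℤ} {T T' : (W →L[ℂ] W)ˣ} {Λ D : ℝ}

/-- The factor `Λ ^ k.natAbs` is carried along to pay for a later application of `T'^k`. -/
theorem RapidDecay.exists_norm_term_le (hAB : Commute A B) (hfree : DualFree A B)
    {r : (Fin d → ℤ) → W} (hr : RapidDecay r) (hΛ : 0 < Λ) (hT : PowBound T Λ D)
    {n : Fin d → ℤ} (hn : n ≠ 0) :
    ∃ C : ℝ, 0 ≤ C ∧ ∀ z k : ℤ, Λ ^ k.natAbs *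
      ‖((T ^ z : (W →L[ℂ] W)ˣ) : W →L[ℂ] W) (r (dualAct (A ^ z) (dualAct (B ^ k) n)))‖ ≤
      C * (1 / 2) ^ k.natAbs * (1 / 2) ^ z.natAbs := by
  obtain ⟨C, hC, h⟩ := hr.exists_orbit_bound hAB hfree hΛ hn
  have hD := hT.nonneg
  refine ⟨D * C, by positivity, fun z k => ?_⟩
  have h1 := h z k
  rw [((hAB.zpow_left z).zpow_right k).eq, dualAct_mul] at h1
  have h2 := hT.norm_apply_le z (r (dualAct (A ^ z) (dualAct (B ^ k) n)))
  calc _ ≤ Λ ^ k.natAbs * (D * Λ ^ z.natAbs * ‖r (dualAct (A ^ z) (dualAct (B ^ k) n))‖) :=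
        mul_le_mul_of_nonneg_left h2 (by positivity)
    _ = D * (Λ ^ (z.natAbs + k.natAbs) * ‖r (dualAct (A ^ z) (dualAct (B ^ k) n))‖) := by
        rw [pow_add]; ring
    _ ≤ D * (C * (1 / 2) ^ (z.natAbs + k.natAbs)) := mul_le_mul_of_nonneg_left h1 hD
    _ = _ := by rw [pow_add]; ring

theorem apply_zpow_add_one (T : (W →L[ℂ] W)ˣ) (z : ℤ) (w : W) :
    ((T ^ (z + 1) : (W →L[ℂ] W)ˣ) : W →L[ℂ] W) w =
      ((T ^ z : (W →L[ℂ] W)ˣ) : W →L[ℂ] W) ((T : W →L[ℂ] W) w) := by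
  rw [zpow_add_one]
  rfl

theorem dualAct_zpow_add_one (A : Matrix.GeneralLinearGroup (Fin d) ℤ) (z : ℤ) (n : Fin d → ℤ) :
    dualAct (A ^ (z + 1)) n = dualAct A (dualAct (A ^ z) n) := by
  rw [zpow_add_one, dualAct_mul]

theorem apply_comm_of_commute (hTT' : Commute T T') (z : ℤ) (w : W) :
    (T' : W →L[ℂ] W) (((T ^ z : (W →L[ℂ] W)ˣ) : W →L[ℂ] W) w) =
      ((T ^ z : (W →L[ℂ] W)ˣ) : W →L[ℂ] W) ((T' : W →L[ℂ] W) w) := by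
  have h : T' * T ^ z = T ^ z * T' := ((hTT'.zpow_left z).eq).symm
  have h1 := congrArg (fun u : (W →L[ℂ] W)ˣ => (u : W →L[ℂ] W) w) h
  exact h1

variable [CompleteSpace W]

theorem RapidDecay.summable_orbit (hAB : Commute A B) (hfree : DualFree A B)
    {r : (Fin d → ℤ) → W} (hr : RapidDecay r) (hΛ : 0 < Λ) (hT : PowBound T Λ D)
    {n : Fin d → ℤ} (hn : n ≠ 0) :
    Summable fun z : ℤ => ((T ^ z : (W →L[ℂ] W)ˣ) : W →L[ℂ] W) (r (dualAct (A ^ z) n)) := by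
  obtain ⟨C, hC, h⟩ := hr.exists_norm_term_le hAB hfree hΛ hT hn
  refine Summable.of_norm_bounded (summable_half_pow_natAbs.mul_left C) fun z => ?_
  simpa using h z 0

/-- The obstruction to solving the cohomological equation for `A` vanishes. -/
theorem tsum_orbit_eq_zero (hAB : Commute A B) (hfree : DualFree A B) (hTT' : Commute T T')
    (hΛ : 0 < Λ) (hT : PowBound T Λ D) (hT' : PowBound T' Λ D)
    {r s : (Fin d → ℤ) → W} (hr : RapidDecay r) (hs : RapidDecay s)
    (hrs : ∀ m, m ≠ 0 → r m - (T' : W →L[ℂ] W) (r (dualAct B m)) =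
      s m - (T : W →L[ℂ] W) (s (dualAct A m))) {n : Fin d → ℤ} (hn : n ≠ 0) :
    ∑' z : ℤ, ((T ^ z : (W →L[ℂ] W)ˣ) : W →L[ℂ] W) (r (dualAct (A ^ z) n)) = 0 := by
  let O : (Fin d → ℤ) → W := fun n =>
    ∑' z : ℤ, ((T ^ z : (W →L[ℂ] W)ˣ) : W →L[ℂ] W) (r (dualAct (A ^ z) n))
  -- Along the `A`-orbit the relation turns `O n - T' O(n B)` into a two-sided telescoping sum of
  -- `s`, which vanishes by shift invariance.
  have hstep : ∀ n, n ≠ 0 → O n = (T' : W →L[ℂ] W) (O (dualAct B n)) := by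
    intro n hn
    have h1 := hr.summable_orbit hAB hfree hΛ hT hn
    have h2 := hr.summable_orbit hAB hfree hΛ hT (dualAct_ne_zero B hn)
    have h3 := hs.summable_orbit hAB hfree hΛ hT hn
    have h4 : ∑' z : ℤ, ((T ^ (z + 1) : (W →L[ℂ] W)ˣ) : W →L[ℂ] W) (s (dualAct (A ^ (z + 1)) n)) =
        ∑' z : ℤ, ((T ^ z : (W →L[ℂ] W)ˣ) : W →L[ℂ] W) (s (dualAct (A ^ z) n)) :=
      (Equiv.addRight (1 : ℤ)).tsum_eq
        (fun z : ℤ => ((T ^ z : (W →L[ℂ] W)ˣ) : W →L[ℂ] W) (s (dualAct (A ^ z) n)))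
    have h5 : Summable fun z : ℤ =>
        ((T ^ (z + 1) : (W →L[ℂ] W)ˣ) : W →L[ℂ] W) (s (dualAct (A ^ (z + 1)) n)) :=
      (Equiv.addRight (1 : ℤ)).summable_iff.2 h3
    rw [← sub_eq_zero]
    simp only [O]
    rw [ContinuousLinearMap.map_tsum _ h2,
      ← h1.tsum_sub ((T' : W →L[ℂ] W).summable h2), ← sub_eq_zero.2 h4.symm, ← h3.tsum_sub h5]
    refine tsum_congr fun z => ?_
    have h6 : dualAct (A ^ z) (dualAct B n) = dualAct B (dualAct (A ^ z) n) := by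
      rw [← dualAct_mul, ← dualAct_mul, ((hAB.zpow_left z).eq)]
    rw [apply_comm_of_commute hTT', h6, apply_zpow_add_one, dualAct_zpow_add_one, ← map_sub,
      ← map_sub, hrs _ (dualAct_ne_zero _ hn)]
  have hiter : ∀ k : ℕ, O n = ((T' ^ (k : ℤ) : (W →L[ℂ] W)ˣ) : W →L[ℂ] W)
      (O (dualAct (B ^ (k : ℤ)) n)) := by
    intro k
    induction k with
    | zero => simp
    | succ k ih =>
      rw [ih, hstep _ (dualAct_ne_zero _ hn), ← dualAct_zpow_add_one, ← apply_zpow_add_one]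
      push_cast
      rfl
  obtain ⟨C, hC, h⟩ := hr.exists_norm_term_le hAB hfree hΛ hT hn
  -- The growth `Λ^k` of `T'^k` cancels against the decay of the orbit sum at `n B^k`, and `2^(-k)`
  -- remains.
  have hbound : ∀ k : ℕ, ‖O n‖ ≤ D * C * (∑' z : ℤ, (1 / 2 : ℝ) ^ z.natAbs) * (1 / 2) ^ k := by
    intro k
    have h1 : ‖O (dualAct (B ^ (k : ℤ)) n)‖ ≤
        (∑' z : ℤ, (1 / 2 : ℝ) ^ z.natAbs) * (C * (1 / 2) ^ k * (Λ ^ k)⁻¹) := by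
      refine tsum_of_norm_bounded (summable_half_pow_natAbs.hasSum.mul_right _) fun z => ?_
      have h2 := h z k
      rw [Int.natAbs_natCast, ← le_div_iff₀' (by positivity)] at h2
      refine h2.trans (le_of_eq ?_)
      rw [div_eq_mul_inv]; ring
    have h3 := hT'.norm_apply_le k (O (dualAct (B ^ (k : ℤ)) n))
    rw [← hiter, Int.natAbs_natCast] at h3
    have hD := hT.nonneg
    refine (h3.trans (mul_le_mul_of_nonneg_left h1 (by positivity))).trans (le_of_eq ?_)
    field_simp
  have hlim : Filter.Tendsto (fun k : ℕ => D * C * (∑' z : ℤ, (1 / 2 : ℝ) ^ z.natAbs) *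
      (1 / 2 : ℝ) ^ k) Filter.atTop (nhds 0) := by
    simpa using (tendsto_pow_atTop_nhds_zero_of_lt_one (by norm_num : (0 : ℝ) ≤ 1 / 2)
      (by norm_num)).const_mul (D * C * (∑' z : ℤ, (1 / 2 : ℝ) ^ z.natAbs))
  have h0 : ‖O n‖ ≤ 0 := ge_of_tendsto' hlim hbound
  exact norm_le_zero_iff.1 h0

/-- The solution of `g n - T (g (n A)) = r n`. -/
noncomputable def orbitSum (T : (W →L[ℂ] W)ˣ) (A : Matrix.GeneralLinearGroup (Fin d) ℤ)
    (r : (Fin d → ℤ) → W) (n : Fin d → ℤ) : W :=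
  ∑' l : ℕ, ((T ^ (l : ℤ) : (W →L[ℂ] W)ˣ) : W →L[ℂ] W) (r (dualAct (A ^ (l : ℤ)) n))

theorem hasSum_orbitSum (hAB : Commute A B) (hfree : DualFree A B) (hΛ : 0 < Λ)
    (hT : PowBound T Λ D) {r : (Fin d → ℤ) → W} (hr : RapidDecay r) {n : Fin d → ℤ} (hn : n ≠ 0) :
    HasSum (fun l : ℕ => ((T ^ (l : ℤ) : (W →L[ℂ] W)ˣ) : W →L[ℂ] W)
      (r (dualAct (A ^ (l : ℤ)) n))) (orbitSum T A r n) :=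
  ((hr.summable_orbit hAB hfree hΛ hT hn).comp_injective Nat.cast_injective).hasSum

theorem hasSum_orbitSum_neg (hAB : Commute A B) (hfree : DualFree A B) (hTT' : Commute T T')
    (hΛ : 0 < Λ) (hT : PowBound T Λ D) (hT' : PowBound T' Λ D)
    {r s : (Fin d → ℤ) → W} (hr : RapidDecay r) (hs : RapidDecay s)
    (hrs : ∀ m, m ≠ 0 → r m - (T' : W →L[ℂ] W) (r (dualAct B m)) =
      s m - (T : W →L[ℂ] W) (s (dualAct A m))) {n : Fin d → ℤ} (hn : n ≠ 0) :
    HasSum (fun l : ℕ => -((T ^ (-((l : ℤ) + 1)) : (W →L[ℂ] W)ˣ) : W →L[ℂ] W)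
      (r (dualAct (A ^ (-((l : ℤ) + 1))) n))) (orbitSum T A r n) := by
  exact hasSum_neg_of_tsum_eq_zero
    (f := fun z : ℤ => ((T ^ z : (W →L[ℂ] W)ˣ) : W →L[ℂ] W) (r (dualAct (A ^ z) n)))
    (hr.summable_orbit hAB hfree hΛ hT hn)
    (tsum_orbit_eq_zero hAB hfree hTT' hΛ hT hT' hr hs hrs hn)

theorem orbitSum_sub (hAB : Commute A B) (hfree : DualFree A B) (hΛ : 0 < Λ)
    (hT : PowBound T Λ D) {r : (Fin d → ℤ) → W} (hr : RapidDecay r) {n : Fin d → ℤ} (hn : n ≠ 0) :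
    orbitSum T A r n - (T : W →L[ℂ] W) (orbitSum T A r (dualAct A n)) = r n := by
  have h1 := hasSum_orbitSum hAB hfree hΛ hT hr hn
  have h2 := hasSum_orbitSum hAB hfree hΛ hT hr (dualAct_ne_zero A hn)
  have h3 := h1.summable.tsum_eq_zero_add
  rw [h1.tsum_eq] at h3
  rw [h3, ← h2.tsum_eq, ContinuousLinearMap.map_tsum _ h2.summable]
  simp only [Nat.cast_zero, zpow_zero, Units.val_one, dualAct_one, one_apply_eq_self]
  rw [add_sub_assoc, add_eq_left, sub_eq_zero]
  refine tsum_congr fun l => ?_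
  rw [apply_comm_of_commute (Commute.refl T)]
  push_cast
  rw [apply_zpow_add_one, add_comm (l : ℤ) 1, zpow_add, zpow_one, dualAct_mul]

/-- The relation makes the difference equal to `Σ_{l ≥ 0} (T^l s(n A^l) - T^(l+1) s(n A^(l+1)))`,
which telescopes to its first term. -/
theorem orbitSum_sub_of_relation (hAB : Commute A B) (hfree : DualFree A B)
    (hTT' : Commute T T') (hΛ : 0 < Λ) (hT : PowBound T Λ D)
    {r s : (Fin d → ℤ) → W} (hr : RapidDecay r) (hs : RapidDecay s)
    (hrs : ∀ m, m ≠ 0 → r m - (T' : W →L[ℂ] W) (r (dualAct B m)) =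
      s m - (T : W →L[ℂ] W) (s (dualAct A m))) {n : Fin d → ℤ} (hn : n ≠ 0) :
    orbitSum T A r n - (T' : W →L[ℂ] W) (orbitSum T A r (dualAct B n)) = s n := by
  have h1 := hasSum_orbitSum hAB hfree hΛ hT hr hn
  have h2 := hasSum_orbitSum hAB hfree hΛ hT hr (dualAct_ne_zero B hn)
  have h3 := hasSum_orbitSum hAB hfree hΛ hT hs hn
  have h4 := (summable_nat_add_iff 1).2 h3.summable
  have h5 := h3.summable.tsum_eq_zero_add
  simp only [Nat.cast_zero, zpow_zero, Units.val_one, dualAct_one,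
    one_apply_eq_self] at h5
  rw [← h1.tsum_eq, ← h2.tsum_eq, ContinuousLinearMap.map_tsum _ h2.summable,
    ← h1.summable.tsum_sub ((T' : W →L[ℂ] W).summable h2.summable)]
  rw [← sub_eq_iff_eq_add] at h5
  rw [← h5, ← h3.summable.tsum_sub h4]
  refine tsum_congr fun l => ?_
  have h6 : dualAct (A ^ (l : ℤ)) (dualAct B n) = dualAct B (dualAct (A ^ (l : ℤ)) n) := by
    rw [← dualAct_mul, ← dualAct_mul, ((hAB.zpow_left l).eq)]
  push_cast
  rw [apply_comm_of_commute hTT', h6, apply_zpow_add_one, dualAct_zpow_add_one, ← map_sub,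
    ← map_sub, hrs _ (dualAct_ne_zero _ hn)]

/-- A rapidly decaying solution of the homogeneous equation vanishes. -/
theorem eq_zero_of_homogeneous (hAB : Commute A B) (hfree : DualFree A B) (hΛ : 0 < Λ)
    (hT : PowBound T Λ D) {r : (Fin d → ℤ) → W} (hr : RapidDecay r)
    (h : ∀ m, m ≠ 0 → r m = (T : W →L[ℂ] W) (r (dualAct A m))) {n : Fin d → ℤ} (hn : n ≠ 0) :
    r n = 0 := by
  have h1 := hasSum_orbitSum hAB hfree hΛ hT hr hn
  -- All terms of the convergent series equal `r n`, and terms of a convergent series tend to zero.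
  have h2 : ∀ l : ℕ, ((T ^ (l : ℤ) : (W →L[ℂ] W)ˣ) : W →L[ℂ] W)
      (r (dualAct (A ^ (l : ℤ)) n)) = r n := by
    intro l
    induction l with
    | zero => simp
    | succ l ih =>
      rw [h _ (dualAct_ne_zero _ hn), ← dualAct_zpow_add_one, ← apply_zpow_add_one] at ih
      exact_mod_cast ih
  simp only [h2] at h1
  exact tendsto_nhds_unique tendsto_const_nhds h1.summable.tendsto_atTop_zero

end CoefficientEquation

/-! ### Smooth functions on the torus and their periodic lifts -/

section Lift

variable {d s : ℕ}

/-- The covering map of `𝕋ᵈ × 𝕋ˢ`. -/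
def prodProj (p : (Fin d → ℝ) × (Fin s → ℝ)) : Torus d × Torus s :=
  (torusProj p.1, torusProj p.2)

theorem isOpenQuotientMap_prodProj :
    IsOpenQuotientMap (prodProj : (Fin d → ℝ) × (Fin s → ℝ) → Torus d × Torus s) := by
  have h1 : IsOpenQuotientMap (QuotientAddGroup.mk : ℝ → UnitAddCircle) :=
    QuotientAddGroup.isOpenQuotientMap_mk
  have h2 : ∀ k : ℕ, IsOpenQuotientMap (torusProj : (Fin k → ℝ) → Torus k) := fun k =>
    IsOpenQuotientMap.piMap fun _ => h1
  exact (h2 d).prodMap (h2 s)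

theorem prodProj_surjective :
    Function.Surjective (prodProj : (Fin d → ℝ) × (Fin s → ℝ) → Torus d × Torus s) :=
  isOpenQuotientMap_prodProj.surjective

theorem torusProj_add {k : ℕ} (x y : Fin k → ℝ) :
    torusProj (x + y) = torusProj x + torusProj y := by
  funext i
  simp [torusProj]

theorem torusProj_surjective {k : ℕ} : Function.Surjective (torusProj : (Fin k → ℝ) → Torus k) := by
  intro x
  choose y hy using fun i => QuotientAddGroup.mk_surjective (x i)
  exact ⟨y, funext hy⟩

theorem prodProj_add (p q : (Fin d → ℝ) × (Fin s → ℝ)) :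
    prodProj (p + q) = prodProj p + prodProj q :=
  Prod.ext (torusProj_add _ _) (torusProj_add _ _)

variable {W : Type*} [NormedAddCommGroup W] [NormedSpace ℝ W]

/-- The periodic function on `ℝᵈ × ℝˢ` defined by a function on `𝕋ᵈ × 𝕋ˢ`. -/
def prodLift (f : Torus d × Torus s → W) : (Fin d → ℝ) × (Fin s → ℝ) → W := fun p => f (prodProj p)

/-- Smoothness of a function on `𝕋ᵈ × 𝕋ˢ`. -/
def ProdSmooth (f : Torus d × Torus s → W) : Prop := ContDiff ℝ ∞ (prodLift f)

/-- The partial derivative of a function on `𝕋ᵈ × 𝕋ˢ`. -/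
noncomputable def torusDeriv (v : Fin d ⊕ Fin s) (f : Torus d × Torus s → W) :
    Torus d × Torus s → W := fun q =>
  fderiv ℝ (prodLift f) (Function.surjInv prodProj_surjective q) (coordDir v)

/-- `torusDeriv` differentiates at an arbitrarily chosen lift; two lifts differ by a period, so the
choice does not matter. -/
theorem prodLift_torusDeriv (v : Fin d ⊕ Fin s) (f : Torus d × Torus s → W) :
    prodLift (torusDeriv v f) = fun p => fderiv ℝ (prodLift f) p (coordDir v) := by
  funext p
  have h1 := Function.surjInv_eq prodProj_surjective (prodProj p)
  set p' := Function.surjInv prodProj_surjective (prodProj p) with hp'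
  have h2 : (fun x => prodLift f (x + (p' - p))) = prodLift f := by
    funext x
    have h3 : prodProj (x + (p' - p)) = prodProj x := by
      have h4 := prodProj_add p (p' - p)
      rw [add_sub_cancel, h1, left_eq_add] at h4
      rw [prodProj_add, h4, add_zero]
    simp only [prodLift, h3]
  change fderiv ℝ (prodLift f) p' (coordDir v) = _
  have h5 := fderiv_comp_add_right (𝕜 := ℝ) (f := prodLift f) (x := p) (p' - p)
  rw [h2, add_sub_cancel] at h5
  rw [h5]

theorem ProdSmooth.partialDeriv {f : Torus d × Torus s → W} (hf : ProdSmooth f) (v : Fin d ⊕ Fin s) :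
    ProdSmooth (torusDeriv v f) := by
  rw [ProdSmooth, prodLift_torusDeriv]
  exact (hf.fderiv_right (m := ∞) (by simp)).clm_apply contDiff_const

theorem ProdSmooth.continuous {f : Torus d × Torus s → W} (hf : ProdSmooth f) : Continuous f :=
  (isOpenQuotientMap_prodProj.isQuotientMap.continuous_iff).2 (ContDiff.continuous hf)

theorem ProdSmooth.exists_norm_le {f : Torus d × Torus s → W} (hf : ProdSmooth f) :
    ∃ C : ℝ, 0 ≤ C ∧ ∀ q, ‖f q‖ ≤ C := by
  obtain ⟨C, hC⟩ := isCompact_univ.exists_bound_of_continuousOn hf.continuous.continuousOn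
  exact ⟨max C 0, le_max_right _ _, fun q => (hC q trivial).trans (le_max_left _ _)⟩

/-- Iterated partial derivatives of a function on `𝕋ᵈ × 𝕋ˢ`. -/
noncomputable def torusDerivs (L : List (Fin d ⊕ Fin s)) (f : Torus d × Torus s → W) :
    Torus d × Torus s → W := L.foldr torusDeriv f

@[simp] theorem torusDerivs_nil (f : Torus d × Torus s → W) : torusDerivs [] f = f := rfl

@[simp] theorem torusDerivs_cons (v : Fin d ⊕ Fin s) (L : List (Fin d ⊕ Fin s))
    (f : Torus d × Torus s → W) :
    torusDerivs (v :: L) f = torusDeriv v (torusDerivs L f) := rfl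

theorem torusDerivs_append (L L' : List (Fin d ⊕ Fin s)) (f : Torus d × Torus s → W) :
    torusDerivs (L ++ L') f = torusDerivs L (torusDerivs L' f) := by
  simp [torusDerivs, List.foldr_append]

theorem ProdSmooth.iterDeriv {f : Torus d × Torus s → W} (hf : ProdSmooth f)
    (L : List (Fin d ⊕ Fin s)) : ProdSmooth (torusDerivs L f) := by
  induction L with
  | nil => exact hf
  | cons v L ih => exact ih.partialDeriv v

/-- The iterated derivative of a smooth function along coordinate directions, as a list of
directional derivatives. -/
noncomputable def dirDerivs : List (Fin d ⊕ Fin s) → ((Fin d → ℝ) × (Fin s → ℝ) → W) →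
    (Fin d → ℝ) × (Fin s → ℝ) → W
  | [], F => F
  | v :: L, F => fun p => fderiv ℝ (dirDerivs L F) p (coordDir v)

theorem iteratedFDeriv_coordDir {F : (Fin d → ℝ) × (Fin s → ℝ) → W} {k : ℕ}
    (hF : ContDiff ℝ k F) (v : Fin k → Fin d ⊕ Fin s) (p : (Fin d → ℝ) × (Fin s → ℝ)) :
    iteratedFDeriv ℝ k F p (fun i => coordDir (v i)) = dirDerivs (List.ofFn v) F p := by
  induction k generalizing p with
  | zero => simp [dirDerivs]
  | succ k ih =>
    have hF' : ContDiff ℝ k F := hF.of_le (by exact_mod_cast Nat.le_succ k)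
    have h1 : Differentiable ℝ (iteratedFDeriv ℝ k F) :=
      hF.differentiable_iteratedFDeriv (by exact_mod_cast Nat.lt_succ_self k)
    rw [iteratedFDeriv_succ_apply_left, List.ofFn_succ]
    have h2 : dirDerivs (List.ofFn fun i => v i.succ) F =
        fun p => iteratedFDeriv ℝ k F p (fun i => coordDir (v i.succ)) := by
      funext p
      exact (ih hF' (fun i => v i.succ) p).symm
    simp only [dirDerivs]
    rw [h2, fderiv_continuousMultilinear_apply_const_apply (h1 p)]
    rfl

theorem dirDerivs_prodLift (L : List (Fin d ⊕ Fin s)) (f : Torus d × Torus s → W) :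
    dirDerivs L (prodLift f) = prodLift (torusDerivs L f) := by
  induction L with
  | nil => rfl
  | cons v L ih => rw [torusDerivs_cons, prodLift_torusDeriv, ← ih]; rfl

/-- The coordinate functions of `ℝᵈ × ℝˢ`. -/
noncomputable def coordFun : Fin d ⊕ Fin s → ((Fin d → ℝ) × (Fin s → ℝ) →L[ℝ] ℝ) :=
  Sum.elim
    (fun i => (ContinuousLinearMap.proj (R := ℝ) (φ := fun _ : Fin d => ℝ) i).comp
      (ContinuousLinearMap.fst ℝ _ _))
    (fun j => (ContinuousLinearMap.proj (R := ℝ) (φ := fun _ : Fin s => ℝ) j).comp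
      (ContinuousLinearMap.snd ℝ _ _))

theorem norm_coordFun_apply_le (v : Fin d ⊕ Fin s) (p : (Fin d → ℝ) × (Fin s → ℝ)) :
    ‖coordFun v p‖ ≤ ‖p‖ := by
  rcases v with i | j
  · exact (norm_le_pi_norm p.1 i).trans (norm_fst_le p)
  · exact (norm_le_pi_norm p.2 j).trans (norm_snd_le p)

theorem sum_coordFun_smul_coordDir (p : (Fin d → ℝ) × (Fin s → ℝ)) :
    ∑ v, coordFun v p • (coordDir v : (Fin d → ℝ) × (Fin s → ℝ)) = p := by
  rw [Fintype.sum_sum_type]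
  ext i
  · simp [coordFun, coordDir, Prod.fst_sum, Pi.single_apply]
  · simp [coordFun, coordDir, Prod.snd_sum, Pi.single_apply]

theorem coordFun_coordDir (v w : Fin d ⊕ Fin s) :
    coordFun v (coordDir w : (Fin d → ℝ) × (Fin s → ℝ)) = if v = w then 1 else 0 := by
  rcases v with i | j <;> rcases w with i' | j' <;> simp [coordFun, coordDir, Pi.single_apply]

theorem continuousLinearMap_eq_sum (ℓ : (Fin d → ℝ) × (Fin s → ℝ) →L[ℝ] W) :
    ℓ = ∑ v, (coordFun v).smulRight (ℓ (coordDir v)) := by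
  refine ContinuousLinearMap.ext fun p => ?_
  conv_lhs => rw [← sum_coordFun_smul_coordDir p]
  simp [map_sum]

/-- Each argument is expanded in the coordinate basis. This turns bounds on partial derivatives into
bounds on `iteratedFDeriv`. -/
theorem norm_multilinear_le {k : ℕ}
    (M : ContinuousMultilinearMap ℝ (fun _ : Fin k => (Fin d → ℝ) × (Fin s → ℝ)) W) {C : ℝ}
    (hC : 0 ≤ C) (h : ∀ v : Fin k → Fin d ⊕ Fin s, ‖M fun i => coordDir (v i)‖ ≤ C) :
    ‖M‖ ≤ (Fintype.card (Fin k → Fin d ⊕ Fin s)) * C := by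
  refine M.opNorm_le_bound (by positivity) fun m => ?_
  have h1 : M m = ∑ v : Fin k → Fin d ⊕ Fin s,
      (∏ i, coordFun (v i) (m i)) • M fun i => coordDir (v i) := by
    have h2 : m = fun i => ∑ v, coordFun v (m i) • coordDir v := by
      funext i
      exact (sum_coordFun_smul_coordDir (m i)).symm
    conv_lhs => rw [h2]
    rw [M.map_sum]
    refine Finset.sum_congr rfl fun v _ => ?_
    rw [M.map_smul_univ]
  rw [h1]
  refine (norm_sum_le _ _).trans ?_
  have h3 : ∀ v ∈ (Finset.univ : Finset (Fin k → Fin d ⊕ Fin s)),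
      ‖(∏ i, coordFun (v i) (m i)) • M fun i => coordDir (v i)‖ ≤ C * ∏ i, ‖m i‖ := by
    intro v _
    rw [norm_smul, norm_prod, mul_comm]
    refine mul_le_mul (h v) (Finset.prod_le_prod (fun _ _ => norm_nonneg _) fun i _ =>
      norm_coordFun_apply_le _ _) (by positivity) hC
  refine (Finset.sum_le_card_nsmul _ _ _ h3).trans (le_of_eq ?_)
  rw [nsmul_eq_mul, Finset.card_univ]
  ring

end Lift

/-! ### Fourier analysis in the base variable -/

/-- The lattice sum converges because the exponent exceeds the rank `d`; `max 1` only serves the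
term `n = 0`. -/
theorem summable_max_one_norm_inv_pow (d : ℕ) :
    Summable fun n : Fin d → ℤ => ((max 1 ‖n‖) ^ (d + 1))⁻¹ := by
  let b := Pi.basisFun ℝ (Fin d)
  let L := Submodule.span ℤ (Set.range b)
  have hrank : Module.finrank ℤ L = d := by
    rw [ZLattice.rank ℝ L]; simp
  have h1 := ZLattice.summable_norm_pow_inv L (d + 1) (by omega)
  have hmem : ∀ n : Fin d → ℤ, (fun i => (n i : ℝ)) ∈ L := by
    intro n
    have : (fun i => (n i : ℝ)) = ∑ i, n i • b i := by
      ext j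
      simp [b, Finset.sum_apply, Pi.single_apply]
    rw [this]
    exact Submodule.sum_mem _ fun i _ =>
      Submodule.smul_mem _ _ (Submodule.subset_span ⟨i, rfl⟩)
  have h2 : Summable fun n : Fin d → ℤ => ‖n‖⁻¹ ^ (d + 1) := by
    have hinj : Function.Injective (fun n : Fin d → ℤ => (⟨_, hmem n⟩ : L)) := by
      intro n m hnm
      funext i
      have : ((n i : ℤ) : ℝ) = m i := congrFun (congrArg Subtype.val hnm) i
      exact_mod_cast this
    have h3 := h1.comp_injective hinj
    refine h3.congr fun n => ?_
    have : ‖(⟨_, hmem n⟩ : L)‖ = ‖n‖ := by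
      change ‖fun i => (n i : ℝ)‖ = ‖n‖
      simp only [Pi.norm_def]
      congr 2
    simp only [Function.comp_apply, this]
  have h4 : Summable fun n : Fin d → ℤ => if n = 0 then (1 : ℝ) else 0 :=
    summable_of_ne_finset_zero (s := {0}) (fun n hn => by simpa using hn)
  refine Summable.of_nonneg_of_le (fun n => by positivity) (fun n => ?_) (h2.add h4)
  by_cases hn : n = 0
  · subst hn; simp
  · have hn1 := one_le_norm_of_ne_zero hn
    simp [hn, max_eq_right hn1]

section Fourier

variable {d s m : ℕ}

/-- The character `e(n · h)` on `ℝᵈ`. -/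
noncomputable def chi (n : Fin d → ℤ) (h : Fin d → ℝ) : ℂ := UnitAddTorus.mFourier n (torusProj h)

theorem norm_mFourier_apply (n : Fin d → ℤ) (x : Torus d) : ‖UnitAddTorus.mFourier n x‖ = 1 := by
  simp only [UnitAddTorus.mFourier, ContinuousMap.coe_mk, norm_prod, fourier_apply,
    Circle.norm_coe, Finset.prod_const_one]

theorem norm_chi (n : Fin d → ℤ) (h : Fin d → ℝ) : ‖chi n h‖ = 1 := norm_mFourier_apply _ _

theorem mFourier_apply_add (n : Fin d → ℤ) (x y : Torus d) :
    UnitAddTorus.mFourier n (x + y) = UnitAddTorus.mFourier n x * UnitAddTorus.mFourier n y := by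
  simp only [UnitAddTorus.mFourier, ContinuousMap.coe_mk, Pi.add_apply, ← Finset.prod_mul_distrib]
  refine Finset.prod_congr rfl fun i _ => ?_
  simp [fourier_apply, AddCircle.toCircle_add]

theorem chi_eq_exp (n : Fin d → ℤ) (h : Fin d → ℝ) :
    chi n h = Complex.exp (∑ i, 2 * Real.pi * Complex.I * n i * h i) := by
  rw [Complex.exp_sum]
  simp only [chi, UnitAddTorus.mFourier, ContinuousMap.coe_mk, torusProj]
  refine Finset.prod_congr rfl fun i _ => ?_
  rw [fourier_coe_apply]
  simp

theorem hasFDerivAt_chi (n : Fin d → ℤ) (p : (Fin d → ℝ) × (Fin s → ℝ)) :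
    HasFDerivAt (fun p : (Fin d → ℝ) × (Fin s → ℝ) => chi n p.1)
      (∑ i, (coordFun (Sum.inl i) : (Fin d → ℝ) × (Fin s → ℝ) →L[ℝ] ℝ).smulRight
        (2 * Real.pi * Complex.I * n i * chi n p.1)) p := by
  have h1 : HasFDerivAt (fun p : (Fin d → ℝ) × (Fin s → ℝ) =>
      ∑ i, 2 * Real.pi * Complex.I * n i * (p.1 i : ℂ))
      (∑ i, (coordFun (Sum.inl i) : (Fin d → ℝ) × (Fin s → ℝ) →L[ℝ] ℝ).smulRight
        (2 * Real.pi * Complex.I * n i)) p := by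
    apply HasFDerivAt.fun_sum
    intro i _
    have h2 := (ContinuousLinearMap.hasFDerivAt (x := p)
      ((coordFun (Sum.inl i) : (Fin d → ℝ) × (Fin s → ℝ) →L[ℝ] ℝ).smulRight
        (2 * Real.pi * Complex.I * n i)))
    refine h2.congr_of_eventuallyEq (Filter.Eventually.of_forall fun q => ?_)
    simp [coordFun, mul_comm]
  have h3 := h1.cexp
  have h4 : (fun p : (Fin d → ℝ) × (Fin s → ℝ) => chi n p.1) =
      fun p => Complex.exp (∑ i, 2 * Real.pi * Complex.I * n i * (p.1 i : ℂ)) := by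
    funext p
    exact chi_eq_exp n p.1
  rw [h4]
  refine h3.congr_fderiv ?_
  refine ContinuousLinearMap.ext fun q => ?_
  rw [chi_eq_exp]
  simp only [smul_apply, sum_apply,
    ContinuousLinearMap.smulRight_apply, Finset.smul_sum]
  refine Finset.sum_congr rfl fun i _ => ?_
  simp only [smul_eq_mul, Complex.real_smul]
  ring

/-- The Fourier coefficients in the base variable. -/
noncomputable def baseCoeff (f : Torus d × Torus s → Fin m → ℂ) (n : Fin d → ℤ) (y : Torus s) :
    Fin m → ℂ :=
  ∫ x, UnitAddTorus.mFourier (-n) x • f (x, y)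

theorem volume_unitAddCircle_eq :
    (volume : Measure UnitAddCircle) = AddCircle.haarAddCircle := by
  simp [AddCircle.volume_eq_smul_haarAddCircle]

instance isProbabilityMeasure_volume_unitAddCircle :
    IsProbabilityMeasure (volume : Measure UnitAddCircle) := by
  rw [volume_unitAddCircle_eq]; infer_instance

theorem mFourierCoeff_eq_integral_volume {E : Type*} [NormedAddCommGroup E] [NormedSpace ℂ E]
    (f : Torus d → E) (n : Fin d → ℤ) :
    UnitAddTorus.mFourierCoeff f n = ∫ x, UnitAddTorus.mFourier (-n) x • f x := by
  have h : (Measure.pi fun _ : Fin d => AddCircle.haarAddCircle) =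
      (volume : Measure (Torus d)) := by
    rw [volume_pi, volume_unitAddCircle_eq]
  rw [← h]
  rfl

theorem norm_baseCoeff_le {f : Torus d × Torus s → Fin m → ℂ} {C : ℝ} (hf : ∀ q, ‖f q‖ ≤ C)
    (n : Fin d → ℤ) (y : Torus s) : ‖baseCoeff f n y‖ ≤ C := by
  rw [baseCoeff]
  refine (norm_integral_le_of_norm_le_const (C := C)
    (Filter.Eventually.of_forall fun x => ?_)).trans (by simp)
  rw [norm_smul, norm_mFourier_apply, one_mul]
  exact hf _

/-- The Fourier coefficients of the translates of a function. -/
noncomputable def translateCoeff (n : Fin d → ℤ) (f : Torus d × Torus s → Fin m → ℂ)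
    (p : (Fin d → ℝ) × (Fin s → ℝ)) : Fin m → ℂ :=
  ∫ x, UnitAddTorus.mFourier (-n) x • f (x + torusProj p.1, torusProj p.2)

theorem mFourier_neg_mul (n : Fin d → ℤ) (x : Torus d) :
    UnitAddTorus.mFourier n x * UnitAddTorus.mFourier (-n) x = 1 := by
  rw [← UnitAddTorus.mFourier_add]
  simp [UnitAddTorus.mFourier_zero]

theorem translateCoeff_eq (n : Fin d → ℤ) (f : Torus d × Torus s → Fin m → ℂ)
    (p : (Fin d → ℝ) × (Fin s → ℝ)) :
    translateCoeff n f p = chi n p.1 • baseCoeff f n (torusProj p.2) := by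
  have h1 := integral_add_right_eq_self (μ := (volume : Measure (Torus d)))
    (fun x => UnitAddTorus.mFourier (-n) x • f (x, torusProj p.2)) (torusProj p.1)
  rw [baseCoeff, ← h1, ← integral_smul, translateCoeff]
  refine integral_congr_ae (Filter.Eventually.of_forall fun x => ?_)
  simp only
  rw [mFourier_apply_add, smul_smul, chi, mul_left_comm, mFourier_neg_mul, mul_one]

theorem continuous_smul_translate {f : Torus d × Torus s → Fin m → ℂ} (hf : Continuous f)
    (n : Fin d → ℤ) (p : (Fin d → ℝ) × (Fin s → ℝ)) :
    Continuous fun x : Torus d =>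
      UnitAddTorus.mFourier (-n) x • f (x + torusProj p.1, torusProj p.2) := by
  have := (UnitAddTorus.mFourier (-n)).continuous
  fun_prop

theorem integrable_smul_translate {f : Torus d × Torus s → Fin m → ℂ} (hf : Continuous f)
    (n : Fin d → ℤ) (p : (Fin d → ℝ) × (Fin s → ℝ)) :
    Integrable fun x : Torus d =>
      UnitAddTorus.mFourier (-n) x • f (x + torusProj p.1, torusProj p.2) :=
  (continuous_smul_translate hf n p).integrable_of_hasCompactSupport
    (HasCompactSupport.of_compactSpace _)

/-- Differentiation under the integral sign, dominated by the sup norms of the partial derivatives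
on the compact torus. -/
theorem hasFDerivAt_translateCoeff {f : Torus d × Torus s → Fin m → ℂ} (hf : ProdSmooth f)
    (n : Fin d → ℤ) (p : (Fin d → ℝ) × (Fin s → ℝ)) :
    HasFDerivAt (translateCoeff n f)
      (∑ v, (coordFun v).smulRight (translateCoeff n (torusDeriv v f) p)) p := by
  choose C hC hCb using fun v => (hf.partialDeriv v).exists_norm_le
  let F' : (Fin d → ℝ) × (Fin s → ℝ) → Torus d →
      ((Fin d → ℝ) × (Fin s → ℝ) →L[ℝ] (Fin m → ℂ)) := fun p x =>
    ∑ v, ContinuousLinearMap.smulRightL ℝ _ _ (coordFun v)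
      (UnitAddTorus.mFourier (-n) x • torusDeriv v f (x + torusProj p.1, torusProj p.2))
  have hcont : ∀ p, Continuous (F' p) := fun p =>
    continuous_finsetSum _ fun v _ => (ContinuousLinearMap.continuous _).comp
      (continuous_smul_translate (hf.partialDeriv v).continuous n p)
  have h1 := hasFDerivAt_integral_of_dominated_of_fderiv_le (𝕜 := ℝ)
    (μ := (volume : Measure (Torus d)))
    (F := fun p x => UnitAddTorus.mFourier (-n) x • f (x + torusProj p.1, torusProj p.2))
    (F' := F') (x₀ := p) (s := Set.univ) (bound := fun _ => ∑ v, ‖coordFun (d := d) (s := s) v‖ * C v)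
    Filter.univ_mem
    (Filter.Eventually.of_forall fun p =>
      (continuous_smul_translate hf.continuous n p).aestronglyMeasurable)
    (integrable_smul_translate hf.continuous n p)
    ((hcont p).aestronglyMeasurable)
    (Filter.Eventually.of_forall fun x q _ => by
      refine (norm_sum_le _ _).trans (Finset.sum_le_sum fun v _ => ?_)
      refine (ContinuousLinearMap.norm_smulRight_apply _ _).le.trans ?_
      rw [norm_smul, norm_mFourier_apply, one_mul]
      exact mul_le_mul_of_nonneg_left (hCb v _) (norm_nonneg _))
    (integrable_const _)
    (Filter.Eventually.of_forall fun x q _ => by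
      obtain ⟨x', rfl⟩ := torusProj_surjective x
      have h2 : (fun q : (Fin d → ℝ) × (Fin s → ℝ) =>
          f (torusProj x' + torusProj q.1, torusProj q.2)) = fun q => prodLift f (q + (x', 0)) := by
        funext q
        simp [prodLift, prodProj, torusProj_add, add_comm]
      have h3 : HasFDerivAt (fun q => prodLift f (q + (x', 0)))
          (fderiv ℝ (prodLift f) (q + (x', 0))) q := by
        have h4 : HasFDerivAt (prodLift f) (fderiv ℝ (prodLift f) (q + (x', 0))) (q + (x', 0)) :=
          (hf.differentiable (by simp)).differentiableAt.hasFDerivAt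
        have h5 := h4.comp q ((hasFDerivAt_id q).add_const ((x', 0) : (Fin d → ℝ) × (Fin s → ℝ)))
        simpa using h5
      rw [← h2] at h3
      refine (h3.const_smul (UnitAddTorus.mFourier (-n) (torusProj x'))).congr_fderiv ?_
      rw [continuousLinearMap_eq_sum (fderiv ℝ (prodLift f) (q + (x', 0))), Finset.smul_sum]
      refine Finset.sum_congr rfl fun v _ => ?_
      have h6 : fderiv ℝ (prodLift f) (q + (x', 0)) (coordDir v) =
          torusDeriv v f (torusProj x' + torusProj q.1, torusProj q.2) := by
        have h7 := congrFun (prodLift_torusDeriv v f) (q + (x', 0))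
        rw [← h7]
        simp [prodLift, prodProj, torusProj_add, add_comm]
      rw [h6]
      refine ContinuousLinearMap.ext fun w => ?_
      simp only [smul_apply, ContinuousLinearMap.smulRight_apply]
      exact smul_comm _ _ _)
  refine h1.congr_fderiv ?_
  simp only [F']
  rw [integral_finsetSum]
  · refine Finset.sum_congr rfl fun v _ => ?_
    rw [ContinuousLinearMap.integral_comp_comm _
      (integrable_smul_translate (hf.partialDeriv v).continuous n p)]
    rfl
  · intro v _
    exact ContinuousLinearMap.integrable_comp _
      (integrable_smul_translate (hf.partialDeriv v).continuous n p)

/-- Differentiation in the base multiplies Fourier coefficients by the frequency. -/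
theorem baseCoeff_torusDeriv_inl {f : Torus d × Torus s → Fin m → ℂ} (hf : ProdSmooth f)
    (n : Fin d → ℤ) (i : Fin d) (y : Torus s) :
    baseCoeff (torusDeriv (Sum.inl i) f) n y =
      (2 * Real.pi * Complex.I * n i) • baseCoeff f n y := by
  obtain ⟨y', rfl⟩ := torusProj_surjective y
  -- Translation in the base multiplies the coefficient by a character. Computing the derivative of
  -- the translated coefficient in both ways and comparing takes the place of an integration by
  -- parts.
  have h1 := hasFDerivAt_translateCoeff hf n (0, y')
  have h2 : (fun t : ℝ => translateCoeff n f ((0, y') + t • coordDir (Sum.inl i))) =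
      fun t => chi n (t • Pi.single i 1 : Fin d → ℝ) • baseCoeff f n (torusProj y') := by
    funext t
    rw [translateCoeff_eq]
    simp [coordDir]
  have h3 : HasDerivAt (fun t : ℝ => (((0 : Fin d → ℝ), y') + t • (coordDir (Sum.inl i)) :
      (Fin d → ℝ) × (Fin s → ℝ))) (coordDir (Sum.inl i)) 0 := by
    have := ((hasDerivAt_id (0 : ℝ)).smul_const
      (coordDir (Sum.inl i) : (Fin d → ℝ) × (Fin s → ℝ))).const_add ((0 : Fin d → ℝ), y')
    simpa using this
  have h4 := HasFDerivAt.comp_hasDerivAt (0 : ℝ) (l := translateCoeff n f)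
    (f := fun t : ℝ => (((0 : Fin d → ℝ), y') + t • (coordDir (Sum.inl i)) :
      (Fin d → ℝ) × (Fin s → ℝ))) (by rw [zero_smul, add_zero]; exact h1) h3
  have h5 := HasFDerivAt.comp_hasDerivAt (0 : ℝ)
    (l := fun p : (Fin d → ℝ) × (Fin s → ℝ) => chi n p.1)
    (f := fun t : ℝ => (((0 : Fin d → ℝ), y') + t • (coordDir (Sum.inl i)) :
      (Fin d → ℝ) × (Fin s → ℝ))) (by rw [zero_smul, add_zero]; exact hasFDerivAt_chi n (0, y')) h3
  have h6 := h5.smul_const (baseCoeff f n (torusProj y'))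
  have h7 : (translateCoeff n f) ∘ (fun t : ℝ => (((0 : Fin d → ℝ), y') +
      t • (coordDir (Sum.inl i)) : (Fin d → ℝ) × (Fin s → ℝ))) = fun t =>
      ((fun p : (Fin d → ℝ) × (Fin s → ℝ) => chi n p.1) ∘ (fun t : ℝ => (((0 : Fin d → ℝ), y') +
      t • (coordDir (Sum.inl i)) : (Fin d → ℝ) × (Fin s → ℝ)))) t •
      baseCoeff f n (torusProj y') := by
    funext t
    simp [translateCoeff_eq, coordDir]
  rw [h7] at h4
  have h8 := h4.unique h6
  have hz : chi n (0 : Fin d → ℝ) = 1 := by simp [chi_eq_exp]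
  simpa [coordFun_coordDir, translateCoeff_eq, hz, ite_smul, Fintype.sum_sum_type] using h8

end Fourier

/-! ### Fourier modes, decay of coefficients and inversion -/

section Modes

variable {d s m : ℕ}

/-- The function `(h, y) ↦ e(n · h) f̂_μ(y)`. -/
noncomputable def mode (n μ : Fin d → ℤ) (f : Torus d × Torus s → Fin m → ℂ)
    (p : (Fin d → ℝ) × (Fin s → ℝ)) : Fin m → ℂ :=
  chi n p.1 • baseCoeff f μ (torusProj p.2)

/-- The coordinate derivatives of `mode n μ f`. -/
noncomputable def modeDeriv (n μ : Fin d → ℤ) (f : Torus d × Torus s → Fin m → ℂ)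
    (v : Fin d ⊕ Fin s) (p : (Fin d → ℝ) × (Fin s → ℝ)) : Fin m → ℂ :=
  Sum.elim (fun i => (2 * Real.pi * Complex.I * n i) • mode n μ f p)
    (fun j => mode n μ (torusDeriv (Sum.inr j) f) p) v

theorem chi_zero (n : Fin d → ℤ) : chi n (0 : Fin d → ℝ) = 1 := by simp [chi_eq_exp]

/-- The frequencies `n` and `μ` are independent because the solution at frequency `n` uses
coefficients of the right-hand side at other points `μ` of the orbit. The fibre factor is
`translateCoeff` at base point zero, so the product rule applies. -/
theorem hasFDerivAt_mode {f : Torus d × Torus s → Fin m → ℂ} (hf : ProdSmooth f)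
    (n μ : Fin d → ℤ) (p : (Fin d → ℝ) × (Fin s → ℝ)) :
    HasFDerivAt (mode n μ f) (∑ v, (coordFun v).smulRight (modeDeriv n μ f v p)) p := by
  let ι : (Fin d → ℝ) × (Fin s → ℝ) →L[ℝ] (Fin d → ℝ) × (Fin s → ℝ) :=
    (0 : (Fin d → ℝ) × (Fin s → ℝ) →L[ℝ] (Fin d → ℝ)).prod (ContinuousLinearMap.snd ℝ _ _)
  have hι : ∀ p, ι p = (0, p.2) := fun p => rfl
  have h0 : ∀ (g : Torus d × Torus s → Fin m → ℂ) (p : (Fin d → ℝ) × (Fin s → ℝ)),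
      translateCoeff μ g (ι p) = baseCoeff g μ (torusProj p.2) := by
    intro g p
    rw [hι, translateCoeff_eq, chi_zero, one_smul]
  have h1 := (hasFDerivAt_translateCoeff hf μ (ι p)).comp p ι.hasFDerivAt
  have h2 : translateCoeff μ f ∘ ι = fun p => baseCoeff f μ (torusProj p.2) :=
    funext fun p => h0 f p
  rw [h2] at h1
  have h3 := (hasFDerivAt_chi n p).smul h1
  refine h3.congr_fderiv ?_
  refine ContinuousLinearMap.ext fun q => ?_
  simp only [add_apply, smul_apply, ContinuousLinearMap.smulRight_apply,
    ContinuousLinearMap.comp_apply, sum_apply, Fintype.sum_sum_type, h0, modeDeriv, Sum.elim_inl,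
    Sum.elim_inr, mode]
  have h4 : ∀ i : Fin d, coordFun (Sum.inl i) (ι q) = 0 := fun i => rfl
  have h5 : ∀ j : Fin s, coordFun (Sum.inr j) (ι q) = coordFun (Sum.inr j) q := fun j => rfl
  simp only [h4, h5, zero_smul, Finset.sum_const_zero, zero_add, Finset.sum_smul]
  rw [add_comm]
  congr 1
  · refine Finset.sum_congr rfl fun i _ => ?_
    rw [smul_assoc, smul_smul]
  · rw [Finset.smul_sum]
    exact Finset.sum_congr rfl fun j _ => smul_comm _ _ _

theorem fderiv_mode_coordDir {f : Torus d × Torus s → Fin m → ℂ} (hf : ProdSmooth f)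
    (n μ : Fin d → ℤ) (v : Fin d ⊕ Fin s) (p : (Fin d → ℝ) × (Fin s → ℝ)) :
    fderiv ℝ (mode n μ f) p (coordDir v) = modeDeriv n μ f v p := by
  rw [(hasFDerivAt_mode hf n μ p).fderiv]
  simp [sum_apply, coordFun_coordDir, ite_smul, -Fintype.sum_sum_type]

/-- Derivatives of modes are combinations of modes, of `f` itself or of its fibre derivatives; hence
the induction is over all `f`. -/
theorem contDiff_mode_nat (k : ℕ) {f : Torus d × Torus s → Fin m → ℂ} (hf : ProdSmooth f)
    (n μ : Fin d → ℤ) : ContDiff ℝ k (mode n μ f) := by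
  induction k generalizing f with
  | zero =>
    rw [Nat.cast_zero, contDiff_zero]
    exact continuous_iff_continuousAt.2 fun p => (hasFDerivAt_mode hf n μ p).continuousAt
  | succ k ih =>
    rw [Nat.cast_add, Nat.cast_one, contDiff_succ_iff_hasFDerivAt]
    refine ⟨_, ?_, fun p => hasFDerivAt_mode hf n μ p⟩
    refine ContDiff.sum fun v _ => ?_
    have h1 : ContDiff ℝ k (modeDeriv n μ f v) := by
      rcases v with i | j
      · exact (ih hf).const_smul _
      · exact ih (hf.partialDeriv _)
    exact contDiff_const.smulRight h1

theorem contDiff_mode {f : Torus d × Torus s → Fin m → ℂ} (hf : ProdSmooth f)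
    (n μ : Fin d → ℤ) : ContDiff ℝ ∞ (mode n μ f) :=
  contDiff_infty.2 fun k => contDiff_mode_nat k hf n μ

/-- The factor produced by the base derivatives among `L` acting on `e(n · h)`. -/
noncomputable def freqFactor (n : Fin d → ℤ) : List (Fin d ⊕ Fin s) → ℂ
  | [] => 1
  | Sum.inl i :: L => (2 * Real.pi * Complex.I * n i) * freqFactor n L
  | Sum.inr _ :: L => freqFactor n L

/-- The fiber derivatives among `L`. -/
def fiberPart : List (Fin d ⊕ Fin s) → List (Fin d ⊕ Fin s)
  | [] => []
  | Sum.inl _ :: L => fiberPart L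
  | Sum.inr j :: L => Sum.inr j :: fiberPart L

theorem length_fiberPart_le (L : List (Fin d ⊕ Fin s)) : (fiberPart L).length ≤ L.length := by
  induction L with
  | nil => simp [fiberPart]
  | cons v L ih => rcases v with i | j <;> simp [fiberPart] <;> omega

theorem norm_freqFactor_le (n : Fin d → ℤ) (L : List (Fin d ⊕ Fin s)) :
    ‖freqFactor n L‖ ≤ (2 * Real.pi) ^ L.length *
      (max 1 ‖n‖) ^ (L.length - (fiberPart L).length) := by
  have hpi : 1 ≤ 2 * Real.pi := by linarith [Real.pi_gt_three]
  induction L with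
  | nil => simp [freqFactor, fiberPart]
  | cons v L ih =>
    have hle := length_fiberPart_le L
    rcases v with i | j
    · simp only [freqFactor, fiberPart, List.length_cons, norm_mul]
      have h1 : ‖(n i : ℂ)‖ ≤ max 1 ‖n‖ := by
        refine le_trans ?_ (le_max_right _ _)
        rw [← norm_intCast_vec]
        exact norm_le_pi_norm (fun i => (n i : ℂ)) i
      have h2 : ‖(2 : ℂ)‖ * ‖((Real.pi : ℝ) : ℂ)‖ * ‖Complex.I‖ = 2 * Real.pi := by
        simp [abs_of_pos Real.pi_pos]
      rw [h2, Nat.succ_sub hle, pow_succ, pow_succ]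
      calc 2 * Real.pi * ‖(n i : ℂ)‖ * ‖freqFactor n L‖
          ≤ 2 * Real.pi * max 1 ‖n‖ * ((2 * Real.pi) ^ L.length *
            (max 1 ‖n‖) ^ (L.length - (fiberPart L).length)) := by gcongr
        _ = _ := by ring
    · simp only [freqFactor, fiberPart, List.length_cons, Nat.add_sub_add_right]
      refine ih.trans ?_
      gcongr
      omega

theorem dirDerivs_mode {f : Torus d × Torus s → Fin m → ℂ} (hf : ProdSmooth f)
    (n μ : Fin d → ℤ) (L : List (Fin d ⊕ Fin s)) :
    dirDerivs L (mode n μ f) = fun p => freqFactor n L • mode n μ (torusDerivs (fiberPart L) f) p := by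
  induction L with
  | nil => funext p; simp [dirDerivs, freqFactor, fiberPart]
  | cons v L ih =>
    funext p
    simp only [dirDerivs]
    rw [ih]
    have hg := hf.iterDeriv (fiberPart L)
    have h1 := (hasFDerivAt_mode hg n μ p).differentiableAt
    have h2 : fderiv ℝ (fun p => freqFactor n L • mode n μ (torusDerivs (fiberPart L) f) p) p =
        freqFactor n L • fderiv ℝ (mode n μ (torusDerivs (fiberPart L) f)) p :=
      fderiv_fun_const_smul h1 _
    rw [h2, smul_apply, fderiv_mode_coordDir hg]
    rcases v with i | j
    · simp only [modeDeriv, Sum.elim_inl, freqFactor, fiberPart]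
      rw [smul_smul, mul_comm]
    · simp [modeDeriv, freqFactor, fiberPart]

theorem baseCoeff_torusDerivs_replicate {f : Torus d × Torus s → Fin m → ℂ} (hf : ProdSmooth f)
    (n : Fin d → ℤ) (i : Fin d) (N : ℕ) (y : Torus s) :
    baseCoeff (torusDerivs (List.replicate N (Sum.inl i)) f) n y =
      (2 * Real.pi * Complex.I * n i) ^ N • baseCoeff f n y := by
  induction N with
  | zero => simp
  | succ N ih =>
    rw [List.replicate_succ, torusDerivs_cons, baseCoeff_torusDeriv_inl (hf.iterDeriv _), ih,
      smul_smul, pow_succ']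

/-- All `N` derivatives are taken in a coordinate where `‖n i‖ = ‖n‖`; each produces a factor `2π
‖n‖ ≥ ‖n‖`. -/
theorem norm_baseCoeff_le_inv_pow {f : Torus d × Torus s → Fin m → ℂ} (hf : ProdSmooth f) {N : ℕ}
    {C : ℝ} (hC : ∀ L : List (Fin d ⊕ Fin s), L.length ≤ N → ∀ q, ‖torusDerivs L f q‖ ≤ C)
    (n : Fin d → ℤ) (y : Torus s) : ‖baseCoeff f n y‖ ≤ C * ((max 1 ‖n‖) ^ N)⁻¹ := by
  by_cases hn : n = 0
  · subst hn
    simpa using norm_baseCoeff_le (hC [] (Nat.zero_le _)) 0 y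
  have hn1 := one_le_norm_of_ne_zero hn
  rw [max_eq_right hn1]
  obtain ⟨i, hi⟩ : ∃ i, ‖n‖ = ‖n i‖ := by
    have : Nonempty (Fin d) := by
      obtain ⟨i, -⟩ := Function.ne_iff.1 hn
      exact ⟨i⟩
    obtain ⟨i, hi⟩ := Finite.exists_max (fun i => ‖n i‖)
    exact ⟨i, le_antisymm ((pi_norm_le_iff_of_nonneg (norm_nonneg _)).2 hi) (norm_le_pi_norm n i)⟩
  have h1 := norm_baseCoeff_le (hC (List.replicate N (Sum.inl i)) (by simp)) n y
  rw [baseCoeff_torusDerivs_replicate hf, norm_smul, norm_pow] at h1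
  have h2 : ‖n‖ ≤ ‖2 * Real.pi * Complex.I * (n i : ℂ)‖ := by
    have h3 : ‖2 * Real.pi * Complex.I * (n i : ℂ)‖ = 2 * Real.pi * ‖n i‖ := by
      simp [abs_of_pos Real.pi_pos, Int.norm_eq_abs]
    rw [h3, hi]
    nlinarith [Real.pi_gt_three, norm_nonneg (n i)]
  rw [← div_eq_mul_inv, le_div_iff₀ (by positivity), mul_comm]
  refine le_trans ?_ h1
  gcongr

theorem ProdSmooth.exists_torusDerivs_le {f : Torus d × Torus s → Fin m → ℂ} (hf : ProdSmooth f)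
    (N : ℕ) : ∃ C : ℝ, 0 ≤ C ∧
      ∀ L : List (Fin d ⊕ Fin s), L.length ≤ N → ∀ q, ‖torusDerivs L f q‖ ≤ C := by
  choose C hC hCb using fun L : List (Fin d ⊕ Fin s) => (hf.iterDeriv L).exists_norm_le
  have hfin : {L : List (Fin d ⊕ Fin s) | L.length ≤ N}.Finite := List.finite_length_le _ N
  refine ⟨∑ L ∈ hfin.toFinset, C L, Finset.sum_nonneg fun L _ => hC L, fun L hL q => ?_⟩
  exact (hCb L q).trans (Finset.single_le_sum (fun L _ => hC L) (hfin.mem_toFinset.2 hL))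

theorem ProdSmooth.rapidDecay {f : Torus d × Torus s → Fin m → ℂ} (hf : ProdSmooth f)
    (y : Torus s) : RapidDecay (fun n => baseCoeff f n y) := by
  intro N
  obtain ⟨C, hC, h⟩ := hf.exists_torusDerivs_le N
  refine ⟨C, hC, fun n hn => ?_⟩
  have := norm_baseCoeff_le_inv_pow hf h n y
  rwa [max_eq_right (one_le_norm_of_ne_zero hn)] at this

theorem ProdSmooth.summable_norm_baseCoeff {f : Torus d × Torus s → Fin m → ℂ} (hf : ProdSmooth f)
    (y : Torus s) : Summable fun n => ‖baseCoeff f n y‖ := by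
  obtain ⟨C, hC, h⟩ := hf.exists_torusDerivs_le (d + 1)
  exact Summable.of_nonneg_of_le (fun _ => norm_nonneg _)
    (fun n => norm_baseCoeff_le_inv_pow hf h n y) ((summable_max_one_norm_inv_pow d).mul_left C)

theorem integrable_base {f : Torus d × Torus s → Fin m → ℂ} (hf : Continuous f) (n : Fin d → ℤ)
    (y : Torus s) : Integrable fun x => UnitAddTorus.mFourier n x • f (x, y) := by
  have h1 := (UnitAddTorus.mFourier n).continuous
  have h2 : Continuous fun x => UnitAddTorus.mFourier n x • f (x, y) := by fun_prop
  exact h2.integrable_of_hasCompactSupport (HasCompactSupport.of_compactSpace _)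

/-- Fourier inversion in the base variable. -/
theorem ProdSmooth.hasSum_baseCoeff {f : Torus d × Torus s → Fin m → ℂ} (hf : ProdSmooth f)
    (x : Torus d) (y : Torus s) :
    HasSum (fun n => UnitAddTorus.mFourier n x • baseCoeff f n y) (f (x, y)) := by
  rw [Pi.hasSum]
  intro k
  let g : C(UnitAddTorus (Fin d), ℂ) :=
    ⟨fun x => f (x, y) k, by
      have := hf.continuous
      fun_prop⟩
  have h1 : ∀ n, UnitAddTorus.mFourierCoeff g n = baseCoeff f n y k := by
    intro n
    rw [mFourierCoeff_eq_integral_volume, baseCoeff]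
    have h2 := ContinuousLinearMap.integral_comp_comm
      (ContinuousLinearMap.proj (R := ℂ) (φ := fun _ : Fin m => ℂ) k)
      (integrable_base hf.continuous (-n) y)
    exact h2
  have h3 : Summable (UnitAddTorus.mFourierCoeff g) := by
    refine Summable.of_norm_bounded (hf.summable_norm_baseCoeff y) fun n => ?_
    rw [h1]
    exact norm_le_pi_norm _ k
  have h4 := UnitAddTorus.hasSum_mFourier_series_apply_of_summable h3 x
  simp only [h1] at h4
  have h5 : g x = f (x, y) k := rfl
  rw [h5] at h4
  simpa [mul_comm] using h4

theorem ProdSmooth.eq_zero_of_baseCoeff_eq_zero {f : Torus d × Torus s → Fin m → ℂ}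
    (hf : ProdSmooth f) (h : ∀ n y, baseCoeff f n y = 0) : f = 0 := by
  funext q
  have := hf.hasSum_baseCoeff q.1 q.2
  simp only [h, smul_zero] at this
  exact this.unique hasSum_zero

end Modes

/-! ### The solution operator and its tame weights -/

section SolutionOperator

variable {d : ℕ} {W : Type*} [NormedAddCommGroup W] [NormedSpace ℂ W]

theorem exists_norm_le_norm_dualAct (A : Matrix.GeneralLinearGroup (Fin d) ℤ) :
    ∃ K : ℝ, 1 ≤ K ∧ ∀ n : Fin d → ℤ, ‖n‖ ≤ K * ‖dualAct A n‖ := by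
  let N : Matrix (Fin d) (Fin d) ℤ := (A⁻¹ : Matrix.GeneralLinearGroup (Fin d) ℤ).val
  refine ⟨1 + ∑ i, ∑ j, ‖N j i‖, by
    have : 0 ≤ ∑ i, ∑ j, ‖N j i‖ := by positivity
    linarith, fun n => ?_⟩
  have h1 : ∀ m : Fin d → ℤ, ‖dualAct A⁻¹ m‖ ≤ (∑ i, ∑ j, ‖N j i‖) * ‖m‖ := by
    intro m
    refine (pi_norm_le_iff_of_nonneg (by positivity)).2 fun i => ?_
    have h2 : dualAct A⁻¹ m i = ∑ j, m j * N j i := rfl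
    rw [h2]
    refine (norm_sum_le _ _).trans ?_
    have h3 : ∑ j, ‖m j * N j i‖ ≤ (∑ j, ‖N j i‖) * ‖m‖ := by
      rw [Finset.sum_mul]
      refine Finset.sum_le_sum fun j _ => ?_
      rw [norm_mul, mul_comm]
      exact mul_le_mul_of_nonneg_left (norm_le_pi_norm m j) (norm_nonneg _)
    refine h3.trans (mul_le_mul_of_nonneg_right ?_ (norm_nonneg _))
    exact Finset.single_le_sum (f := fun i => ∑ j, ‖N j i‖) (fun i _ => by positivity)
      (Finset.mem_univ i)
  have h4 := h1 (dualAct A n)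
  rw [dualAct_inv_dualAct] at h4
  have := norm_nonneg (dualAct A n)
  linarith

/-- The Fourier coefficients of the solution of the cohomological equation over `A`; the zeroth one
is given by `L₀`. -/
noncomputable def solCoeff (T : (W →L[ℂ] W)ˣ) (A : Matrix.GeneralLinearGroup (Fin d) ℤ)
    (L₀ : W →L[ℂ] W) (r : (Fin d → ℤ) → W) (n : Fin d → ℤ) : W :=
  if n = 0 then L₀ (r 0) else orbitSum T A r (dualAct A n)

/-- The operators `L n l` and frequencies `μ n l` in a series lose at most `q` powers of the
frequency in every decay estimate of order at most `N₀`. -/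
def TameWeights (L : (Fin d → ℤ) → ℕ → W →L[ℂ] W) (μ : (Fin d → ℤ) → ℕ → Fin d → ℤ) (θ C : ℝ)
    (q N₀ : ℕ) : Prop :=
  ∀ n l N, q ≤ N → N ≤ N₀ → ‖L n l‖ * ((max 1 ‖μ n l‖) ^ N)⁻¹ ≤
    C * (θ ^ l * ((max 1 ‖n‖) ^ (N - q))⁻¹)

theorem norm_mul_inv_pow_le_of_dualAct {A : Matrix.GeneralLinearGroup (Fin d) ℤ} {K : ℝ}
    (hK : 1 ≤ K) (hA : ∀ n : Fin d → ℤ, ‖n‖ ≤ K * ‖dualAct A n‖) {n : Fin d → ℤ} (hn : n ≠ 0)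
    {k N₀ : ℕ} (hk : k ≤ N₀) :
    (‖dualAct A n‖ ^ k)⁻¹ ≤ K ^ N₀ * ((max 1 ‖n‖) ^ k)⁻¹ := by
  rw [max_eq_right (one_le_norm_of_ne_zero hn)]
  have h1 := one_le_norm_of_ne_zero hn
  have h2 := norm_dualAct_pos A hn
  rw [← div_eq_mul_inv, le_div_iff₀ (by positivity), inv_mul_le_iff₀ (by positivity)]
  calc ‖n‖ ^ k ≤ (K * ‖dualAct A n‖) ^ k := pow_le_pow_left₀ (norm_nonneg _) (hA n) k
    _ = ‖dualAct A n‖ ^ k * K ^ k := by rw [mul_pow, mul_comm]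
    _ ≤ _ := mul_le_mul_of_nonneg_left (pow_le_pow_right₀ hK hk) (by positivity)

variable [CompleteSpace W]

/-- The solution of the cohomological equation as a series of operators with tame weights, for each
finite order of decay. -/
theorem exists_tameWeights {A B : Matrix.GeneralLinearGroup (Fin d) ℤ} {T T' : (W →L[ℂ] W)ˣ}
    {Λ D θ C₀ : ℝ} {q N₀ : ℕ} (hAB : Commute A B) (hfree : DualFree A B) (hTT' : Commute T T')
    (hΛ : 0 < Λ) (hT : PowBound T Λ D) (hT' : PowBound T' Λ D) (hθ : 0 < θ) (hθ1 : θ < 1)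
    (hC₀ : 0 ≤ C₀)
    (hdich : ∀ n : Fin d → ℤ, n ≠ 0 →
      (∀ N l : ℕ, q ≤ N → N ≤ N₀ → Λ ^ l * (‖dualAct (A ^ l) n‖ ^ N)⁻¹ ≤
        C₀ * (θ ^ l * (‖n‖ ^ (N - q))⁻¹)) ∨
      (∀ N l : ℕ, q ≤ N → N ≤ N₀ → Λ ^ l * (‖dualAct (A⁻¹ ^ l) n‖ ^ N)⁻¹ ≤
        C₀ * (θ ^ l * (‖n‖ ^ (N - q))⁻¹))) (L₀ : W →L[ℂ] W) :
    ∃ (C : ℝ) (L : (Fin d → ℤ) → ℕ → W →L[ℂ] W) (μ : (Fin d → ℤ) → ℕ → Fin d → ℤ),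
      0 ≤ C ∧ TameWeights L μ θ C q N₀ ∧ ∀ r s : (Fin d → ℤ) → W, RapidDecay r → RapidDecay s →
        (∀ m, m ≠ 0 → r m - (T' : W →L[ℂ] W) (r (dualAct B m)) =
          s m - (T : W →L[ℂ] W) (s (dualAct A m))) →
        ∀ n, HasSum (fun l => L n l (r (μ n l))) (solCoeff T A L₀ r n) := by
  obtain ⟨K, hK, hKA⟩ := exists_norm_le_norm_dualAct A
  have hD := hT.nonneg
  let C : ℝ := ‖L₀‖ + D * C₀ * K ^ N₀
  have hC : 0 ≤ C := by positivity
  have key : ∀ n : Fin d → ℤ, ∃ (L : ℕ → W →L[ℂ] W) (μ : ℕ → Fin d → ℤ),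
      (∀ l N, q ≤ N → N ≤ N₀ → ‖L l‖ * ((max 1 ‖μ l‖) ^ N)⁻¹ ≤
        C * (θ ^ l * ((max 1 ‖n‖) ^ (N - q))⁻¹)) ∧
      ∀ r s : (Fin d → ℤ) → W, RapidDecay r → RapidDecay s →
        (∀ m, m ≠ 0 → r m - (T' : W →L[ℂ] W) (r (dualAct B m)) =
          s m - (T : W →L[ℂ] W) (s (dualAct A m))) →
        HasSum (fun l => L l (r (μ l))) (solCoeff T A L₀ r n) := by
    intro n
    by_cases hn : n = 0
    · subst hn
      -- At frequency zero the series is the single term `L₀ (r 0)`, padded with zeros.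
      refine ⟨fun l => if l = 0 then L₀ else 0, fun _ => 0, fun l N _ _ => ?_,
        fun r s _ _ _ => ?_⟩
      · by_cases hl : l = 0
        · subst hl
          simp only [if_true, norm_zero, zero_le_one, max_eq_left, one_pow, inv_one, mul_one,
            pow_zero]
          have : 0 ≤ D * C₀ * K ^ N₀ := by positivity
          simp only [C]
          linarith
        · simp only [hl, if_false, norm_zero, zero_mul]
          positivity
      · have h1 := hasSum_ite_eq (0 : ℕ) (L₀ (r 0))
        have h2 : (fun l : ℕ => (if l = 0 then L₀ else 0) (r 0)) =
            fun l => if l = 0 then L₀ (r 0) else 0 := by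
          funext l
          split_ifs <;> rfl
        simp only [solCoeff, if_true]
        rw [h2]
        exact h1
    · have hm := dualAct_ne_zero A hn
      have hle : ∀ N, N ≤ N₀ → D * C₀ * (‖dualAct A n‖ ^ (N - q))⁻¹ ≤
          C * ((max 1 ‖n‖) ^ (N - q))⁻¹ := by
        intro N hN
        have h1 := norm_mul_inv_pow_le_of_dualAct hK hKA hn (k := N - q) (N₀ := N₀) (by omega)
        calc _ ≤ D * C₀ * (K ^ N₀ * ((max 1 ‖n‖) ^ (N - q))⁻¹) :=
              mul_le_mul_of_nonneg_left h1 (by positivity)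
          _ = (0 + D * C₀ * K ^ N₀) * ((max 1 ‖n‖) ^ (N - q))⁻¹ := by ring
          _ ≤ _ := mul_le_mul_of_nonneg_right
            (add_le_add_left (norm_nonneg _) _) (by positivity)
      -- Both half-orbit sums have the value `solCoeff`; the one with the good estimate supplies the
      -- weights.
      rcases hdich _ hm with h | h
      · refine ⟨fun l => ((T ^ (l : ℤ) : (W →L[ℂ] W)ˣ) : W →L[ℂ] W),
          fun l => dualAct (A ^ (l : ℤ)) (dualAct A n), fun l N hqN hN => ?_,
          fun r s hr hs hrs => ?_⟩
        · rw [max_eq_right (one_le_norm_of_ne_zero (dualAct_ne_zero _ hm))]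
          have h1 := hT l
          have h2 := h N l hqN hN
          rw [Int.natAbs_natCast] at h1
          rw [zpow_natCast A]
          calc _ ≤ D * Λ ^ l * (‖dualAct (A ^ l) (dualAct A n)‖ ^ N)⁻¹ :=
                mul_le_mul_of_nonneg_right h1 (by positivity)
            _ = D * (Λ ^ l * (‖dualAct (A ^ l) (dualAct A n)‖ ^ N)⁻¹) := by ring
            _ ≤ D * (C₀ * (θ ^ l * (‖dualAct A n‖ ^ (N - q))⁻¹)) :=
                mul_le_mul_of_nonneg_left h2 hD
            _ = θ ^ l * (D * C₀ * (‖dualAct A n‖ ^ (N - q))⁻¹) := by ring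
            _ ≤ θ ^ l * (C * ((max 1 ‖n‖) ^ (N - q))⁻¹) :=
                mul_le_mul_of_nonneg_left (hle N hN) (by positivity)
            _ = _ := by ring
        · rw [solCoeff, if_neg hn]
          exact hasSum_orbitSum hAB hfree hΛ hT hr hm
      · refine ⟨fun l => -((T ^ (-((l : ℤ) + 1)) : (W →L[ℂ] W)ˣ) : W →L[ℂ] W),
          fun l => dualAct (A ^ (-((l : ℤ) + 1))) (dualAct A n), fun l N hqN hN => ?_,
          fun r s hr hs hrs => ?_⟩
        · rw [max_eq_right (one_le_norm_of_ne_zero (dualAct_ne_zero _ hm)), norm_neg]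
          have h1 := hT (-((l : ℤ) + 1))
          -- The backward half begins at `-1`, so term `l` lies `l + 1` steps away; the extra factor
          -- `θ` is dropped.
          have h2 := h N (l + 1) hqN hN
          have h3 : (-((l : ℤ) + 1)).natAbs = l + 1 := by omega
          have h4 : A ^ (-((l : ℤ) + 1)) = A⁻¹ ^ (l + 1) := by
            rw [zpow_neg, ← Nat.cast_succ, zpow_natCast, inv_pow]
          rw [h3] at h1
          rw [h4]
          calc _ ≤ D * Λ ^ (l + 1) * (‖dualAct (A⁻¹ ^ (l + 1)) (dualAct A n)‖ ^ N)⁻¹ :=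
                mul_le_mul_of_nonneg_right h1 (by positivity)
            _ = D * (Λ ^ (l + 1) * (‖dualAct (A⁻¹ ^ (l + 1)) (dualAct A n)‖ ^ N)⁻¹) := by ring
            _ ≤ D * (C₀ * (θ ^ (l + 1) * (‖dualAct A n‖ ^ (N - q))⁻¹)) :=
                mul_le_mul_of_nonneg_left h2 hD
            _ = θ ^ (l + 1) * (D * C₀ * (‖dualAct A n‖ ^ (N - q))⁻¹) := by ring
            _ ≤ θ ^ l * (C * ((max 1 ‖n‖) ^ (N - q))⁻¹) :=
                mul_le_mul (pow_le_pow_of_le_one hθ.le hθ1.le (Nat.le_succ l)) (hle N hN)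
                  (by positivity) (by positivity)
            _ = _ := by ring
        · rw [solCoeff, if_neg hn]
          exact hasSum_orbitSum_neg hAB hfree hTT' hΛ hT hT' hr hs hrs hm
  choose L μ h1 h2 using key
  exact ⟨C, L, μ, hC, fun n l N h h' => h1 n l N h h', fun r s hr hs hrs n => h2 n r s hr hs hrs⟩

theorem solCoeff_sub {A B : Matrix.GeneralLinearGroup (Fin d) ℤ} {T : (W →L[ℂ] W)ˣ} {Λ D : ℝ}
    (hAB : Commute A B) (hfree : DualFree A B) (hΛ : 0 < Λ) (hT : PowBound T Λ D)
    {L₀ : W →L[ℂ] W} {r : (Fin d → ℤ) → W} (hr : RapidDecay r)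
    (h0 : L₀ (r 0) - (T : W →L[ℂ] W) (L₀ (r 0)) = r 0) (n : Fin d → ℤ) :
    solCoeff T A L₀ r n - (T : W →L[ℂ] W) (solCoeff T A L₀ r (dualAct A n)) =
      r (dualAct A n) := by
  by_cases hn : n = 0
  · subst hn
    simpa [solCoeff] using h0
  · have hm := dualAct_ne_zero A hn
    rw [solCoeff, solCoeff, if_neg hn, if_neg hm]
    exact orbitSum_sub hAB hfree hΛ hT hr hm

theorem solCoeff_sub_of_relation {A B : Matrix.GeneralLinearGroup (Fin d) ℤ}
    {T T' : (W →L[ℂ] W)ˣ} {Λ D : ℝ} (hAB : Commute A B) (hfree : DualFree A B)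
    (hTT' : Commute T T') (hΛ : 0 < Λ) (hT : PowBound T Λ D) {L₀ : W →L[ℂ] W}
    {r s : (Fin d → ℤ) → W} (hr : RapidDecay r) (hs : RapidDecay s)
    (hrs : ∀ m, m ≠ 0 → r m - (T' : W →L[ℂ] W) (r (dualAct B m)) =
      s m - (T : W →L[ℂ] W) (s (dualAct A m)))
    (h0 : L₀ (r 0) - (T' : W →L[ℂ] W) (L₀ (r 0)) = s 0) (n : Fin d → ℤ) :
    solCoeff T A L₀ r n - (T' : W →L[ℂ] W) (solCoeff T A L₀ r (dualAct B n)) =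
      s (dualAct A n) := by
  by_cases hn : n = 0
  · subst hn
    simpa [solCoeff] using h0
  · have hm := dualAct_ne_zero A hn
    rw [solCoeff, solCoeff, if_neg hn, if_neg (dualAct_ne_zero B hn), ← dualAct_mul, hAB.symm.eq,
      dualAct_mul]
    exact orbitSum_sub_of_relation hAB hfree hTT' hΛ hT hr hs hrs hm

end SolutionOperator

/-! ### Smoothness and estimates for the solution series -/

section Series

variable {d s m : ℕ}

theorem norm_mode_le {f : Torus d × Torus s → Fin m → ℂ} {C : ℝ} {μ : Fin d → ℤ}
    (h : ∀ y, ‖baseCoeff f μ y‖ ≤ C) (n : Fin d → ℤ) (p : (Fin d → ℝ) × (Fin s → ℝ)) :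
    ‖mode n μ f p‖ ≤ C := by
  rw [mode, norm_smul, norm_chi, one_mul]
  exact h _

theorem dirDerivs_clm_comp {W W' : Type*} [NormedAddCommGroup W] [NormedSpace ℝ W]
    [NormedAddCommGroup W'] [NormedSpace ℝ W'] (ℓ : W →L[ℝ] W')
    {F : (Fin d → ℝ) × (Fin s → ℝ) → W} (hF : ContDiff ℝ ∞ F) (k : ℕ)
    (v : Fin k → Fin d ⊕ Fin s) (p : (Fin d → ℝ) × (Fin s → ℝ)) :
    iteratedFDeriv ℝ k (fun p => ℓ (F p)) p (fun i => coordDir (v i)) =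
      ℓ (dirDerivs (List.ofFn v) F p) := by
  have h1 : ContDiff ℝ k F := hF.of_le (by exact_mod_cast le_top)
  have h2 := ℓ.iteratedFDeriv_comp_left (x := p) h1.contDiffAt (i := k) le_rfl
  have h3 : (fun p => ℓ (F p)) = ℓ ∘ F := rfl
  rw [h3, h2, ← iteratedFDeriv_coordDir h1]
  rfl

/-- Each derivative of a term of the solution series is bounded by finitely many derivatives of the
right-hand side. -/
theorem norm_iteratedFDeriv_term_le {L : (Fin d → ℤ) → ℕ → (Fin m → ℂ) →L[ℂ] (Fin m → ℂ)}
    {μ : (Fin d → ℤ) → ℕ → Fin d → ℤ} {θ C : ℝ} {q N₀ k : ℕ} (hC : 0 ≤ C) (hθ : 0 ≤ θ)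
    (hL : TameWeights L μ θ C q N₀) (hk : k + q + d + 1 ≤ N₀)
    {f : Torus d × Torus s → Fin m → ℂ} (hf : ProdSmooth f) {M : ℝ}
    (hM : ∀ Ls : List (Fin d ⊕ Fin s), Ls.length ≤ k + q + d + 1 → ∀ z, ‖torusDerivs Ls f z‖ ≤ M)
    (n : Fin d → ℤ) (l : ℕ) (p : (Fin d → ℝ) × (Fin s → ℝ)) :
    ‖iteratedFDeriv ℝ k (fun p => L n l (mode n (μ n l) f p)) p‖ ≤
      (Fintype.card (Fin k → Fin d ⊕ Fin s) * (2 * Real.pi) ^ k * C * M) *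
        (((max 1 ‖n‖) ^ (d + 1))⁻¹ * θ ^ l) := by
  have hM0 : 0 ≤ M := (norm_nonneg _).trans (hM [] (Nat.zero_le _) (prodProj p))
  have h0 : 1 ≤ max 1 ‖n‖ := le_max_left _ _
  have hpi : 0 < Real.pi := Real.pi_pos
  have h1 : ∀ v : Fin k → Fin d ⊕ Fin s,
      ‖iteratedFDeriv ℝ k (fun p => L n l (mode n (μ n l) f p)) p fun i => coordDir (v i)‖ ≤
      (2 * Real.pi) ^ k * C * M * (((max 1 ‖n‖) ^ (d + 1))⁻¹ * θ ^ l) := by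
    intro v
    have h2 := dirDerivs_clm_comp ((L n l).restrictScalars ℝ) (contDiff_mode hf n (μ n l)) k v p
    rw [ContinuousLinearMap.coe_restrictScalars'] at h2
    rw [h2, dirDerivs_mode hf]
    set v' := List.ofFn v with hv'
    have hlen : v'.length = k := List.length_ofFn
    have hj := length_fiberPart_le v'
    have hfac := norm_freqFactor_le n v'
    set j := (fiberPart v').length with hjdef
    rw [hlen] at hj hfac
    -- Of the `k` derivatives, `j` fall on `f` in the fibre and `k - j` produce powers of the
    -- frequency `n`. Decay of order `k - j + q + d + 1` pays for these powers, for the loss `q`,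
    -- and for summability over `n`; together with the `j` fibre derivatives it uses exactly `k + q
    -- + d + 1` derivatives.
    have h3 : ∀ y, ‖baseCoeff (torusDerivs (fiberPart v') f) (μ n l) y‖ ≤
        M * ((max 1 ‖μ n l‖) ^ (k - j + q + d + 1))⁻¹ := fun y =>
      norm_baseCoeff_le_inv_pow (hf.iterDeriv _) (fun Ls hLs z => by
        rw [← torusDerivs_append]
        refine hM _ ?_ z
        rw [List.length_append]
        omega) _ y
    have h4 := norm_mode_le h3 n p
    have h5 := hL n l (k - j + q + d + 1) (by omega) (by omega)
    have h6 : k - j + q + d + 1 - q = k - j + (d + 1) := by omega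
    rw [h6, pow_add (max 1 ‖n‖), mul_inv] at h5
    simp only [map_smul, norm_smul]
    have h7 := (L n l).le_of_opNorm_le le_rfl (mode n (μ n l) (torusDerivs (fiberPart v') f) p)
    have hX : (0 : ℝ) < (max 1 ‖n‖) ^ (k - j) := by positivity
    calc _ ≤ ((2 * Real.pi) ^ k * (max 1 ‖n‖) ^ (k - j)) *
          (‖L n l‖ * (M * ((max 1 ‖μ n l‖) ^ (k - j + q + d + 1))⁻¹)) := by
            refine mul_le_mul hfac (h7.trans ?_) (norm_nonneg _) (by positivity)
            exact mul_le_mul_of_nonneg_left h4 (norm_nonneg _)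
      _ = ((2 * Real.pi) ^ k * M * (max 1 ‖n‖) ^ (k - j)) *
          (‖L n l‖ * ((max 1 ‖μ n l‖) ^ (k - j + q + d + 1))⁻¹) := by ring
      _ ≤ ((2 * Real.pi) ^ k * M * (max 1 ‖n‖) ^ (k - j)) *
          (C * (θ ^ l * (((max 1 ‖n‖) ^ (k - j))⁻¹ * ((max 1 ‖n‖) ^ (d + 1))⁻¹))) :=
            mul_le_mul_of_nonneg_left h5 (by positivity)
      _ = (2 * Real.pi) ^ k * C * M * (((max 1 ‖n‖) ^ (d + 1))⁻¹ * θ ^ l) *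
          ((max 1 ‖n‖) ^ (k - j) * ((max 1 ‖n‖) ^ (k - j))⁻¹) := by ring
      _ = _ := by rw [mul_inv_cancel₀ hX.ne', mul_one]
  refine (norm_multilinear_le _ (by positivity) h1).trans (le_of_eq ?_)
  ring

/-- The function with given Fourier coefficients in the base. -/
noncomputable def baseSeries (c : (Fin d → ℤ) → Torus s → Fin m → ℂ) (z : Torus d × Torus s) :
    Fin m → ℂ :=
  ∑' n, UnitAddTorus.mFourier n z.1 • c n z.2

theorem summable_weights (d : ℕ) {θ : ℝ} (hθ : 0 ≤ θ) (hθ1 : θ < 1) :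
    Summable fun i : (Fin d → ℤ) × ℕ => ((max 1 ‖i.1‖) ^ (d + 1))⁻¹ * θ ^ i.2 :=
  (summable_max_one_norm_inv_pow d).mul_of_nonneg (summable_geometric_of_lt_one hθ hθ1)
    (fun n => by positivity) (fun l => by positivity)

theorem contDiff_tsum_and_iteratedFDeriv {ι V W : Type*} [NormedAddCommGroup V] [NormedSpace ℝ V]
    [NormedAddCommGroup W] [NormedSpace ℝ W] [CompleteSpace W] {g : ι → V → W}
    (hg : ∀ i, ContDiff ℝ ∞ (g i)) {r : ℕ} {v : ℕ → ι → ℝ} (hv : ∀ k ≤ r, Summable (v k))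
    (h : ∀ k ≤ r, ∀ i p, ‖iteratedFDeriv ℝ k (g i) p‖ ≤ v k i) :
    ContDiff ℝ r (fun p => ∑' i, g i p) ∧ ∀ k ≤ r, ∀ p,
      iteratedFDeriv ℝ k (fun p => ∑' i, g i p) p = ∑' i, iteratedFDeriv ℝ k (g i) p := by
  have h1 : ∀ i, ContDiff ℝ ((r : ℕ∞) : WithTop ℕ∞) (g i) := fun i =>
    (hg i).of_le (by exact_mod_cast le_top)
  have h2 : ∀ k : ℕ, (k : ℕ∞) ≤ (r : ℕ∞) → Summable (v k) := fun k hk => hv k (by exact_mod_cast hk)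
  have h3 : ∀ (k : ℕ) (i : ι) (p : V), (k : ℕ∞) ≤ (r : ℕ∞) → ‖iteratedFDeriv ℝ k (g i) p‖ ≤ v k i :=
    fun k i p hk => h k (by exact_mod_cast hk) i p
  exact ⟨contDiff_tsum h1 h2 h3, fun k hk p =>
    iteratedFDeriv_tsum_apply h1 h2 h3 (by exact_mod_cast hk) p⟩

/-- A series with tame weights is smooth to finite order, and its derivatives are bounded by
finitely many derivatives of the right-hand side. -/
theorem exists_baseSeries_bound {L : (Fin d → ℤ) → ℕ → (Fin m → ℂ) →L[ℂ] (Fin m → ℂ)}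
    {μ : (Fin d → ℤ) → ℕ → Fin d → ℤ} {θ C : ℝ} {q r : ℕ} (hC : 0 ≤ C) (hθ : 0 ≤ θ) (hθ1 : θ < 1)
    (hL : TameWeights L μ θ C q (r + q + d + 1)) :
    ∃ K : ℝ, 0 ≤ K ∧ ∀ (f : Torus d × Torus s → Fin m → ℂ)
      (c : (Fin d → ℤ) → Torus s → Fin m → ℂ), ProdSmooth f →
      (∀ n y, HasSum (fun l => L n l (baseCoeff f (μ n l) y)) (c n y)) →
      ContDiff ℝ r (prodLift (baseSeries c)) ∧ (∀ y, Summable fun n => ‖c n y‖) ∧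
      ∀ M, (∀ Ls : List (Fin d ⊕ Fin s), Ls.length ≤ r + q + d + 1 →
        ∀ z, ‖torusDerivs Ls f z‖ ≤ M) →
        ∀ k ≤ r, ∀ p, ‖iteratedFDeriv ℝ k (prodLift (baseSeries c)) p‖ ≤ K * M := by
  have hW := summable_weights d hθ hθ1
  set S := ∑' i : (Fin d → ℤ) × ℕ, ((max 1 ‖i.1‖) ^ (d + 1))⁻¹ * θ ^ i.2 with hS
  have hS0 : 0 ≤ S := tsum_nonneg fun i => by positivity
  let E : ℕ → ℝ := fun k => Fintype.card (Fin k → Fin d ⊕ Fin s) * (2 * Real.pi) ^ k * C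
  have hE : ∀ k, 0 ≤ E k := fun k => by
    have := Real.pi_pos
    positivity
  refine ⟨(∑ k ∈ Finset.range (r + 1), E k) * S,
    mul_nonneg (Finset.sum_nonneg fun k _ => hE k) hS0, fun f c hf hc => ?_⟩
  let g : (Fin d → ℤ) × ℕ → (Fin d → ℝ) × (Fin s → ℝ) → Fin m → ℂ := fun i p =>
    L i.1 i.2 (mode i.1 (μ i.1 i.2) f p)
  have hg : ∀ i, ContDiff ℝ ∞ (g i) := fun i =>
    ((L i.1 i.2).restrictScalars ℝ).contDiff.comp (contDiff_mode hf i.1 (μ i.1 i.2))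
  have hbound : ∀ M, (∀ Ls : List (Fin d ⊕ Fin s), Ls.length ≤ r + q + d + 1 →
      ∀ z, ‖torusDerivs Ls f z‖ ≤ M) → ∀ k ≤ r, ∀ i p, ‖iteratedFDeriv ℝ k (g i) p‖ ≤
      E k * M * (((max 1 ‖i.1‖) ^ (d + 1))⁻¹ * θ ^ i.2) := fun M hM k hk i p =>
    norm_iteratedFDeriv_term_le hC hθ hL (by omega) hf (fun Ls hLs => hM Ls (by omega)) i.1 i.2 p
  obtain ⟨M₀, -, hM₀⟩ := hf.exists_torusDerivs_le (r + q + d + 1)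
  have hsumg : ∀ p, Summable fun i => ‖g i p‖ := fun p =>
    Summable.of_nonneg_of_le (fun _ => norm_nonneg _) (fun i => by
      have := hbound M₀ hM₀ 0 (Nat.zero_le _) i p
      rwa [norm_iteratedFDeriv_zero] at this) (hW.mul_left (E 0 * M₀))
  have hterm : ∀ n (p : (Fin d → ℝ) × (Fin s → ℝ)),
      HasSum (fun l => g (n, l) p) (chi n p.1 • c n (torusProj p.2)) := by
    intro n p
    have := (hc n (torusProj p.2)).const_smul (chi n p.1)
    have h1 : (fun l => g (n, l) p) =
        fun l => chi n p.1 • L n l (baseCoeff f (μ n l) (torusProj p.2)) := by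
      funext l
      exact map_smul (L n l) _ _
    rw [h1]
    exact this
  have heq : prodLift (baseSeries c) = fun p => ∑' i, g i p := by
    funext p
    rw [(hsumg p).of_norm.tsum_prod' fun n => (hterm n p).summable]
    exact tsum_congr fun n => (hterm n p).tsum_eq.symm
  refine ⟨?_, fun y => ?_, fun M hM k hk p => ?_⟩
  · rw [heq]
    exact (contDiff_tsum_and_iteratedFDeriv hg (fun k _ => hW.mul_left (E k * M₀))
      (hbound M₀ hM₀)).1
  · obtain ⟨y', rfl⟩ := torusProj_surjective y
    have h1 := (hsumg (0, y')).prod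
    refine Summable.of_nonneg_of_le (fun _ => norm_nonneg _) (fun n => ?_) h1
    have h2 := hterm n (0, y')
    rw [chi_zero, one_smul] at h2
    rw [← h2.tsum_eq]
    exact norm_tsum_le_tsum_norm ((hsumg (0, y')).prod_factor n)
  · have hM0 : 0 ≤ M := (norm_nonneg _).trans (hM [] (Nat.zero_le _) (prodProj p))
    rw [heq, (contDiff_tsum_and_iteratedFDeriv hg (fun k _ => hW.mul_left (E k * M₀))
      (hbound M₀ hM₀)).2 k hk p]
    refine (tsum_of_norm_bounded (hW.mul_left (E k * M)).hasSum
      fun i => hbound M hM k hk i p).trans ?_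
    rw [tsum_mul_left, ← hS]
    have h2 : E k ≤ ∑ k ∈ Finset.range (r + 1), E k :=
      Finset.single_le_sum (fun k _ => hE k) (Finset.mem_range.2 (by omega))
    calc E k * M * S = E k * (S * M) := by ring
      _ ≤ (∑ k ∈ Finset.range (r + 1), E k) * (S * M) :=
        mul_le_mul_of_nonneg_right h2 (by positivity)
      _ = _ := by ring

end Series

/-! ### Toral automorphisms acting on Fourier series -/

section Automorphism

variable {d s m : ℕ}

theorem torusAut_torusProj (M : Matrix.GeneralLinearGroup (Fin d) ℤ) (h : Fin d → ℝ) :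
    torusAut M (torusProj h) = torusProj (linAct M h) := by
  funext i
  simp only [torusAut, torusProj, linAct, Matrix.mulVec, dotProduct, Matrix.map_apply]
  have h1 := map_sum (QuotientAddGroup.mk' (AddSubgroup.zmultiples (1 : ℝ)))
    (fun j => (M.val i j : ℝ) * h j) Finset.univ
  refine Eq.trans ?_ h1.symm
  refine Finset.sum_congr rfl fun j _ => ?_
  rw [← zsmul_eq_mul]
  rfl

theorem mFourier_torusAut (M : Matrix.GeneralLinearGroup (Fin d) ℤ) (n : Fin d → ℤ)
    (x : Torus d) :
    UnitAddTorus.mFourier n (torusAut M x) = UnitAddTorus.mFourier (dualAct M n) x := by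
  obtain ⟨h, rfl⟩ := torusProj_surjective x
  rw [torusAut_torusProj]
  change chi n _ = chi _ h
  rw [chi_eq_exp, chi_eq_exp]
  congr 1
  simp only [linAct, dualAct, Matrix.mulVec, Matrix.vecMul, dotProduct, Matrix.map_apply]
  push_cast
  simp only [Finset.mul_sum, Finset.sum_mul]
  rw [Finset.sum_comm]
  refine Finset.sum_congr rfl fun j _ => Finset.sum_congr rfl fun i _ => ?_
  ring

theorem continuous_torusAut (M : Matrix.GeneralLinearGroup (Fin d) ℤ) :
    Continuous (torusAut M) := by
  unfold torusAut
  fun_prop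

theorem dualAct_neg (M : Matrix.GeneralLinearGroup (Fin d) ℤ) (n : Fin d → ℤ) :
    dualAct M (-n) = -dualAct M n := Matrix.neg_vecMul _ _

theorem baseCoeff_comp_torusAut {f : Torus d × Torus s → Fin m → ℂ} (hf : Continuous f)
    {M : Matrix.GeneralLinearGroup (Fin d) ℤ} (hM : MeasurePreserving (torusAut M))
    (n : Fin d → ℤ) (y : Torus s) :
    baseCoeff (fun z => f (torusAut M z.1, z.2)) (dualAct M n) y = baseCoeff f n y := by
  have h1 : Continuous fun x => UnitAddTorus.mFourier (-n) x • f (x, y) := by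
    have := (UnitAddTorus.mFourier (-n)).continuous
    fun_prop
  have h2 := integral_map (μ := (volume : Measure (Torus d))) hM.aemeasurable
    (f := fun x => UnitAddTorus.mFourier (-n) x • f (x, y)) h1.aestronglyMeasurable
  rw [hM.map_eq] at h2
  rw [baseCoeff, baseCoeff, h2]
  simp only [mFourier_torusAut, dualAct_neg]

theorem integral_mFourier {n : Fin d → ℤ} (hn : n ≠ 0) :
    ∫ x : Torus d, UnitAddTorus.mFourier n x = 0 := by
  obtain ⟨i, hi⟩ := Function.ne_iff.1 hn
  have hi' : (n i : ℂ) ≠ 0 := by exact_mod_cast hi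
  -- Translation by half a period of the character changes its sign, so its integral equals its own
  -- negative.
  let h : Fin d → ℝ := Pi.single i (1 / (2 * n i))
  have h1 : chi n h = -1 := by
    rw [chi_eq_exp, Finset.sum_eq_single i]
    · simp only [h, Pi.single_eq_same]
      push_cast
      rw [← Complex.exp_pi_mul_I]
      congr 1
      field_simp
    · intro j _ hj
      simp [h, Pi.single_eq_of_ne hj]
    · simp
  have h2 := integral_add_right_eq_self (μ := (volume : Measure (Torus d)))
    (fun x => UnitAddTorus.mFourier n x) (torusProj h)
  simp only [mFourier_apply_add] at h2
  rw [integral_mul_const] at h2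
  change _ * chi n h = _ at h2
  rw [h1] at h2
  have h3 : (2 : ℂ) * ∫ x : Torus d, UnitAddTorus.mFourier n x = 0 := by
    linear_combination -h2
  simpa using h3

/-- A fixed nonzero frequency would make its character invariant, hence almost everywhere constant;
that constant would have modulus one but integral zero. -/
theorem dualAct_ne_of_ergodic {M : Matrix.GeneralLinearGroup (Fin d) ℤ}
    (hM : Ergodic (torusAut M) (volume : Measure (Torus d))) {n : Fin d → ℤ} (hn : n ≠ 0) :
    dualAct M n ≠ n := by
  intro h
  have h1 : (UnitAddTorus.mFourier n : Torus d → ℂ) ∘ torusAut M = UnitAddTorus.mFourier n := by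
    funext x
    rw [Function.comp_apply, mFourier_torusAut, h]
  obtain ⟨c, hc⟩ := hM.ae_eq_const_of_ae_eq_comp_ae
    (UnitAddTorus.mFourier n).continuous.aestronglyMeasurable
    (Filter.Eventually.of_forall fun x => congrFun h1 x)
  have h2 := integral_congr_ae hc
  rw [integral_mFourier hn] at h2
  simp only [Function.const_apply, integral_const, probReal_univ, one_smul] at h2
  obtain ⟨x, hx⟩ := hc.exists
  have h3 := norm_mFourier_apply n x
  rw [hx, Function.const_apply, ← h2, norm_zero] at h3
  exact zero_ne_one h3

theorem HigherRank.dualFree {A B : Matrix.GeneralLinearGroup (Fin d) ℤ} (h : HigherRank A B) :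
    DualFree A B := fun l k hlk _ hn => dualAct_ne_of_ergodic (h l k hlk) hn

theorem HigherRank.measurePreserving_left {A B : Matrix.GeneralLinearGroup (Fin d) ℤ}
    (h : HigherRank A B) : MeasurePreserving (torusAut A) := by
  simpa using (h 1 0 (by simp)).toMeasurePreserving

theorem HigherRank.measurePreserving_right {A B : Matrix.GeneralLinearGroup (Fin d) ℤ}
    (h : HigherRank A B) : MeasurePreserving (torusAut B) := by
  simpa using (h 0 1 (by simp)).toMeasurePreserving

/-- The average over the base of a series is its zeroth coefficient. -/
theorem integral_baseSeries {c : (Fin d → ℤ) → Torus s → Fin m → ℂ} {y : Torus s}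
    (hc : Summable fun n => ‖c n y‖) : ∫ x, baseSeries c (x, y) = c 0 y := by
  have hcont : ∀ n, Continuous fun x : Torus d => UnitAddTorus.mFourier n x • c n y := fun n =>
    (UnitAddTorus.mFourier n).continuous.smul continuous_const
  have h1 := hasSum_integral_of_summable_integral_norm (μ := (volume : Measure (Torus d)))
    (F := fun n x => UnitAddTorus.mFourier n x • c n y)
    (fun n => (hcont n).integrable_of_hasCompactSupport (HasCompactSupport.of_compactSpace _))
    (by simpa [norm_smul, norm_mFourier_apply] using hc)
  refine h1.unique ?_
  have h2 : (fun n => ∫ x : Torus d, UnitAddTorus.mFourier n x • c n y) =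
      fun n => if n = 0 then c 0 y else 0 := by
    funext n
    rw [integral_smul_const]
    split_ifs with hn
    · subst hn
      simp [UnitAddTorus.mFourier_zero]
    · rw [integral_mFourier hn, zero_smul]
  rw [h2]
  exact hasSum_ite_eq 0 _

theorem summable_mFourier_smul {c : (Fin d → ℤ) → Torus s → Fin m → ℂ} {y : Torus s}
    (hc : Summable fun n => ‖c n y‖) (x : Torus d) :
    Summable fun n => UnitAddTorus.mFourier n x • c n y :=
  Summable.of_norm (by simpa [norm_smul, norm_mFourier_apply] using hc)

/-- A series solves the cohomological equation over `M` if its coefficients do. -/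
theorem baseSeries_torusAut_sub {c : (Fin d → ℤ) → Torus s → Fin m → ℂ}
    (hc : ∀ y, Summable fun n => ‖c n y‖) {f : Torus d × Torus s → Fin m → ℂ} (hf : ProdSmooth f)
    (M : Matrix.GeneralLinearGroup (Fin d) ℤ) (T : (Fin m → ℂ) →L[ℂ] (Fin m → ℂ))
    (h : ∀ n y, c n y - T (c (dualAct M n) y) = baseCoeff f (dualAct M n) y)
    (z : Torus d × Torus s) :
    baseSeries c (torusAut M z.1, z.2) - T (baseSeries c z) = f z := by
  have h1 := (summable_mFourier_smul (hc z.2) (torusAut M z.1)).hasSum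
  have h2 := ((summable_mFourier_smul (hc z.2) z.1).hasSum.mapL T)
  rw [← (dualEquiv M).hasSum_iff] at h2
  have h3 := hf.hasSum_baseCoeff z.1 z.2
  rw [← (dualEquiv M).hasSum_iff] at h3
  have h4 : (fun n => UnitAddTorus.mFourier n (torusAut M z.1) • c n z.2 -
      ((fun n => T (UnitAddTorus.mFourier n z.1 • c n z.2)) ∘ dualEquiv M) n) =
      (fun n => UnitAddTorus.mFourier n z.1 • baseCoeff f n z.2) ∘ dualEquiv M := by
    funext n
    have h5 : dualEquiv M n = dualAct M n := rfl
    simp only [Function.comp_apply, h5, ← h, map_smul, smul_sub, mFourier_torusAut]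
  have h6 := h1.sub h2
  rw [h4] at h6
  exact h6.unique h3

end Automorphism

/-! ### Complex-valued common solutions -/

section ComplexSolution

variable {d s m : ℕ}

theorem baseCoeff_clm_comp (T : (Fin m → ℂ) →L[ℂ] (Fin m → ℂ))
    {f : Torus d × Torus s → Fin m → ℂ} (hf : Continuous f) (n : Fin d → ℤ) (y : Torus s) :
    baseCoeff (fun z => T (f z)) n y = T (baseCoeff f n y) := by
  rw [baseCoeff, baseCoeff, ← T.integral_comp_comm (integrable_base hf (-n) y)]
  simp only [map_smul]

theorem baseCoeff_sub {f g : Torus d × Torus s → Fin m → ℂ} (hf : Continuous f)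
    (hg : Continuous g) (n : Fin d → ℤ) (y : Torus s) :
    baseCoeff (fun z => f z - g z) n y = baseCoeff f n y - baseCoeff g n y := by
  simp only [baseCoeff, smul_sub]
  exact integral_sub (integrable_base hf (-n) y) (integrable_base hg (-n) y)

theorem baseCoeff_zero (f : Torus d × Torus s → Fin m → ℂ) (y : Torus s) :
    baseCoeff f 0 y = ∫ x, f (x, y) := by
  simp [baseCoeff, UnitAddTorus.mFourier_zero]

/-- The Fourier coefficients of `f(Mx, y) - T f(x, y)`. -/
theorem baseCoeff_torusAut_sub {f : Torus d × Torus s → Fin m → ℂ} (hf : Continuous f)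
    {M : Matrix.GeneralLinearGroup (Fin d) ℤ} (hM : MeasurePreserving (torusAut M))
    (T : (Fin m → ℂ) →L[ℂ] (Fin m → ℂ)) (n : Fin d → ℤ) (y : Torus s) :
    baseCoeff (fun z => f (torusAut M z.1, z.2) - T (f z)) (dualAct M n) y =
      baseCoeff f n y - T (baseCoeff f (dualAct M n) y) := by
  have h1 : Continuous fun z : Torus d × Torus s => f (torusAut M z.1, z.2) := by
    have := continuous_torusAut M
    fun_prop
  have h2 : Continuous fun z => T (f z) := T.continuous.comp hf
  rw [baseCoeff_sub h1 h2, baseCoeff_comp_torusAut hf hM,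
    baseCoeff_clm_comp T hf]

theorem RapidDecay.comp_dualAct {W : Type*} [NormedAddCommGroup W] {r : (Fin d → ℤ) → W}
    (hr : RapidDecay r) (M : Matrix.GeneralLinearGroup (Fin d) ℤ) :
    RapidDecay fun n => r (dualAct M n) := by
  obtain ⟨K, hK, h⟩ := exists_norm_le_norm_dualAct M
  intro N
  obtain ⟨C, hC, hr⟩ := hr N
  refine ⟨C * K ^ N, by positivity, fun n hn => ?_⟩
  have h1 := norm_mul_inv_pow_le_of_dualAct hK h hn (le_refl N)
  rw [max_eq_right (one_le_norm_of_ne_zero hn)] at h1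
  calc _ ≤ C * (‖dualAct M n‖ ^ N)⁻¹ := hr _ (dualAct_ne_zero M hn)
    _ ≤ C * (K ^ N * (‖n‖ ^ N)⁻¹) := mul_le_mul_of_nonneg_left h1 hC
    _ = _ := by ring

/-- A smooth solution of the homogeneous equation is determined by its averages over the base. -/
theorem eq_zero_of_torusAut_eq {A B : Matrix.GeneralLinearGroup (Fin d) ℤ} (hAB : Commute A B)
    (hH : HigherRank A B) {T : ((Fin m → ℂ) →L[ℂ] (Fin m → ℂ))ˣ} {Λ D : ℝ} (hΛ : 0 < Λ)
    (hT : PowBound T Λ D) {f : Torus d × Torus s → Fin m → ℂ} (hf : ProdSmooth f)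
    (h : ∀ z : Torus d × Torus s,
      f (torusAut A z.1, z.2) - (T : (Fin m → ℂ) →L[ℂ] (Fin m → ℂ)) (f z) = 0)
    (h0 : ∀ y, baseCoeff f 0 y = 0) : f = 0 := by
  refine hf.eq_zero_of_baseCoeff_eq_zero fun n y => ?_
  by_cases hn : n = 0
  · rw [hn, h0]
  refine eq_zero_of_homogeneous hAB hH.dualFree hΛ hT (hf.rapidDecay y) (fun k _ => ?_) hn
  have h1 := baseCoeff_torusAut_sub hf.continuous hH.measurePreserving_left
    (T : (Fin m → ℂ) →L[ℂ] (Fin m → ℂ)) k y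
  simp only [h] at h1
  rw [← sub_eq_zero, ← h1]
  simp [baseCoeff]

/-- The common solution of two commuting cohomological equations, with tame estimates. -/
theorem exists_smooth_solution (s : ℕ) {A B : Matrix.GeneralLinearGroup (Fin d) ℤ}
    (hAB : Commute A B) (hH : HigherRank A B) {T T' : ((Fin m → ℂ) →L[ℂ] (Fin m → ℂ))ˣ}
    (hTT' : Commute T T') {Λ D θ : ℝ} {q : ℕ} (hΛ : 0 < Λ) (hT : PowBound T Λ D)
    (hT' : PowBound T' Λ D) (hθ : 0 < θ) (hθ1 : θ < 1)
    (hdich : ∀ N₀ : ℕ, ∃ C : ℝ, 0 ≤ C ∧ ∀ n : Fin d → ℤ, n ≠ 0 →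
      (∀ N l : ℕ, q ≤ N → N ≤ N₀ → Λ ^ l * (‖dualAct (A ^ l) n‖ ^ N)⁻¹ ≤
        C * (θ ^ l * (‖n‖ ^ (N - q))⁻¹)) ∨
      (∀ N l : ℕ, q ≤ N → N ≤ N₀ → Λ ^ l * (‖dualAct (A⁻¹ ^ l) n‖ ^ N)⁻¹ ≤
        C * (θ ^ l * (‖n‖ ^ (N - q))⁻¹)))
    (L₀ : (Fin m → ℂ) →L[ℂ] (Fin m → ℂ)) :
    ∃ K : ℕ → ℝ, (∀ r, 0 ≤ K r) ∧ ∀ R S : Torus d × Torus s → Fin m → ℂ,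
      ProdSmooth R → ProdSmooth S →
      (∀ z : Torus d × Torus s,
        R (torusAut B z.1, z.2) - (T' : (Fin m → ℂ) →L[ℂ] (Fin m → ℂ)) (R z) =
        S (torusAut A z.1, z.2) - (T : (Fin m → ℂ) →L[ℂ] (Fin m → ℂ)) (S z)) →
      (∀ y, L₀ (baseCoeff R 0 y) - (T : (Fin m → ℂ) →L[ℂ] (Fin m → ℂ)) (L₀ (baseCoeff R 0 y)) =
        baseCoeff R 0 y) →
      (∀ y, L₀ (baseCoeff R 0 y) - (T' : (Fin m → ℂ) →L[ℂ] (Fin m → ℂ)) (L₀ (baseCoeff R 0 y)) =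
        baseCoeff S 0 y) →
      ∃ Ω : Torus d × Torus s → Fin m → ℂ, ProdSmooth Ω ∧
        (∀ z : Torus d × Torus s, Ω (torusAut A z.1, z.2) -
          (T : (Fin m → ℂ) →L[ℂ] (Fin m → ℂ)) (Ω z) = R z) ∧
        (∀ z : Torus d × Torus s, Ω (torusAut B z.1, z.2) -
          (T' : (Fin m → ℂ) →L[ℂ] (Fin m → ℂ)) (Ω z) = S z) ∧
        (∀ y, ∫ x, Ω (x, y) = L₀ (baseCoeff R 0 y)) ∧
        ∀ r M, (∀ Ls : List (Fin d ⊕ Fin s), Ls.length ≤ r + q + d + 1 →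
          ∀ z, ‖torusDerivs Ls R z‖ ≤ M) →
          ∀ k ≤ r, ∀ p, ‖iteratedFDeriv ℝ k (prodLift Ω) p‖ ≤ K r * M := by
  have hfree := hH.dualFree
  -- The weights, that is the choice of half orbits, depend on `r`, but the coefficients `c` are
  -- always those of `solCoeff`. Hence one function satisfies the estimates of every order.
  have key : ∀ r : ℕ, ∃ K : ℝ, 0 ≤ K ∧ ∀ (f : Torus d × Torus s → Fin m → ℂ)
      (c : (Fin d → ℤ) → Torus s → Fin m → ℂ) (g : (Fin d → ℤ) → Torus s → Fin m → ℂ),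
      ProdSmooth f → (∀ y, RapidDecay fun n => g n y) →
      (∀ y m', m' ≠ 0 → baseCoeff f m' y - (T' : (Fin m → ℂ) →L[ℂ] (Fin m → ℂ))
        (baseCoeff f (dualAct B m') y) =
        g m' y - (T : (Fin m → ℂ) →L[ℂ] (Fin m → ℂ)) (g (dualAct A m') y)) →
      (∀ n y, c n y = solCoeff T A L₀ (fun n => baseCoeff f n y) n) →
      ContDiff ℝ r (prodLift (baseSeries c)) ∧ (∀ y, Summable fun n => ‖c n y‖) ∧
      ∀ M, (∀ Ls : List (Fin d ⊕ Fin s), Ls.length ≤ r + q + d + 1 →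
        ∀ z, ‖torusDerivs Ls f z‖ ≤ M) →
        ∀ k ≤ r, ∀ p, ‖iteratedFDeriv ℝ k (prodLift (baseSeries c)) p‖ ≤ K * M := by
    intro r
    obtain ⟨C₀, hC₀, hd⟩ := hdich (r + q + d + 1)
    obtain ⟨C, L, μ, hC, hL, hsum⟩ :=
      exists_tameWeights hAB hfree hTT' hΛ hT hT' hθ hθ1 hC₀ hd L₀
    obtain ⟨K, hK, h⟩ := exists_baseSeries_bound (s := s) hC hθ.le hθ1 hL
    refine ⟨K, hK, fun f c g hf hg hfg hc => h f c hf fun n y => ?_⟩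
    rw [hc]
    exact hsum _ _ (hf.rapidDecay y) (hg y) (hfg y) n
  choose K hK hKs using key
  refine ⟨K, hK, fun R S hR hS hRS hA0 hB0 => ?_⟩
  let c : (Fin d → ℤ) → Torus s → Fin m → ℂ := fun n y =>
    solCoeff T A L₀ (fun n => baseCoeff R n y) n
  -- At frequency `k B` the relation involves the coefficients of `S` at `k B A⁻¹` and at `k B`.
  -- This shift of index brings it to the form `r k - T' r(k B) = g k - T g(k A)`.
  let g : (Fin d → ℤ) → Torus s → Fin m → ℂ := fun n y =>
    baseCoeff S (dualAct B (dualAct A⁻¹ n)) y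
  have hg : ∀ y, RapidDecay fun n => g n y := fun y =>
    ((hS.rapidDecay y).comp_dualAct B).comp_dualAct A⁻¹
  have hcomm : ∀ n, dualAct B (dualAct A n) = dualAct A (dualAct B n) := fun n => by
    rw [← dualAct_mul, hAB.eq, dualAct_mul]
  have hgA : ∀ n y, g (dualAct A n) y = baseCoeff S (dualAct B n) y := fun n y => by
    simp only [g, dualAct_inv_dualAct]
  have hrel : ∀ y k, k ≠ 0 → baseCoeff R k y - (T' : (Fin m → ℂ) →L[ℂ] (Fin m → ℂ))
      (baseCoeff R (dualAct B k) y) =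
      g k y - (T : (Fin m → ℂ) →L[ℂ] (Fin m → ℂ)) (g (dualAct A k) y) := by
    intro y k _
    rw [← baseCoeff_torusAut_sub hR.continuous hH.measurePreserving_right, hgA]
    have h1 := baseCoeff_torusAut_sub hS.continuous hH.measurePreserving_left
      (T : (Fin m → ℂ) →L[ℂ] (Fin m → ℂ)) (dualAct B (dualAct A⁻¹ k)) y
    rw [← hcomm, dualAct_dualAct_inv] at h1
    simp only [hRS]
    exact h1
  have hc : ∀ r, _ := fun r => hKs r R c g hR hg hrel fun n y => rfl
  have hsum : ∀ y, Summable fun n => ‖c n y‖ := (hc 0).2.1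
  refine ⟨baseSeries c, contDiff_infty.2 fun r => (hc r).1, ?_, ?_, fun y => ?_,
    fun r => (hc r).2.2⟩
  · refine baseSeries_torusAut_sub hsum hR A _ fun n y => ?_
    exact solCoeff_sub hAB hfree hΛ hT (r := fun n => baseCoeff R n y) (hR.rapidDecay y) (hA0 y) n
  · refine baseSeries_torusAut_sub hsum hS B _ fun n y => ?_
    have h1 := solCoeff_sub_of_relation hAB hfree hTT' hΛ hT (L₀ := L₀)
      (r := fun n => baseCoeff R n y) (s := fun n => g n y) (hR.rapidDecay y) (hg y) (hrel y)
      (by simpa [g] using hB0 y) n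
    simp only [hgA] at h1
    exact h1
  · rw [integral_baseSeries (hsum y)]
    simp [c, solCoeff]

end ComplexSolution

/-! ### Passage between real and complex values -/

section Complexification

variable {d s m : ℕ}

/-- The inclusion `ℝᵐ → ℂᵐ`. -/
noncomputable def ofRealVec (m : ℕ) : (Fin m → ℝ) →L[ℝ] (Fin m → ℂ) :=
  ContinuousLinearMap.pi fun i => Complex.ofRealCLM.comp (ContinuousLinearMap.proj i)

/-- The real part `ℂᵐ → ℝᵐ`. -/
noncomputable def reVec (m : ℕ) : (Fin m → ℂ) →L[ℝ] (Fin m → ℝ) :=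
  ContinuousLinearMap.pi fun i => Complex.reCLM.comp (ContinuousLinearMap.proj i)

theorem ofRealVec_apply (v : Fin m → ℝ) (i : Fin m) : ofRealVec m v i = (v i : ℂ) := rfl

theorem reVec_apply (v : Fin m → ℂ) (i : Fin m) : reVec m v i = (v i).re := rfl

theorem reVec_ofRealVec (v : Fin m → ℝ) : reVec m (ofRealVec m v) = v := rfl

theorem ofRealVec_injective : Function.Injective (ofRealVec m) :=
  Function.LeftInverse.injective reVec_ofRealVec

theorem norm_ofRealVec (v : Fin m → ℝ) : ‖ofRealVec m v‖ = ‖v‖ := by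
  simp [Pi.norm_def, ofRealVec_apply]

theorem norm_reVec_le (v : Fin m → ℂ) : ‖reVec m v‖ ≤ ‖v‖ :=
  (pi_norm_le_iff_of_nonneg (norm_nonneg _)).2 fun i =>
    (Complex.abs_re_le_norm (v i)).trans (norm_le_pi_norm v i)

theorem ProdSmooth.clm_comp {W W' : Type*} [NormedAddCommGroup W] [NormedSpace ℝ W]
    [NormedAddCommGroup W'] [NormedSpace ℝ W'] (ℓ : W →L[ℝ] W') {f : Torus d × Torus s → W}
    (hf : ProdSmooth f) : ProdSmooth fun z => ℓ (f z) :=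
  ℓ.contDiff.comp hf

theorem torusDeriv_clm_comp {W W' : Type*} [NormedAddCommGroup W] [NormedSpace ℝ W]
    [NormedAddCommGroup W'] [NormedSpace ℝ W'] (ℓ : W →L[ℝ] W') {f : Torus d × Torus s → W}
    (hf : ProdSmooth f) (v : Fin d ⊕ Fin s) :
    torusDeriv v (fun z => ℓ (f z)) = fun z => ℓ (torusDeriv v f z) := by
  funext z
  have h1 := (hf.differentiable (by simp)).differentiableAt
    (x := Function.surjInv prodProj_surjective z)
  have h2 := ℓ.hasFDerivAt.comp _ h1.hasFDerivAt
  have h3 : prodLift (fun z => ℓ (f z)) = ℓ ∘ prodLift f := rfl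
  rw [torusDeriv, h3, h2.fderiv]
  rfl

theorem torusDerivs_clm_comp {W W' : Type*} [NormedAddCommGroup W] [NormedSpace ℝ W]
    [NormedAddCommGroup W'] [NormedSpace ℝ W'] (ℓ : W →L[ℝ] W') {f : Torus d × Torus s → W}
    (hf : ProdSmooth f) (Ls : List (Fin d ⊕ Fin s)) :
    torusDerivs Ls (fun z => ℓ (f z)) = fun z => ℓ (torusDerivs Ls f z) := by
  induction Ls with
  | nil => rfl
  | cons v Ls ih => rw [torusDerivs_cons, ih, torusDeriv_clm_comp ℓ (hf.iterDeriv Ls)]; rfl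

theorem torusPartial_eq {f : Torus d × Torus s → Fin m → ℝ} (hf : TorusSmooth f) {k : ℕ}
    (v : Fin k → Fin d ⊕ Fin s) (p : (Fin d → ℝ) × (Fin s → ℝ)) :
    torusPartial v f p = torusDerivs (List.ofFn v) f (prodProj p) := by
  have h1 : ContDiff ℝ k (prodLift f) := ContDiff.of_le hf (by exact_mod_cast le_top)
  have h2 := iteratedFDeriv_coordDir h1 v p
  rw [dirDerivs_prodLift] at h2
  exact h2

theorem enorm_torusDerivs_le_crNorm {f : Torus d × Torus s → Fin m → ℝ} (hf : TorusSmooth f)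
    {r : ℕ} {Ls : List (Fin d ⊕ Fin s)} (hLs : Ls.length ≤ r) (z : Torus d × Torus s) :
    ‖torusDerivs Ls f z‖ₑ ≤ crNorm r f := by
  obtain ⟨p, rfl⟩ := prodProj_surjective z
  have h1 := torusPartial_eq hf Ls.get p
  rw [List.ofFn_get] at h1
  rw [← h1]
  exact le_iSup_of_le Ls.length (le_iSup_of_le hLs (le_iSup_of_le Ls.get
    (le_iSup (fun p => ‖torusPartial Ls.get f p‖ₑ) p)))

theorem crNorm_le {f : Torus d × Torus s → Fin m → ℝ} {r : ℕ} {C : ℝ≥0∞}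
    (h : ∀ k ≤ r, ∀ (v : Fin k → Fin d ⊕ Fin s) p, ‖torusPartial v f p‖ₑ ≤ C) : crNorm r f ≤ C :=
  iSup_le fun k => iSup_le fun hk => iSup_le fun v => iSup_le fun p => h k hk v p

theorem crNorm_ne_top {f : Torus d × Torus s → Fin m → ℝ} (hf : TorusSmooth f) (r : ℕ) :
    crNorm r f ≠ ⊤ := by
  have hf' : ProdSmooth f := hf
  choose C hC hCb using fun L : List (Fin d ⊕ Fin s) => (hf'.iterDeriv L).exists_norm_le
  have hfin : {L : List (Fin d ⊕ Fin s) | L.length ≤ r}.Finite := List.finite_length_le _ r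
  have h1 : crNorm r f ≤ ENNReal.ofReal (∑ L ∈ hfin.toFinset, C L) := by
    refine crNorm_le fun k hk v p => ?_
    rw [torusPartial_eq hf, ← ofReal_norm]
    refine ENNReal.ofReal_le_ofReal ((hCb _ _).trans (Finset.single_le_sum
      (fun L _ => hC L) (hfin.mem_toFinset.2 ?_)))
    simpa using hk
  exact ne_top_of_le_ne_top ENNReal.ofReal_ne_top h1

theorem norm_coordDir_le (v : Fin d ⊕ Fin s) :
    ‖(coordDir v : (Fin d → ℝ) × (Fin s → ℝ))‖ ≤ 1 := by
  rcases v with i | j <;> simp [coordDir, Prod.norm_def, Pi.norm_single]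

/-- The `C^r` norm of the real part of a smooth function with values in `ℂᵐ`. -/
theorem crNorm_reVec_le {F : Torus d × Torus s → Fin m → ℂ} (hF : ProdSmooth F) {r : ℕ} {C : ℝ}
    (h : ∀ k ≤ r, ∀ p, ‖iteratedFDeriv ℝ k (prodLift F) p‖ ≤ C) :
    crNorm r (fun z => reVec m (F z)) ≤ ENNReal.ofReal C := by
  refine crNorm_le fun k hk v p => ?_
  rw [← ofReal_norm]
  refine ENNReal.ofReal_le_ofReal ?_
  have h1 : ContDiffAt ℝ k (prodLift F) p :=
    (ContDiff.of_le hF (by exact_mod_cast le_top)).contDiffAt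
  have h2 := (reVec m).iteratedFDeriv_comp_left h1 (i := k) le_rfl
  have h3 : torusPartial v (fun z => reVec m (F z)) p =
      reVec m (iteratedFDeriv ℝ k (prodLift F) p fun i => coordDir (v i)) := by
    change iteratedFDeriv ℝ k (reVec m ∘ prodLift F) p _ = _
    rw [h2]
    rfl
  rw [h3]
  refine (norm_reVec_le _).trans ((ContinuousMultilinearMap.le_opNorm _ _).trans ?_)
  refine (mul_le_of_le_one_right (norm_nonneg _) ?_).trans (h k hk p)
  exact Finset.prod_le_one (fun i _ => norm_nonneg _) fun i _ => norm_coordDir_le (v i)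

theorem integral_ofRealVec {f : Torus d × Torus s → Fin m → ℝ} (hf : Continuous f) (y : Torus s) :
    ∫ x, ofRealVec m (f (x, y)) = ofRealVec m (∫ x, f (x, y)) := by
  have h1 : Continuous fun x => f (x, y) := by fun_prop
  exact (ofRealVec m).integral_comp_comm
    (h1.integrable_of_hasCompactSupport (HasCompactSupport.of_compactSpace _))

theorem integral_reVec {f : Torus d × Torus s → Fin m → ℂ} (hf : Continuous f) (y : Torus s) :
    ∫ x, reVec m (f (x, y)) = reVec m (∫ x, f (x, y)) := by
  have h1 : Continuous fun x => f (x, y) := by fun_prop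
  exact (reVec m).integral_comp_comm
    (h1.integrable_of_hasCompactSupport (HasCompactSupport.of_compactSpace _))

end Complexification

/-! ### Integer matrices as operators on complex vectors -/

section MatrixOperator

variable {d : ℕ}

/-- The operators on `ℂᵈ` given by integer matrices. -/
noncomputable def matOp (d : ℕ) :
    Matrix.GeneralLinearGroup (Fin d) ℤ →* ((Fin d → ℂ) →L[ℂ] (Fin d → ℂ))ˣ :=
  Units.map ((((Matrix.toLinAlgEquiv' (R := ℂ) (n := Fin d)).trans
    (Module.End.toContinuousLinearMap (Fin d → ℂ))).toRingEquiv.toRingHom.comp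
    (RingHom.mapMatrix (m := Fin d) (Int.castRingHom ℂ))).toMonoidHom)

theorem matOp_apply (M : Matrix.GeneralLinearGroup (Fin d) ℤ) (w : Fin d → ℂ) :
    (matOp d M : (Fin d → ℂ) →L[ℂ] (Fin d → ℂ)) w =
      (M.val.map (Int.cast : ℤ → ℂ)).mulVec w := rfl

theorem matOp_ofRealVec (M : Matrix.GeneralLinearGroup (Fin d) ℤ) (v : Fin d → ℝ) :
    (matOp d M : (Fin d → ℂ) →L[ℂ] (Fin d → ℂ)) (ofRealVec d v) = ofRealVec d (linAct M v) := by
  funext i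
  simp [matOp_apply, ofRealVec_apply, linAct, Matrix.mulVec, dotProduct]

theorem reVec_matOp (M : Matrix.GeneralLinearGroup (Fin d) ℤ) (w : Fin d → ℂ) :
    reVec d ((matOp d M : (Fin d → ℂ) →L[ℂ] (Fin d → ℂ)) w) = linAct M (reVec d w) := by
  funext i
  simp [matOp_apply, reVec_apply, linAct, Matrix.mulVec, dotProduct]

theorem matOp_pow_apply (M : Matrix.GeneralLinearGroup (Fin d) ℤ) (l : ℕ) (w : Fin d → ℂ) :
    (matOp d (M ^ l) : (Fin d → ℂ) →L[ℂ] (Fin d → ℂ)) w =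
      ((Matrix.toLin' (M.val.map (Int.cast : ℤ → ℂ))) ^ l) w := by
  induction l generalizing w with
  | zero => simp
  | succ l ih =>
    rw [pow_succ, map_mul, pow_succ, Module.End.mul_apply, ← ih]
    rfl

theorem exists_norm_matOp_pow_le (M : Matrix.GeneralLinearGroup (Fin d) ℤ) {ρ : ℝ} (hρ : 0 ≤ ρ)
    (h : ∀ z ∈ eigenvalueSet M, ‖z‖ ≤ ρ) :
    ∃ D : ℝ, 0 ≤ D ∧ ∀ l : ℕ,
      ‖(matOp d (M ^ l) : (Fin d → ℂ) →L[ℂ] (Fin d → ℂ))‖ ≤ D * (ρ + 1) ^ l := by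
  obtain ⟨C, hC, hb⟩ := Module.End.exists_norm_pow_apply_le
    (Matrix.toLin' (M.val.map (Int.cast : ℤ → ℂ))) ρ hρ (by rwa [Matrix.spectrum_toLin'])
  refine ⟨C, hC, fun l => ContinuousLinearMap.opNorm_le_bound _ (by positivity) fun w => ?_⟩
  rw [matOp_pow_apply]
  exact hb w l

theorem inv_mem_eigenvalueSet {M : Matrix.GeneralLinearGroup (Fin d) ℤ} {z : ℂ}
    (hz : z ∈ eigenvalueSet M⁻¹) : z⁻¹ ∈ eigenvalueSet M := by
  let u : (Matrix (Fin d) (Fin d) ℂ)ˣ :=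
    Units.map (RingHom.mapMatrix (m := Fin d) (Int.castRingHom ℂ)).toMonoidHom M
  have h1 : z ∈ spectrum ℂ (u⁻¹ : (Matrix (Fin d) (Fin d) ℂ)ˣ).val := hz
  rw [← spectrum.map_inv u] at h1
  exact h1

/-- Negative powers are positive powers of the inverse, whose eigenvalues are the inverses; hence
the bound on both `‖z‖` and `‖z⁻¹‖`. -/
theorem exists_powBound_matOp (M : Matrix.GeneralLinearGroup (Fin d) ℤ) {ρ : ℝ} (hρ : 0 ≤ ρ)
    (h : ∀ z ∈ eigenvalueSet M, ‖z‖ ≤ ρ ∧ ‖z⁻¹‖ ≤ ρ) :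
    ∃ D : ℝ, PowBound (matOp d M) (ρ + 1) D := by
  obtain ⟨D, hD, h1⟩ := exists_norm_matOp_pow_le M hρ fun z hz => (h z hz).1
  obtain ⟨D', hD', h2⟩ := exists_norm_matOp_pow_le M⁻¹ hρ fun z hz => by
    have := (h _ (inv_mem_eigenvalueSet hz)).2
    rwa [inv_inv] at this
  refine ⟨D + D', fun z => ?_⟩
  rw [← map_zpow]
  have h3 : 0 ≤ (ρ + 1) ^ z.natAbs := by positivity
  rcases Int.natAbs_eq z with hz | hz
  · rw [hz, zpow_natCast, Int.natAbs_natCast]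
    exact (h1 _).trans (mul_le_mul_of_nonneg_right (by linarith) h3)
  · rw [hz, zpow_neg, zpow_natCast, ← inv_pow, Int.natAbs_neg, Int.natAbs_natCast]
    exact (h2 _).trans (mul_le_mul_of_nonneg_right (by linarith) h3)

theorem PowBound.mono {W : Type*} [NormedAddCommGroup W] [NormedSpace ℂ W] {T : (W →L[ℂ] W)ˣ}
    {Λ D D' : ℝ} (h : PowBound T Λ D) (hΛ : 0 ≤ Λ) (hD : D ≤ D') : PowBound T Λ D' := fun z =>
  (h z).trans (mul_le_mul_of_nonneg_right hD (by positivity))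

/-- A matrix without nonzero fixed vectors on the dual lattice has no nonzero fixed vectors. -/
theorem exists_sub_matOp_inverse {M : Matrix.GeneralLinearGroup (Fin d) ℤ}
    (h : ∀ n : Fin d → ℤ, n ≠ 0 → dualAct M n ≠ n) :
    ∃ L₀ : (Fin d → ℂ) →L[ℂ] (Fin d → ℂ),
      (∀ w, L₀ w - (matOp d M : (Fin d → ℂ) →L[ℂ] (Fin d → ℂ)) (L₀ w) = w) ∧
      ∀ w, w - (matOp d M : (Fin d → ℂ) →L[ℂ] (Fin d → ℂ)) w = 0 → w = 0 := by
  have hdet : (1 - M.val : Matrix (Fin d) (Fin d) ℤ).det ≠ 0 := by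
    intro h0
    obtain ⟨n, hn, hn0⟩ := Matrix.exists_vecMul_eq_zero_iff.2 h0
    rw [Matrix.vecMul_sub, Matrix.vecMul_one, sub_eq_zero] at hn0
    exact h n hn hn0.symm
  have hinj : ∀ w, w - (matOp d M : (Fin d → ℂ) →L[ℂ] (Fin d → ℂ)) w = 0 → w = 0 := by
    intro w hw
    by_contra hw0
    apply hdet
    have h1 : ((1 - M.val : Matrix (Fin d) (Fin d) ℤ).map (Int.cast : ℤ → ℂ)).det = 0 := by
      refine Matrix.exists_mulVec_eq_zero_iff.1 ⟨w, hw0, ?_⟩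
      rw [Matrix.map_sub _ Int.cast_sub, Matrix.map_one _ Int.cast_zero Int.cast_one, Matrix.sub_mulVec,
        Matrix.one_mulVec]
      exact hw
    have h2 := (Int.castRingHom ℂ).map_det (1 - M.val : Matrix (Fin d) (Fin d) ℤ)
    have h3 : ((1 - M.val : Matrix (Fin d) (Fin d) ℤ).det : ℂ) = 0 := h2.trans h1
    exact_mod_cast h3
  let F : (Fin d → ℂ) →ₗ[ℂ] (Fin d → ℂ) :=
    LinearMap.id - (matOp d M : (Fin d → ℂ) →L[ℂ] (Fin d → ℂ)).toLinearMap
  have hF : Function.Injective F := (injective_iff_map_eq_zero F).2 hinj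
  let e := LinearEquiv.ofInjectiveEndo F hF
  exact ⟨LinearMap.toContinuousLinearMap e.symm.toLinearMap, fun w => e.apply_symm_apply w, hinj⟩

end MatrixOperator

/-! ### Real solutions and uniqueness -/

section RealSolution

variable {d s m : ℕ}

/-- The real common solution of two commuting cohomological equations, with tame estimates. -/
theorem exists_real_solution (s : ℕ) {A B : Matrix.GeneralLinearGroup (Fin d) ℤ}
    (hAB : Commute A B) (hH : HigherRank A B) {T T' : ((Fin m → ℂ) →L[ℂ] (Fin m → ℂ))ˣ}
    {t t' : (Fin m → ℝ) → Fin m → ℝ}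
    (ht : ∀ v, (T : (Fin m → ℂ) →L[ℂ] (Fin m → ℂ)) (ofRealVec m v) = ofRealVec m (t v))
    (ht' : ∀ v, (T' : (Fin m → ℂ) →L[ℂ] (Fin m → ℂ)) (ofRealVec m v) = ofRealVec m (t' v))
    (hre : ∀ w, reVec m ((T : (Fin m → ℂ) →L[ℂ] (Fin m → ℂ)) w) = t (reVec m w))
    (hre' : ∀ w, reVec m ((T' : (Fin m → ℂ) →L[ℂ] (Fin m → ℂ)) w) = t' (reVec m w))
    (hTT' : Commute T T') {Λ D θ : ℝ} {q : ℕ} (hΛ : 0 < Λ) (hT : PowBound T Λ D)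
    (hT' : PowBound T' Λ D) (hθ : 0 < θ) (hθ1 : θ < 1)
    (hdich : ∀ N₀ : ℕ, ∃ C : ℝ, 0 ≤ C ∧ ∀ n : Fin d → ℤ, n ≠ 0 →
      (∀ N l : ℕ, q ≤ N → N ≤ N₀ → Λ ^ l * (‖dualAct (A ^ l) n‖ ^ N)⁻¹ ≤
        C * (θ ^ l * (‖n‖ ^ (N - q))⁻¹)) ∨
      (∀ N l : ℕ, q ≤ N → N ≤ N₀ → Λ ^ l * (‖dualAct (A⁻¹ ^ l) n‖ ^ N)⁻¹ ≤
        C * (θ ^ l * (‖n‖ ^ (N - q))⁻¹)))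
    (L₀ : (Fin m → ℂ) →L[ℂ] (Fin m → ℂ)) :
    ∃ C : ℕ → ℝ≥0, ∀ R S : Torus d × Torus s → Fin m → ℝ, TorusSmooth R → TorusSmooth S →
      (∀ z : Torus d × Torus s,
        R (torusAut B z.1, z.2) - t' (R z) = S (torusAut A z.1, z.2) - t (S z)) →
      (∀ y, L₀ (baseCoeff (fun z => ofRealVec m (R z)) 0 y) -
        (T : (Fin m → ℂ) →L[ℂ] (Fin m → ℂ)) (L₀ (baseCoeff (fun z => ofRealVec m (R z)) 0 y)) =
        baseCoeff (fun z => ofRealVec m (R z)) 0 y) →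
      (∀ y, L₀ (baseCoeff (fun z => ofRealVec m (R z)) 0 y) -
        (T' : (Fin m → ℂ) →L[ℂ] (Fin m → ℂ)) (L₀ (baseCoeff (fun z => ofRealVec m (R z)) 0 y)) =
        baseCoeff (fun z => ofRealVec m (S z)) 0 y) →
      ∃ Ω : Torus d × Torus s → Fin m → ℝ, TorusSmooth Ω ∧
        (∀ z : Torus d × Torus s, Ω (torusAut A z.1, z.2) - t (Ω z) = R z) ∧
        (∀ z : Torus d × Torus s, Ω (torusAut B z.1, z.2) - t' (Ω z) = S z) ∧
        (∀ y, ∫ x, Ω (x, y) = reVec m (L₀ (baseCoeff (fun z => ofRealVec m (R z)) 0 y))) ∧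
        ∀ r, crNorm r Ω ≤ C r * crNorm (r + q + d + 1) R := by
  obtain ⟨K, hK, h⟩ := exists_smooth_solution s hAB hH hTT' hΛ hT hT' hθ hθ1 hdich L₀
  refine ⟨fun r => (K r).toNNReal, fun R S hR hS hRS hA0 hB0 => ?_⟩
  have hRs : ProdSmooth R := hR
  have hSs : ProdSmooth S := hS
  obtain ⟨Ω, hΩ, hΩA, hΩB, hΩ0, hb⟩ := h _ _ (hRs.clm_comp (ofRealVec m))
    (hSs.clm_comp (ofRealVec m)) (fun z => by
      rw [ht, ht', ← map_sub, ← map_sub, hRS]) hA0 hB0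
  refine ⟨fun z => reVec m (Ω z), hΩ.clm_comp (reVec m), fun z => ?_, fun z => ?_, fun y => ?_,
    fun r => ?_⟩
  · rw [← hre, ← map_sub, hΩA, reVec_ofRealVec]
  · rw [← hre', ← map_sub, hΩB, reVec_ofRealVec]
  · rw [integral_reVec hΩ.continuous, hΩ0]
  · have htop := crNorm_ne_top hR (r + q + d + 1)
    refine (crNorm_reVec_le hΩ (hb r (crNorm (r + q + d + 1) R).toReal fun Ls hLs z => ?_)).trans ?_
    · rw [torusDerivs_clm_comp _ hRs, norm_ofRealVec]
      have h1 := ENNReal.toReal_mono htop (enorm_torusDerivs_le_crNorm hR hLs z)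
      rwa [toReal_enorm] at h1
    · rw [ENNReal.ofReal_mul (hK r), ENNReal.ofReal_toReal htop]
      rfl

/-- The difference solves the homogeneous equation, so only its zeroth coefficient can survive. The
alternatives in `h0` kill that coefficient in the twisted and in the untwisted case respectively. -/
theorem eq_of_torusAut_sub_eq {A B : Matrix.GeneralLinearGroup (Fin d) ℤ} (hAB : Commute A B)
    (hH : HigherRank A B) {T : ((Fin m → ℂ) →L[ℂ] (Fin m → ℂ))ˣ} {t : (Fin m → ℝ) → Fin m → ℝ}
    (ht : ∀ v, (T : (Fin m → ℂ) →L[ℂ] (Fin m → ℂ)) (ofRealVec m v) = ofRealVec m (t v))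
    {Λ D : ℝ} (hΛ : 0 < Λ) (hT : PowBound T Λ D) {Ω Ω' : Torus d × Torus s → Fin m → ℝ}
    (hΩ : TorusSmooth Ω) (hΩ' : TorusSmooth Ω')
    (h : ∀ z : Torus d × Torus s,
      Ω (torusAut A z.1, z.2) - t (Ω z) = Ω' (torusAut A z.1, z.2) - t (Ω' z))
    (h0 : (∀ w, w - (T : (Fin m → ℂ) →L[ℂ] (Fin m → ℂ)) w = 0 → w = 0) ∨
      ∀ y, ∫ x, Ω (x, y) = ∫ x, Ω' (x, y)) : Ω = Ω' := by
  have hs : ProdSmooth Ω := hΩ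
  have hs' : ProdSmooth Ω' := hΩ'
  have hf := (hs.clm_comp (ofRealVec m))
  have hf' := (hs'.clm_comp (ofRealVec m))
  have hsub : ProdSmooth fun z => ofRealVec m (Ω z) - ofRealVec m (Ω' z) := ContDiff.sub hf hf'
  have heq : ∀ z : Torus d × Torus s, (ofRealVec m (Ω (torusAut A z.1, z.2)) -
      ofRealVec m (Ω' (torusAut A z.1, z.2))) - (T : (Fin m → ℂ) →L[ℂ] (Fin m → ℂ))
      (ofRealVec m (Ω z) - ofRealVec m (Ω' z)) = 0 := by
    intro z
    rw [map_sub, ht, ht, sub_sub_sub_comm, ← map_sub, ← map_sub, h, sub_self]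
  have hzero := eq_zero_of_torusAut_eq hAB hH hΛ hT hsub heq fun y => by
    rcases h0 with h0 | h0
    · apply h0
      have h1 := baseCoeff_torusAut_sub hsub.continuous hH.measurePreserving_left
        (T : (Fin m → ℂ) →L[ℂ] (Fin m → ℂ)) 0 y
      simp only [heq, dualAct_zero] at h1
      rw [← h1]
      simp [baseCoeff]
    · rw [baseCoeff_sub hf.continuous hf'.continuous, baseCoeff_zero, baseCoeff_zero,
        integral_ofRealVec hs.continuous, integral_ofRealVec hs'.continuous, h0, sub_self]
  funext z
  have h1 := congrFun hzero z
  simp only [Pi.zero_apply, sub_eq_zero] at h1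
  exact ofRealVec_injective h1

end RealSolution

/-! ### Choice of constants and the two cases -/

section Constants

variable {d : ℕ}

/-- Supplies the time step of the counting argument from the set of eigenvalues alone, so that the
growth rate depends on nothing else but `d`. -/
theorem exists_expansion_time {a : Set ℂ} (ha : a.Finite) :
    ∃ t : ℕ, 0 < t ∧ ∀ z ∈ a, 1 < ‖z‖ → 2 ≤ ‖z‖ ^ t := by
  have h1 : ∀ z : ℂ, ∃ t : ℕ, 1 < ‖z‖ → 2 ≤ ‖z‖ ^ t := fun z => by
    by_cases hz : 1 < ‖z‖
    · obtain ⟨t, ht⟩ := pow_unbounded_of_one_lt 2 hz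
      exact ⟨t, fun _ => ht.le⟩
    · exact ⟨0, fun h => absurd h hz⟩
  choose t ht using h1
  refine ⟨∑ z ∈ ha.toFinset, t z + 1, Nat.succ_pos _, fun z hz hz1 => (ht z hz1).trans ?_⟩
  refine pow_le_pow_right₀ hz1.le ?_
  have := Finset.single_le_sum (f := t) (fun z _ => Nat.zero_le _) (ha.mem_toFinset.2 hz)
  omega

theorem exists_norm_le_of_finite {a : Set ℂ} (ha : a.Finite) :
    ∃ ρ : ℝ, 0 ≤ ρ ∧ ∀ z ∈ a, ‖z‖ ≤ ρ ∧ ‖z⁻¹‖ ≤ ρ := by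
  refine ⟨∑ z ∈ ha.toFinset, (‖z‖ + ‖z⁻¹‖), by positivity, fun z hz => ?_⟩
  have := Finset.single_le_sum (f := fun z : ℂ => ‖z‖ + ‖z⁻¹‖) (fun z _ => by positivity)
    (ha.mem_toFinset.2 hz)
  have h1 := norm_nonneg z
  have h2 := norm_nonneg z⁻¹
  constructor <;> linarith

theorem finite_eigenvalueSet (M : Matrix.GeneralLinearGroup (Fin d) ℤ) :
    (eigenvalueSet M).Finite := Matrix.finite_spectrum _

theorem exists_growth_rate (d t : ℕ) (ht : 0 < t) :
    ∃ τ : ℝ, 0 < τ ∧ ∀ A B : Matrix.GeneralLinearGroup (Fin d) ℤ, Commute A B → DualFree A B →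
      (∀ z ∈ eigenvalueSet A, 1 < ‖z‖ → 2 ≤ ‖z‖ ^ t) →
      ∃ c : ℝ, 0 < c ∧ ∀ n : Fin d → ℤ, n ≠ 0 → ∀ l : ℕ,
        c * Real.exp (τ * l) ≤ ‖n‖ + ‖dualAct (A ^ l) n‖ := by
  rcases Nat.eq_zero_or_pos d with rfl | hd
  · exact ⟨1, one_pos, fun _ _ _ _ _ => ⟨1, one_pos, fun n hn => absurd (Subsingleton.elim n 0) hn⟩⟩
  · exact exists_exp_le_norm_add_norm hd t ht

end Constants

/-- The twisted case, with a loss of derivatives determined by the eigenvalues. -/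
theorem exists_twisted_loss (d : ℕ) (a b : Set ℂ) : ∃ σ : ℕ, 0 < σ ∧
    ∀ (s : ℕ) (A B : Matrix.GeneralLinearGroup (Fin d) ℤ), Commute A B → HigherRank A B →
      eigenvalueSet A = a → eigenvalueSet B = b →
      ∃ C : ℕ → ℝ≥0, ∀ R S : Torus d × Torus s → Fin d → ℝ,
        TorusSmooth R → TorusSmooth S → opL1 A B R S = 0 →
        ∃ Ω : Torus d × Torus s → Fin d → ℝ, IsTwistedSolution A B R S Ω ∧
          (∀ Ω' : Torus d × Torus s → Fin d → ℝ, IsTwistedSolution A B R S Ω' → Ω' = Ω) ∧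
          ∀ r : ℕ, crNorm r Ω ≤ C r * crNorm (r + σ) R := by
  by_cases hab : a.Finite ∧ b.Finite
  swap
  -- An infinite set is no eigenvalue set, so any loss will do.
  · refine ⟨1, one_pos, fun s A B _ _ hA hB => absurd ⟨?_, ?_⟩ hab⟩
    · rw [← hA]; exact finite_eigenvalueSet A
    · rw [← hB]; exact finite_eigenvalueSet B
  obtain ⟨t, ht, hat⟩ := exists_expansion_time hab.1
  obtain ⟨ρ, hρ, hρab⟩ := exists_norm_le_of_finite (hab.1.union hab.2)
  obtain ⟨τ, hτ, hgrow⟩ := exists_growth_rate d t ht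
  have hΛ : 0 < ρ + 1 := by linarith
  -- `p` solves `e^(τ p) = 2 (ρ + 1)`: the growth bound to the power `p` compensates the operator
  -- growth `Λ = ρ + 1` with `θ = 1/2`. All of `τ`, `ρ`, `p`, `q` come from `d`, `a` and `b` only.
  set p : ℝ := Real.log (2 * (ρ + 1)) / τ with hp
  have hp0 : 0 < p := div_pos (Real.log_pos (by linarith)) hτ
  have hpτ : (1 / 2 : ℝ)⁻¹ * (ρ + 1) ≤ Real.exp (τ * p) := by
    rw [hp, mul_div_cancel₀ _ hτ.ne', Real.exp_log (by positivity)]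
    norm_num
  obtain ⟨q, hq⟩ := exists_nat_ge (2 * p + 1 / 4)
  refine ⟨q + d + 1, Nat.succ_pos _, fun s A B hAB hH hA hB => ?_⟩
  have hfree := hH.dualFree
  obtain ⟨c, hc, hcA⟩ := hgrow A B hAB hfree (by rwa [hA])
  obtain ⟨D, hD⟩ := exists_powBound_matOp A hρ fun z hz => hρab z (Or.inl (hA ▸ hz))
  obtain ⟨D', hD'⟩ := exists_powBound_matOp B hρ fun z hz => hρab z (Or.inr (hB ▸ hz))
  have hT := hD.mono hΛ.le (le_max_left D D')
  have hT' := hD'.mono hΛ.le (le_max_right D D')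
  obtain ⟨L₀, hL₀, hinj⟩ := exists_sub_matOp_inverse (M := A) fun n hn => by
    simpa [dualAct] using hfree 1 0 (by simp) n hn
  have hcomm : Commute (matOp d A) (matOp d B) := hAB.map (matOp d)
  obtain ⟨C, hC⟩ := exists_real_solution s hAB hH (matOp_ofRealVec A) (matOp_ofRealVec B)
    (reVec_matOp A) (reVec_matOp B) hcomm hΛ hT hT' (θ := 1 / 2) (q := q) (by norm_num)
    (by norm_num)
    (fun N₀ => exists_pow_mul_inv_pow_dualAct_le hτ hc hcA hp0 (by norm_num) hpτ hΛ.le hq N₀) L₀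
  refine ⟨C, fun R S hR hS hRS => ?_⟩
  have hrel : ∀ z : Torus d × Torus s,
      R (torusAut B z.1, z.2) - linAct B (R z) = S (torusAut A z.1, z.2) - linAct A (S z) :=
    fun z => sub_eq_zero.1 (congrFun hRS z)
  have hRs : ProdSmooth R := hR
  have hSs : ProdSmooth S := hS
  obtain ⟨Ω, hΩ, hΩA, hΩB, -, hb⟩ := hC R S hR hS hrel (fun y => hL₀ _) fun y => by
    have h1 := baseCoeff_torusAut_sub (hRs.clm_comp (ofRealVec d)).continuous
      hH.measurePreserving_right (matOp d B : (Fin d → ℂ) →L[ℂ] (Fin d → ℂ)) 0 y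
    have h2 := baseCoeff_torusAut_sub (hSs.clm_comp (ofRealVec d)).continuous
      hH.measurePreserving_left (matOp d A : (Fin d → ℂ) →L[ℂ] (Fin d → ℂ)) 0 y
    simp only [matOp_ofRealVec, ← map_sub, hrel, dualAct_zero] at h1 h2
    set u := baseCoeff (fun z => ofRealVec d (R z)) 0 y
    set w := baseCoeff (fun z => ofRealVec d (S z)) 0 y
    have h3 : ∀ x, (matOp d A : (Fin d → ℂ) →L[ℂ] (Fin d → ℂ))
        ((matOp d B : (Fin d → ℂ) →L[ℂ] (Fin d → ℂ)) x) =
        (matOp d B : (Fin d → ℂ) →L[ℂ] (Fin d → ℂ))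
        ((matOp d A : (Fin d → ℂ) →L[ℂ] (Fin d → ℂ)) x) := fun x =>
      congrArg (fun U : ((Fin d → ℂ) →L[ℂ] (Fin d → ℂ))ˣ =>
        (U : (Fin d → ℂ) →L[ℂ] (Fin d → ℂ)) x) hcomm.eq
    -- The zeroth coefficient was chosen to solve the equation over `A`. That it also solves the one
    -- over `B` is checked after applying the injective operator `1 - A`, which commutes with `B`,
    -- using the relation at frequency zero.
    rw [← sub_eq_zero]
    apply hinj
    have h4 := h1.symm.trans h2
    rw [map_sub, map_sub, h3]
    have h5 := congrArg (matOp d B : (Fin d → ℂ) →L[ℂ] (Fin d → ℂ)) (hL₀ u)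
    rw [map_sub] at h5
    have h6 := hL₀ u
    have h7 : ∀ x1 x2 x3 x4 w1 w2 u1 u2 : Fin d → ℂ, u1 - u2 = w1 - w2 → x2 - x3 = u2 →
        x1 - x4 = u1 → x1 - x2 - w1 - (x4 - x3 - w2) = 0 := by
      intro x1 x2 x3 x4 w1 w2 u1 u2 e1 e2 e3
      rw [← e2, ← e3] at e1
      have := sub_eq_zero.2 e1
      rw [← this]
      abel
    exact h7 _ _ _ _ _ _ _ _ h4 h5 h6
  refine ⟨Ω, ⟨hΩ, funext hΩA, funext hΩB⟩, fun Ω' hΩ' => ?_, fun r => ?_⟩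
  · refine eq_of_torusAut_sub_eq hAB hH (matOp_ofRealVec A) hΛ hT hΩ'.1 hΩ (fun z => ?_)
      (Or.inl hinj)
    rw [hΩA]
    exact congrFun hΩ'.2.1 z
  · simpa only [add_assoc] using hb r

/-- The untwisted case. -/
theorem exists_untwisted_solution (d s m : ℕ) (A B : Matrix.GeneralLinearGroup (Fin d) ℤ)
    (hAB : Commute A B) (hH : HigherRank A B) :
    ∃ C : ℕ → ℝ≥0, ∀ R S : Torus d × Torus s → Fin m → ℝ,
      TorusSmooth R → TorusSmooth S → opL2 A B R S = 0 → ZeroBaseAverage R → ZeroBaseAverage S →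
      ∃ Ω : Torus d × Torus s → Fin m → ℝ, IsUntwistedSolution A B R S Ω ∧
        (∀ Ω' : Torus d × Torus s → Fin m → ℝ, IsUntwistedSolution A B R S Ω' → Ω' = Ω) ∧
        ∀ r : ℕ, crNorm r Ω ≤ C r * crNorm (r + d + 2) R := by
  have hfree := hH.dualFree
  obtain ⟨t, ht, hat⟩ := exists_expansion_time (finite_eigenvalueSet A)
  obtain ⟨τ, hτ, hgrow⟩ := exists_growth_rate d t ht
  obtain ⟨c, hc, hcA⟩ := hgrow A B hAB hfree hat
  have hT : PowBound (1 : ((Fin m → ℂ) →L[ℂ] (Fin m → ℂ))ˣ) 1 1 := fun z => by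
    have h1 : ‖(1 : (Fin m → ℂ) →L[ℂ] (Fin m → ℂ))‖ ≤ 1 := ContinuousLinearMap.norm_id_le
    simpa using h1
  have hθ1 : Real.exp (-(τ * (1 / 4))) < 1 := Real.exp_lt_one_iff.2 (by linarith)
  -- Without operator growth (`Λ = 1`) a small `p` suffices: `p = 1/4` gives `2 p + 1/4 = 3/4 ≤ 1`,
  -- so `q = 1` and the loss is `q + d + 1 = d + 2`; `θ = e^(-τ p)` is still below one. The final
  -- `0` is `L₀`, as the averages vanish.
  obtain ⟨C, hC⟩ := exists_real_solution s hAB hH (t := fun v => v) (t' := fun v => v) (m := m)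
    (T := 1) (T' := 1) (fun v => rfl) (fun v => rfl) (fun v => rfl) (fun v => rfl)
    (Commute.refl 1) one_pos hT hT (Real.exp_pos _) hθ1 (q := 1)
    (fun N₀ => exists_pow_mul_inv_pow_dualAct_le hτ hc hcA (p := 1 / 4) (by norm_num)
      (Real.exp_pos _) (by rw [← Real.exp_neg, neg_neg, mul_one]) zero_le_one (by norm_num) N₀) 0
  refine ⟨C, fun R S hR hS hRS hR0 hS0 => ?_⟩
  have hRs : ProdSmooth R := hR
  have hSs : ProdSmooth S := hS
  have hR0' : ∀ y, baseCoeff (fun z => ofRealVec m (R z)) 0 y = 0 := fun y => by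
    rw [baseCoeff_zero, integral_ofRealVec hRs.continuous, hR0, map_zero]
  have hS0' : ∀ y, baseCoeff (fun z => ofRealVec m (S z)) 0 y = 0 := fun y => by
    rw [baseCoeff_zero, integral_ofRealVec hSs.continuous, hS0, map_zero]
  obtain ⟨Ω, hΩ, hΩA, hΩB, hΩ0, hb⟩ := hC R S hR hS (fun z => sub_eq_zero.1 (congrFun hRS z))
    (fun y => by rw [hR0']; simp) (fun y => by rw [hR0', hS0']; simp)
  have hΩ0' : ZeroBaseAverage Ω := fun y => by
    rw [hΩ0, hR0', map_zero, map_zero]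
  refine ⟨Ω, ⟨hΩ, hΩ0', funext hΩA, funext hΩB⟩, fun Ω' hΩ' => ?_, fun r => ?_⟩
  · refine eq_of_torusAut_sub_eq hAB hH (t := fun v => v) (T := 1) (fun v => rfl) one_pos hT
      hΩ'.1 hΩ (fun z => ?_) (Or.inr fun y => by rw [hΩ'.2.1 y, hΩ0' y])
    rw [hΩA]
    exact congrFun hΩ'.2.2.1 z
  · have h1 : r + 1 + d + 1 = r + d + 2 := by omega
    rw [← h1]
    exact hb r

theorem proposition5p3 :
    -- twisted case; the loss `σ₁` depends only on `d` and on the eigenvalues of `A` and `B`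
    (∃ σ₁ : ℕ → Set ℂ → Set ℂ → ℕ, (∀ d a b, 0 < σ₁ d a b) ∧
      ∀ (d s : ℕ) (A B : Matrix.GeneralLinearGroup (Fin d) ℤ), Commute A B → HigherRank A B →
        ∃ C : ℕ → ℝ≥0, ∀ R S : Torus d × Torus s → Fin d → ℝ,
          TorusSmooth R → TorusSmooth S → opL1 A B R S = 0 →
          ∃ Ω : Torus d × Torus s → Fin d → ℝ,
            IsTwistedSolution A B R S Ω ∧
            (∀ Ω' : Torus d × Torus s → Fin d → ℝ, IsTwistedSolution A B R S Ω' → Ω' = Ω) ∧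
            ∀ r : ℕ, crNorm r Ω ≤
              C r * crNorm (r + σ₁ d (eigenvalueSet A) (eigenvalueSet B)) R) ∧
    -- untwisted case
    (∀ (d s : ℕ) (A B : Matrix.GeneralLinearGroup (Fin d) ℤ), Commute A B → HigherRank A B →
      ∃ C : ℕ → ℝ≥0, ∀ R S : Torus d × Torus s → Fin s → ℝ,
        TorusSmooth R → TorusSmooth S → opL2 A B R S = 0 →
        ZeroBaseAverage R → ZeroBaseAverage S →
        ∃ Ω : Torus d × Torus s → Fin s → ℝ,
          IsUntwistedSolution A B R S Ω ∧
          (∀ Ω' : Torus d × Torus s → Fin s → ℝ, IsUntwistedSolution A B R S Ω' → Ω' = Ω) ∧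
          ∀ r : ℕ, crNorm r Ω ≤ C r * crNorm (r + d + 2) R) := by
  refine ⟨?_, fun d s A B hAB hH => exists_untwisted_solution d s s A B hAB hH⟩
  -- The loss is selected from `d` and the two eigenvalue sets before `s`, `A` and `B` are given.
  choose σ hσ h using exists_twisted_loss
  exact ⟨σ, hσ, fun d s A B hAB hH => h d _ _ s A B hAB hH rfl rfl⟩
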